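/- **Setting.** Let $S$ be a countable inverse semigroup with zero (every $s\in S$ has a unique $s^*$ with $ss^*s=s$, $s^*ss^*=s^*$), and let $E=E(S)$ be its semilattice of idempotents, with $e\le f\iff ef=e$ and $e\wedge f=ef$. Two elements $x,y\in E$ *intersect* if there is a nonzero $z\in E$ with $z\le x$, $z\le y$; otherwise $x\perp y$. For finite $X,Y\subseteq E$ let $E^{X,Y}=\{z\in E: z\le x\ \forall x\in X,\ z\perp y\ \forall y\in Y\}$. A subset $Z\subseteq F\subseteq E$ is a *cover* for $F$ if every nonzero $x\in F$ intersects some $z\in Z$. A map $\beta$ from $E$ to a Boolean algebra is *tight* if $\beta(0)=0$, $\beta(x\wedge y)=\beta(x)\wedge\beta(y)$, and $$\bigvee_{z\in Z}\beta(z)\ \ge\ \bigwedge_{x\in X}\beta(x)\wedge\bigwedge_{y\in Y}\neg\beta(y)$$ for all finite (possibly empty) $X,Y\subseteq E$ and every finite (possibly empty) cover $Z$ for $E^{X,Y}$ (empty suprema are $0$, empty infima are $1$). **The groupoid.** Let $\widehat E_{\rm tight}$ be the space, with the topology of pointwise convergence, of all nonzero multiplicative maps $\varphi:E\to\{0,1\}$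 that are tight. The semigroup $S$ acts on it: $\theta_s$ has domain $D_{s^*s}=\{\varphi:\varphi(s^*s)=1\}$ and $\theta_s(\varphi)(e)=\varphi(s^*es)$; its range is $D_{ss^*}$. Let $\mathcal G_{\rm tight}$ be the groupoid of germs $[s,\varphi]$, $\varphi\in D_{s^*s}$, where $[s,\varphi]=[t,\psi]$ iff $\varphi=\psi$ and $se=te$ for some $e\in E$ with $\varphi(e)=1$; the source, range, product and inverse are $d[s,\varphi]=\varphi$, $r[s,\varphi]=\theta_s(\varphi)$, $[s,\theta_t(\psi)][t,\psi]=[st,\psi]$ and $[s,\varphi]^{-1}=[s^*,\theta_s(\varphi)]$; the topology is generated by the sets $\{[s,\varphi]:\varphi\in U\}$ with $U\subseteq D_{s^*s}$ open. Let $C_c(\mathcal G_{\rm tight})$ be the linear span, in the space of all functions $\mathcal G_{\rm tight}\to\mathbb C$, of the functions that vanish outside some open Hausdorff subset $V$ and whose restriction to $V$ is continuous and compactly supported. It is a *-algebra for $(f\star g)(\gamma)=\sum_{\alpha\beta=\gamma}f(\alpha)g(\beta)$ and $f^*(\gamma)=\overline{f(\gamma^{-1})}$. Let $C^*(\mathcal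 G_{\rm tight})$ be its Hausdorff completion in the seminorm $f\mapsto\sup_\pi\|\pi(f)\|$, where $\pi$ runs over all *-representations of $C_c(\mathcal G_{\rm tight})$ on Hilbert spaces, and let $i:C_c(\mathcal G_{\rm tight})\to C^*(\mathcal G_{\rm tight})$ be the canonical map. For $s\in S$ let $1_{ss^*}$ be the characteristic function of $D_{ss^*}$, and let $1_{ss^*}\delta_s\in C_c(\mathcal G_{\rm tight})$ be the function equal to $1_{ss^*}\circ r$ on $\{[s,\varphi]:\varphi\in D_{s^*s}\}$ and to $0$ elsewhere. **Representations.** A representation of $S$ on a complex Hilbert space $H$ is a map $\sigma:S\to B(H)$ with $\sigma_{st}=\sigma_s\sigma_t$ and $\sigma_{s^*}=\sigma_s^*$. Let $A$ be the closed unital *-subalgebra of $B(H)$ generated by $\{\sigma_e:e\in E\}$. The representation $\sigma$ is *tight* if $e\mapsto\sigma_e$ is tight as a map from $E$ to the Boolean algebra of idempotents of the commutative algebra $A$ ($a\wedge b=ab$, $a\vee b=a+b-ab$, $\neg a=1-a$). A representation of $S$ or of $C^*(\mathcal G_{\rm tight})$ on $H$ is *nondegenerate* if the ranges of its operators together span a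 dense subspace of $H$. **Theorem.** For every Hilbert space $H$ there is a bijection $\sigma\leftrightarrow\rho$ between the tight representations $\sigma$ of $S$ on $H$ and the *-representations $\rho$ of $C^*(\mathcal G_{\rm tight})$ on $H$, the latter being required to be nondegenerate in the case where $E$ admits a finite cover, such that $$\rho\big(i(1_{ss^*}\delta_s)\big)=\sigma_s\qquad\text{for all } s\in S$$ whenever $\sigma$ and $\rho$ correspond to each other. Moreover $\sigma$ is nondegenerate if and only if the corresponding $\rho$ is. In particular, nondegenerate tight representations of $S$ correspond bijectively to nondegenerate *-representations of $C^*(\mathcal G_{\rm tight})$. -/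

import Mathlib

universe u v w

/-- An inverse semigroup: every `s` has exactly one generalized inverse, written `star s`. -/
class InverseSemigroup (S : Type*) extends Semigroup S, Star S where
  mul_star_mul_self (s : S) : s * star s * s = s
  star_mul_mul_star (s : S) : star s * s * star s = star s
  eq_star (s t : S) : s * t * s = s → t * s * t = t → t = star s

/-- An inverse semigroup with a zero element. -/
class InverseSemigroupWithZero (S : Type*) extends InverseSemigroup S, SemigroupWithZero S

namespace InverseSemigroup

section Basic

variable {S : Type u} [InverseSemigroup S]

theorem star_star_eq (s : S) : star (star s) = s :=
  (eq_star (star s) s (star_mul_mul_star s) (mul_star_mul_self s)).symm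

theorem star_of_idem {e : S} (he : e * e = e) : star e = e :=
  (eq_star e e (by rw [he, he]) (by rw [he, he])).symm

theorem idem_mul {e f : S} (he : e * e = e) (hf : f * f = f) : (e * f) * (e * f) = e * f := by
  have h1 := mul_star_mul_self (e * f)
  have h2 := star_mul_mul_star (e * f)
  set x := star (e * f) with hx
  have h3 : f * x * e = x := by
    apply eq_star
    · calc e * f * (f * x * e) * (e * f) = e * (f * f) * x * ((e * e) * f) := by
            simp only [mul_assoc]
        _ = e * f * x * (e * f) := by rw [he, hf]
        _ = e * f := h1
    · calc f * x * e * (e * f) * (f * x * e) = f * x * (e * e) * (f * f) * x * e := by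
            simp only [mul_assoc]
        _ = f * (x * (e * f) * x) * e := by rw [he, hf]; simp only [mul_assoc]
        _ = f * x * e := by rw [h2]
  have h4 : x * x = x := by
    calc x * x = (f * x * e) * (f * x * e) := by rw [h3]
      _ = f * (x * (e * f) * x) * e := by simp only [mul_assoc]
      _ = x := by rw [h2, h3]
  have h5 : star x = x := star_of_idem h4
  have h6 : e * f = x := by rw [← h5, hx, star_star_eq]
  rw [h6, h4]

theorem idem_comm {e f : S} (he : e * e = e) (hf : f * f = f) : e * f = f * e := by
  have h1 := idem_mul he hf
  have h2 := idem_mul hf he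
  have h3 : f * e = star (e * f) := by
    apply eq_star
    · calc e * f * (f * e) * (e * f) = e * (f * f) * (e * e) * f := by simp only [mul_assoc]
        _ = (e * f) * (e * f) := by rw [he, hf]; simp only [mul_assoc]
        _ = e * f := h1
    · calc f * e * (e * f) * (f * e) = f * (e * e) * (f * f) * e := by simp only [mul_assoc]
        _ = (f * e) * (f * e) := by rw [he, hf]; simp only [mul_assoc]
        _ = f * e := h2
  rw [h3, star_of_idem h1]

theorem idem_star_mul (s : S) : (star s * s) * (star s * s) = star s * s := by
  rw [← mul_assoc, star_mul_mul_star]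

theorem idem_mul_star (s : S) : (s * star s) * (s * star s) = s * star s := by
  rw [← mul_assoc, mul_star_mul_self]

theorem star_mul_rev (s t : S) : star (s * t) = star t * star s := by
  symm
  apply eq_star
  · calc s * t * (star t * star s) * (s * t) = s * ((t * star t) * (star s * s)) * t := by
          simp only [mul_assoc]
      _ = s * ((star s * s) * (t * star t)) * t := by
          rw [idem_comm (idem_mul_star t) (idem_star_mul s)]
      _ = (s * star s * s) * (t * star t * t) := by simp only [mul_assoc]
      _ = s * t := by rw [mul_star_mul_self, mul_star_mul_self]
  · calc star t * star s * (s * t) * (star t * star s)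
          = star t * ((star s * s) * (t * star t)) * star s := by simp only [mul_assoc]
      _ = star t * ((t * star t) * (star s * s)) * star s := by
          rw [idem_comm (idem_mul_star t) (idem_star_mul s)]
      _ = (star t * t * star t) * (star s * s * star s) := by simp only [mul_assoc]
      _ = star t * star s := by rw [star_mul_mul_star, star_mul_mul_star]

/-- Conjugates of idempotents are idempotent. -/
theorem idem_conj (s : S) {e : S} (he : e * e = e) :
    (star s * e * s) * (star s * e * s) = star s * e * s := by
  calc (star s * e * s) * (star s * e * s) = star s * (e * (s * star s)) * e * s := by
        simp only [mul_assoc]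
    _ = star s * ((s * star s) * e) * e * s := by rw [idem_comm he (idem_mul_star s)]
    _ = (star s * s * star s) * (e * e) * s := by simp only [mul_assoc]
    _ = star s * e * s := by rw [star_mul_mul_star, he]

end Basic

/-- The set `E(S)` of idempotents of `S`. -/
def Idem (S : Type u) [InverseSemigroup S] : Type u := {e : S // e * e = e}

section IdemOrder

variable {S : Type u} [InverseSemigroup S]

/-- `E(S)` is a semilattice for the order `e ≤ f ↔ e * f = e`, and `e ⊓ f = e * f`. -/
instance : SemilatticeInf (Idem S) where
  le e f := e.1 * f.1 = e.1
  le_refl e := e.2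
  le_trans a b c hab hbc := by
    change a.1 * b.1 = a.1 at hab
    change b.1 * c.1 = b.1 at hbc
    change a.1 * c.1 = a.1
    rw [← hab, mul_assoc, hbc]
  le_antisymm a b hab hba := by
    change a.1 * b.1 = a.1 at hab
    change b.1 * a.1 = b.1 at hba
    apply Subtype.ext
    rw [← hab, idem_comm a.2 b.2, hba]
  inf a b := ⟨a.1 * b.1, idem_mul a.2 b.2⟩
  inf_le_left a b := by
    change a.1 * b.1 * a.1 = a.1 * b.1
    rw [idem_comm a.2 b.2, mul_assoc, a.2]
  inf_le_right a b := by
    change a.1 * b.1 * b.1 = a.1 * b.1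
    rw [mul_assoc, b.2]
  le_inf a b c hab hac := by
    change a.1 * b.1 = a.1 at hab
    change a.1 * c.1 = a.1 at hac
    change a.1 * (b.1 * c.1) = a.1
    rw [← mul_assoc, hab, hac]

@[simp] theorem Idem.coe_inf (a b : Idem S) : (a ⊓ b).1 = a.1 * b.1 := rfl

theorem Idem.le_iff (a b : Idem S) : a ≤ b ↔ a.1 * b.1 = a.1 := Iff.rfl

/-- The idempotent `s* e s`. -/
def conj (s : S) (e : Idem S) : Idem S := ⟨star s * e.1 * s, idem_conj s e.2⟩

/-- The idempotent `s* s`. -/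
def source (s : S) : Idem S := ⟨star s * s, idem_star_mul s⟩

end IdemOrder

/-- The least element of `E(S)` is `0`. -/
instance {S : Type u} [InverseSemigroupWithZero S] : OrderBot (Idem S) where
  bot := ⟨0, zero_mul 0⟩
  bot_le e := zero_mul e.1

theorem Idem.coe_bot {S : Type u} [InverseSemigroupWithZero S] : (⊥ : Idem S).1 = 0 := rfl

end InverseSemigroup

namespace Semilattice

section

variable {E : Type u} [SemilatticeInf E] [OrderBot E]

/-- `x` and `y` intersect: there is a nonzero `z` below both. Otherwise they are disjoint. -/
def Intersects (x y : E) : Prop := ∃ z : E, z ≠ ⊥ ∧ z ≤ x ∧ z ≤ y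

/-- The set `E^{X,Y}` of all `z` below every `x ∈ X` and disjoint from every `y ∈ Y`. -/
def between (X Y : Finset E) : Set E :=
  {z | (∀ x ∈ X, z ≤ x) ∧ ∀ y ∈ Y, ¬ Intersects z y}

/-- `Z` is a cover for `F`: `Z ⊆ F` and every nonzero `x ∈ F` intersects some `z ∈ Z`. -/
def IsCover (Z F : Set E) : Prop :=
  Z ⊆ F ∧ ∀ x ∈ F, x ≠ ⊥ → ∃ z ∈ Z, Intersects z x

variable (E) in
/-- The whole semilattice admits a finite cover. -/
def HasFiniteCover : Prop := ∃ Z : Finset E, IsCover (Z : Set E) Set.univ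

/-- Representations of a semilattice with zero in a Boolean algebra. -/
structure IsRep {B : Type v} [BooleanAlgebra B] (β : E → B) : Prop where
  map_bot : β ⊥ = ⊥
  map_inf : ∀ x y, β (x ⊓ y) = β x ⊓ β y

/-- Tight representations. Empty `X`, `Y`, `Z` are allowed; empty infima are `⊤` and empty
suprema are `⊥`. -/
structure IsTight {B : Type v} [BooleanAlgebra B] (β : E → B) : Prop extends IsRep β where
  tight : ∀ X Y Z : Finset E, IsCover (Z : Set E) (between X Y) →
    X.inf β ⊓ Y.inf (fun y => (β y)ᶜ) ≤ Z.sup β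

end

/-- The spectrum of a semilattice: nonzero multiplicative `{0,1}`-valued maps with the topology of
pointwise convergence. -/
def Spectrum (E : Type u) [SemilatticeInf E] : Type u :=
  {φ : E → Bool // (∃ e, φ e = true) ∧ ∀ e f, φ (e ⊓ f) = (φ e && φ f)}

instance (E : Type u) [SemilatticeInf E] : TopologicalSpace (Spectrum E) :=
  inferInstanceAs (TopologicalSpace {φ : E → Bool // _})

/-- The tight spectrum: the semicharacters that are tight representations in the Boolean algebra
`{0,1}` (in particular they vanish at the zero of `E`). -/
def tightSpectrum (E : Type u) [SemilatticeInf E] [OrderBot E] : Set (Spectrum E) :=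
  {φ | IsTight φ.1}

end Semilattice

open InverseSemigroup Semilattice

/-- An action of an inverse semigroup `S` on a space `X`: each `s` acts as a continuous bijection
`act s` from the open set `dom s` onto its image; products act as compositions on the largest
possible domain; the domains cover `X`. The values of `act s` outside `dom s` carry no meaning. -/
structure PartialAction (S : Type u) (X : Type v) [InverseSemigroup S] [TopologicalSpace X] where
  dom : S → Set X
  act : S → X → X
  isOpen_dom : ∀ s, IsOpen (dom s)
  continuousOn_act : ∀ s, ContinuousOn (act s) (dom s)
  injOn_act : ∀ s, Set.InjOn (act s) (dom s)
  mem_dom_mul : ∀ s t x, x ∈ dom (s * t) ↔ x ∈ dom t ∧ act t x ∈ dom s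
  act_mul : ∀ s t x, x ∈ dom (s * t) → act (s * t) x = act s (act t x)
  exists_mem_dom : ∀ x, ∃ s, x ∈ dom s

namespace PartialAction

section

variable {S : Type u} {X : Type v} [InverseSemigroup S] [TopologicalSpace X]
  (θ : PartialAction S X)

theorem act_idem {e : S} (he : e * e = e) {x : X} (hx : x ∈ θ.dom e) : θ.act e x = x := by
  have h1 : x ∈ θ.dom (e * e) := by rwa [he]
  have h2 := θ.act_mul e e x h1
  rw [he] at h2
  exact (θ.injOn_act e hx ((θ.mem_dom_mul e e x).1 h1).2 h2).symm

theorem mem_dom_source {s : S} {x : X} : x ∈ θ.dom (star s * s) ↔ x ∈ θ.dom s := by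
  refine ⟨fun h => ((θ.mem_dom_mul _ _ _).1 h).1, fun h => ?_⟩
  have h1 : x ∈ θ.dom (s * (star s * s)) := by rwa [← mul_assoc, mul_star_mul_self]
  exact ((θ.mem_dom_mul _ _ _).1 h1).1

theorem act_mem_dom_star {s : S} {x : X} (hx : x ∈ θ.dom s) : θ.act s x ∈ θ.dom (star s) :=
  ((θ.mem_dom_mul _ _ _).1 (θ.mem_dom_source.2 hx)).2

theorem act_star_act {s : S} {x : X} (hx : x ∈ θ.dom s) : θ.act (star s) (θ.act s x) = x := by
  rw [← θ.act_mul _ _ _ (θ.mem_dom_source.2 hx)]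
  exact θ.act_idem (idem_star_mul s) (θ.mem_dom_source.2 hx)

theorem act_star_mem_dom {s : S} {x : X} (hx : x ∈ θ.dom (star s)) : θ.act (star s) x ∈ θ.dom s := by
  have := θ.act_mem_dom_star hx
  rwa [star_star_eq] at this

theorem act_act_star {s : S} {x : X} (hx : x ∈ θ.dom (star s)) : θ.act s (θ.act (star s) x) = x := by
  have := θ.act_star_act hx
  rwa [star_star_eq] at this

/-- Multiplying by an idempotent on the right does not change the action. -/
theorem mem_dom_mul_idem {s e : S} (he : e * e = e) {x : X} :
    x ∈ θ.dom (s * e) ↔ x ∈ θ.dom e ∧ x ∈ θ.dom s := by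
  rw [θ.mem_dom_mul]
  constructor
  · rintro ⟨h1, h2⟩; exact ⟨h1, by rwa [θ.act_idem he h1] at h2⟩
  · rintro ⟨h1, h2⟩; exact ⟨h1, by rwa [θ.act_idem he h1]⟩

theorem act_mul_idem {s e : S} (he : e * e = e) {x : X} (h1 : x ∈ θ.dom e) (h2 : x ∈ θ.dom s) :
    θ.act (s * e) x = θ.act s x := by
  rw [θ.act_mul _ _ _ ((θ.mem_dom_mul_idem he).2 ⟨h1, h2⟩), θ.act_idem he h1]

/-- The restriction of an action to an invariant subset. -/
noncomputable def restrict (Y : Set X) (hY : ∀ s, ∀ x ∈ θ.dom s, x ∈ Y → θ.act s x ∈ Y) :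
    PartialAction S Y := by
  classical
  exact
  { dom := fun s => {x | x.1 ∈ θ.dom s}
    act := fun s x => if h : x.1 ∈ θ.dom s then ⟨θ.act s x.1, hY s x.1 h x.2⟩ else x
    isOpen_dom := fun s => (θ.isOpen_dom s).preimage continuous_subtype_val
    continuousOn_act := fun s => by
      rw [Topology.IsInducing.subtypeVal.continuousOn_iff]
      refine ((θ.continuousOn_act s).comp continuous_subtype_val.continuousOn
        (fun x hx => hx)).congr ?_
      intro x hx
      have hx' : x.1 ∈ θ.dom s := hx
      simp [hx']
    injOn_act := fun s x hx y hy h => by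
      have hx' : x.1 ∈ θ.dom s := hx
      have hy' : y.1 ∈ θ.dom s := hy
      simp only [hx', hy', dif_pos, Subtype.mk.injEq] at h
      exact Subtype.ext (θ.injOn_act s hx' hy' h)
    mem_dom_mul := fun s t x => by
      simp only [Set.mem_ofPred_eq, θ.mem_dom_mul]
      constructor
      · rintro ⟨h1, h2⟩; exact ⟨h1, by simpa only [h1, dif_pos] using h2⟩
      · rintro ⟨h1, h2⟩; exact ⟨h1, by simpa only [h1, dif_pos] using h2⟩
    act_mul := fun s t x hx => by
      have hx' : x.1 ∈ θ.dom (s * t) := hx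
      obtain ⟨h1, h2⟩ := (θ.mem_dom_mul s t x).1 hx'
      simp only [hx', h1, h2, dif_pos, θ.act_mul s t x hx']
    exists_mem_dom := fun x => θ.exists_mem_dom x.1 }

/-- The set `Ω` of pairs `(s, x)` with `x` in the domain of `s`. -/
def Omega : Type (max u v) := {p : S × X // p.2 ∈ θ.dom p.1}

/-- `(s, x) ∼ (t, y)` iff `x = y` and `s e = t e` for an idempotent `e` with `x ∈ dom e`. -/
def germSetoid : Setoid θ.Omega where
  r a b := a.1.2 = b.1.2 ∧ ∃ e : S, e * e = e ∧ a.1.2 ∈ θ.dom e ∧ a.1.1 * e = b.1.1 * e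
  iseqv := by
    refine ⟨fun a => ⟨rfl, star a.1.1 * a.1.1, idem_star_mul _, θ.mem_dom_source.2 a.2, rfl⟩, ?_, ?_⟩
    · rintro a b ⟨h, e, he, hx, hs⟩
      exact ⟨h.symm, e, he, h ▸ hx, hs.symm⟩
    · rintro a b c ⟨h, e, he, hx, hs⟩ ⟨h', e', he', hx', hs'⟩
      refine ⟨h.trans h', e * e', idem_mul he he', ?_, ?_⟩
      · rw [θ.mem_dom_mul_idem he']; exact ⟨h ▸ hx', hx⟩
      · rw [← mul_assoc, hs, mul_assoc, idem_comm he he', ← mul_assoc, hs', mul_assoc]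

/-- The set of germs: the underlying set of the groupoid of germs. -/
def Germ : Type (max u v) := Quotient θ.germSetoid

variable {θ}

/-- The germ `[s, x]`. -/
def Germ.mk (s : S) (x : X) (hx : x ∈ θ.dom s) : θ.Germ := Quotient.mk θ.germSetoid ⟨(s, x), hx⟩

theorem Germ.ind {p : θ.Germ → Prop} (h : ∀ s x hx, p (Germ.mk s x hx)) (γ : θ.Germ) : p γ :=
  Quotient.ind (fun a => h a.1.1 a.1.2 a.2) γ

theorem Germ.mk_eq_mk {s t : S} {x y : X} {hx : x ∈ θ.dom s} {hy : y ∈ θ.dom t} :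
    Germ.mk s x hx = Germ.mk t y hy ↔
      x = y ∧ ∃ e : S, e * e = e ∧ x ∈ θ.dom e ∧ s * e = t * e :=
  Quotient.eq (r := θ.germSetoid)

/-- The source map `d [s, x] = x`. -/
def Germ.d : θ.Germ → X := Quotient.lift (fun a => a.1.2) (fun _ _ h => h.1)

/-- The range map `r [s, x] = θ_s(x)`. -/
def Germ.r : θ.Germ → X := Quotient.lift (fun a => θ.act a.1.1 a.1.2) (by
  rintro ⟨⟨s, x⟩, hx⟩ ⟨⟨t, y⟩, hy⟩ ⟨h, e, he, hxe, hs⟩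
  simp only at h hx hy hxe hs ⊢
  subst h
  rw [← θ.act_mul_idem he hxe hx, hs, θ.act_mul_idem he hxe hy])

@[simp] theorem Germ.d_mk (s : S) (x : X) (hx : x ∈ θ.dom s) : (Germ.mk s x hx).d = x := rfl
@[simp] theorem Germ.r_mk (s : S) (x : X) (hx : x ∈ θ.dom s) : (Germ.mk s x hx).r = θ.act s x := rfl

theorem germ_mul_aux {s t s' t' : S} {x y : X} (hx : x ∈ θ.dom s) (hy : y ∈ θ.dom t)
    (hx' : x ∈ θ.dom s') (hy' : y ∈ θ.dom t') (h : x = θ.act t y)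
    (hst : y ∈ θ.dom (s * t)) (hst' : y ∈ θ.dom (s' * t'))
    (h1 : Germ.mk s x hx = Germ.mk s' x hx') (h2 : Germ.mk t y hy = Germ.mk t' y hy') :
    Germ.mk (s * t) y hst = Germ.mk (s' * t') y hst' := by
  obtain ⟨_, e, he, hxe, hs⟩ := Germ.mk_eq_mk.1 h1
  obtain ⟨_, f, hf, hyf, ht⟩ := Germ.mk_eq_mk.1 h2
  refine Germ.mk_eq_mk.2 ⟨rfl, f * (star t * e * t), idem_mul hf (idem_conj t he), ?_, ?_⟩
  · rw [θ.mem_dom_mul_idem (idem_conj t he)]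
    refine ⟨?_, hyf⟩
    rw [θ.mem_dom_mul, θ.mem_dom_mul, ← h]
    refine ⟨hy, hxe, ?_⟩
    rw [θ.act_idem he hxe, h]; exact θ.act_mem_dom_star hy
  · have key : t * f * (star t * e * t) = e * (t * f) := by
      have h3 : t * f * star t = star (star t) * f * star t := by rw [star_star_eq]
      have h4 : (t * f * star t) * (t * f * star t) = t * f * star t := by
        rw [h3]; exact idem_conj (star t) hf
      calc t * f * (star t * e * t) = ((t * f * star t) * e) * t := by simp only [mul_assoc]
        _ = (e * (t * f * star t)) * t := by rw [idem_comm h4 he]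
        _ = e * t * (f * (star t * t)) := by simp only [mul_assoc]
        _ = e * t * ((star t * t) * f) := by rw [idem_comm hf (idem_star_mul t)]
        _ = e * (t * star t * t) * f := by simp only [mul_assoc]
        _ = e * (t * f) := by rw [mul_star_mul_self, mul_assoc]
    calc s * t * (f * (star t * e * t)) = s * (t * f * (star t * e * t)) := by
          simp only [mul_assoc]
      _ = (s * e) * (t * f) := by rw [key, mul_assoc]
      _ = s' * (e * (t * f)) := by rw [hs, mul_assoc]
      _ = s' * (t * f * (star t * e * t)) := by rw [key]
      _ = s' * t' * (f * (star t * e * t)) := by rw [ht]; simp only [mul_assoc]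

open Classical in
/-- The product `[s, x] [t, y] = [s t, y]`, defined when `x = θ_t(y)`, that is, when the source of
the first germ is the range of the second. (For other pairs the value carries no meaning.) -/
noncomputable def Germ.mul : θ.Germ → θ.Germ → θ.Germ :=
  Quotient.lift₂ (fun a b => if h : a.1.2 = θ.act b.1.1 b.1.2 then
      Germ.mk (a.1.1 * b.1.1) b.1.2 ((θ.mem_dom_mul _ _ _).2 ⟨b.2, h ▸ a.2⟩)
    else Germ.mk b.1.1 b.1.2 b.2) (by
  rintro ⟨⟨s, x⟩, hx⟩ ⟨⟨t, y⟩, hy⟩ ⟨⟨s', x'⟩, hx'⟩ ⟨⟨t', y'⟩, hy'⟩ h1 h2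
  have h1' : Germ.mk s x hx = Germ.mk s' x' hx' := Quotient.sound h1
  have h2' : Germ.mk t y hy = Germ.mk t' y' hy' := Quotient.sound h2
  obtain rfl : x = x' := h1.1
  obtain rfl : y = y' := h2.1
  have h3 : θ.act t y = θ.act t' y := congrArg Germ.r h2'
  simp only at hx hy hx' hy' ⊢
  by_cases h : x = θ.act t y
  · rw [dif_pos h, dif_pos (h.trans h3)]
    exact germ_mul_aux hx hy hx' hy' h _ _ h1' h2'
  · rw [dif_neg h, dif_neg (fun h' => h (h'.trans h3.symm))]
    exact h2')

theorem Germ.mk_mul_mk {s t : S} {x y : X} (hx : x ∈ θ.dom s) (hy : y ∈ θ.dom t)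
    (h : x = θ.act t y) : Germ.mul (Germ.mk s x hx) (Germ.mk t y hy) =
      Germ.mk (s * t) y ((θ.mem_dom_mul _ _ _).2 ⟨hy, h ▸ hx⟩) :=
  dif_pos h

/-- The inverse `[s, x]⁻¹ = [s*, θ_s(x)]`. -/
def Germ.inv : θ.Germ → θ.Germ :=
  Quotient.lift (fun a => Germ.mk (star a.1.1) (θ.act a.1.1 a.1.2) (θ.act_mem_dom_star a.2)) (by
  rintro ⟨⟨s, x⟩, hx⟩ ⟨⟨t, y⟩, hy⟩ h
  have h' : Germ.mk s x hx = Germ.mk t y hy := Quotient.sound h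
  obtain rfl : x = y := h.1
  obtain ⟨_, e, he, hxe, hs⟩ := h
  simp only at hx hy hxe hs ⊢
  refine Germ.mk_eq_mk.2 ⟨congrArg Germ.r h', star (star (s * e)) * e * star (s * e),
    idem_conj _ he, ?_, ?_⟩
  · have hse : x ∈ θ.dom (s * e) := (θ.mem_dom_mul_idem he).2 ⟨hxe, hx⟩
    have hact : θ.act (s * e) x = θ.act s x := θ.act_mul_idem he hxe hx
    rw [mul_assoc, θ.mem_dom_mul, θ.mem_dom_mul, star_star_eq]
    have h5 : θ.act (star (s * e)) (θ.act s x) = x := by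
      rw [← hact]; exact θ.act_star_act hse
    have h6 : θ.act s x ∈ θ.dom (star (s * e)) := by
      rw [← hact]; exact θ.act_mem_dom_star hse
    have h7 : θ.act s x ∈ θ.dom (e * star (s * e)) := by
      rw [θ.mem_dom_mul, h5]; exact ⟨h6, hxe⟩
    rw [θ.act_mul _ _ _ h7, h5, θ.act_idem he hxe]
    exact ⟨⟨h6, hxe⟩, hse⟩
  · have main : ∀ r : S, star r * (star (star (r * e)) * e * star (r * e)) = star (r * e) := by
      intro r
      rw [star_star_eq, star_mul_rev, star_of_idem he]
      calc star r * (r * e * e * (e * star r)) = (star r * r) * (e * (e * e)) * star r := by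
            simp only [mul_assoc]
        _ = ((star r * r) * e) * star r := by rw [he, he]
        _ = (e * (star r * r)) * star r := by rw [idem_comm (idem_star_mul r) he]
        _ = e * (star r * r * star r) := by simp only [mul_assoc]
        _ = e * star r := by rw [star_mul_mul_star]
    rw [main s, hs, main t])

@[simp] theorem Germ.inv_mk (s : S) (x : X) (hx : x ∈ θ.dom s) :
    (Germ.mk s x hx).inv = Germ.mk (star s) (θ.act s x) (θ.act_mem_dom_star hx) := rfl

variable (θ)

/-- The basic set `Θ(s, U) = {[s, x] : x ∈ U}`; here `U` is meant to be contained in the domain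
of `s`. -/
def Theta (s : S) (U : Set X) : Set θ.Germ := {γ | ∃ x, ∃ hx : x ∈ θ.dom s, x ∈ U ∧ γ = Germ.mk s x hx}

/-- The topology of the groupoid of germs is generated by the sets `Θ(s, U)`, where `U` is open
and contained in the domain of `s`. -/
instance : TopologicalSpace θ.Germ :=
  TopologicalSpace.generateFrom {T | ∃ s U, IsOpen U ∧ U ⊆ θ.dom s ∧ T = θ.Theta s U}

theorem isOpen_Theta {s : S} {U : Set X} (hU : IsOpen U) (h : U ⊆ θ.dom s) :
    IsOpen (θ.Theta s U) :=
  TopologicalSpace.isOpen_generateFrom_of_mem ⟨s, U, hU, h, rfl⟩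

/-- The section `x ↦ [s, x]` over the domain of `s`. -/
def germSection (s : S) (x : θ.dom s) : θ.Germ := Germ.mk s x.1 x.2

theorem range_germSection (s : S) : Set.range (θ.germSection s) = θ.Theta s (θ.dom s) := by
  ext γ
  constructor
  · rintro ⟨x, rfl⟩; exact ⟨x.1, x.2, x.2, rfl⟩
  · rintro ⟨x, hx, _, rfl⟩; exact ⟨⟨x, hx⟩, rfl⟩

theorem isOpenEmbedding_germSection (s : S) : Topology.IsOpenEmbedding (θ.germSection s) := by
  refine Topology.IsOpenEmbedding.of_continuous_injective_isOpenMap ?_ ?_ ?_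
  · refine continuous_generateFrom_iff.2 ?_
    rintro _ ⟨t, U, hU, hUt, rfl⟩
    rw [isOpen_iff_mem_nhds]
    rintro ⟨x, hx⟩ ⟨y, hy, hyU, h⟩
    obtain ⟨h1, e, he, hxe, hs⟩ := Germ.mk_eq_mk.1 h
    subst h1
    have hopen : IsOpen {z : θ.dom s | z.1 ∈ θ.dom e ∧ z.1 ∈ U} :=
      ((θ.isOpen_dom e).inter hU).preimage continuous_subtype_val
    refine Filter.mem_of_superset (hopen.mem_nhds ⟨hxe, hyU⟩) ?_
    rintro ⟨z, hz⟩ ⟨hze, hzU⟩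
    exact ⟨z, hUt hzU, hzU, Germ.mk_eq_mk.2 ⟨rfl, e, he, hze, hs⟩⟩
  · rintro ⟨x, hx⟩ ⟨y, hy⟩ h
    exact Subtype.ext (Germ.mk_eq_mk.1 h).1
  · intro U hU
    obtain ⟨V, hV, rfl⟩ := isOpen_induced_iff.1 hU
    have : θ.germSection s '' (Subtype.val ⁻¹' V) = θ.Theta s (V ∩ θ.dom s) := by
      ext γ
      constructor
      · rintro ⟨x, hx, rfl⟩; exact ⟨x.1, x.2, ⟨hx, x.2⟩, rfl⟩
      · rintro ⟨x, hx, hxV, rfl⟩; exact ⟨⟨x, hx⟩, hxV.1, rfl⟩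
    rw [this]
    exact θ.isOpen_Theta (hV.inter (θ.isOpen_dom s)) Set.inter_subset_right

end

end PartialAction

namespace PartialAction

section Convolution

variable {S : Type u} {X : Type v} [InverseSemigroup S] [TopologicalSpace X]
  (θ : PartialAction S X)

/-- The functions `f` on the groupoid of germs for which there is an open set `V`, Hausdorff in
the relative topology, such that `f` vanishes outside `V` and the restriction of `f` to `V` is
continuous and compactly supported. -/
def ccZero : Set (θ.Germ → ℂ) :=
  {f | ∃ V : Set θ.Germ, IsOpen V ∧ T2Space V ∧ (∀ γ, γ ∉ V → f γ = 0) ∧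
    Continuous (fun γ : V => f γ) ∧ HasCompactSupport (fun γ : V => f γ)}

/-- The space `C_c(G)`: the linear span of `ccZero` in the space of all functions. -/
def ccSubmodule : Submodule ℂ (θ.Germ → ℂ) := Submodule.span ℂ θ.ccZero

variable {θ}

/-- The convolution `(f ⋆ g)(γ) = ∑ f(α) g(β)` over all composable `(α, β)` with `α β = γ`. -/
noncomputable def conv (f g : θ.Germ → ℂ) (γ : θ.Germ) : ℂ :=
  ∑ᶠ p : {p : θ.Germ × θ.Germ // p.1.d = p.2.r ∧ p.1.mul p.2 = γ}, f p.1.1 * g p.1.2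

/-- The adjoint `f*(γ) = conj (f(γ⁻¹))`. -/
noncomputable def adj (f : θ.Germ → ℂ) (γ : θ.Germ) : ℂ := star (f γ.inv)

variable (θ)

open Classical in
/-- The function `δ_s g`: it equals `g ∘ d` on `Θ_s = Θ(s, dom s)` and `0` elsewhere. -/
noncomputable def deltaLeft (s : S) (g : X → ℂ) (γ : θ.Germ) : ℂ :=
  if γ ∈ θ.Theta s (θ.dom s) then g γ.d else 0

open Classical in
/-- The function `g δ_s`: it equals `g ∘ r` on `Θ_s = Θ(s, dom s)` and `0` elsewhere. -/
noncomputable def deltaRight (g : X → ℂ) (s : S) (γ : θ.Germ) : ℂ :=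
  if γ ∈ θ.Theta s (θ.dom s) then g γ.r else 0

variable {θ}

theorem mk_mem_Theta {s : S} {x : X} (hx : x ∈ θ.dom s) : Germ.mk s x hx ∈ θ.Theta s (θ.dom s) :=
  ⟨x, hx, hx, rfl⟩

theorem deltaLeft_mk {s : S} {x : X} (hx : x ∈ θ.dom s) (g : X → ℂ) :
    θ.deltaLeft s g (Germ.mk s x hx) = g x := if_pos (mk_mem_Theta hx)

theorem deltaLeft_congr {s : S} {g h : X → ℂ} (H : ∀ x ∈ θ.dom s, g x = h x) :
    θ.deltaLeft s g = θ.deltaLeft s h := by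
  funext γ
  unfold deltaLeft
  split_ifs with hγ
  · obtain ⟨x, hx, _, rfl⟩ := hγ
    exact H x hx
  · rfl

theorem conv_deltaLeft (s t : S) (f g : X → ℂ) :
    conv (θ.deltaLeft s f) (θ.deltaLeft t g) =
      θ.deltaLeft (s * t) (fun x => f (θ.act t x) * g x) := by
  funext γ
  have key : ∀ p : θ.Germ × θ.Germ, p.1.d = p.2.r → θ.deltaLeft s f p.1 * θ.deltaLeft t g p.2 ≠ 0 →
      ∃ y, ∃ hy : y ∈ θ.dom t, ∃ hx : θ.act t y ∈ θ.dom s,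
        p = (Germ.mk s (θ.act t y) hx, Germ.mk t y hy) := by
    rintro ⟨a, b⟩ hp hne
    have ha : a ∈ θ.Theta s (θ.dom s) := by
      by_contra h
      exact hne (by simp [deltaLeft, h])
    have hb : b ∈ θ.Theta t (θ.dom t) := by
      by_contra h
      exact hne (by simp [deltaLeft, h])
    obtain ⟨x, hx, _, rfl⟩ := ha
    obtain ⟨y, hy, _, rfl⟩ := hb
    simp only [Germ.d_mk, Germ.r_mk] at hp
    subst hp
    exact ⟨y, hy, hx, rfl⟩
  by_cases hγ : γ ∈ θ.Theta (s * t) (θ.dom (s * t))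
  · obtain ⟨y, hyst, _, rfl⟩ := hγ
    obtain ⟨hy, hx⟩ := (θ.mem_dom_mul _ _ _).1 hyst
    rw [deltaLeft_mk, conv]
    rw [finsum_eq_single _ ⟨(Germ.mk s (θ.act t y) hx, Germ.mk t y hy), rfl,
      Germ.mk_mul_mk hx hy rfl⟩]
    · rw [deltaLeft_mk, deltaLeft_mk]
    · rintro ⟨p, hp1, hp2⟩ hne
      by_contra h0
      obtain ⟨y', hy', hx', rfl⟩ := key p hp1 h0
      rw [Germ.mk_mul_mk hx' hy' rfl] at hp2
      obtain rfl : y' = y := (Germ.mk_eq_mk.1 hp2).1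
      exact hne rfl
  · have : θ.deltaLeft (s * t) (fun x => f (θ.act t x) * g x) γ = 0 := if_neg hγ
    rw [this, conv]
    refine finsum_eq_zero_of_forall_eq_zero ?_
    rintro ⟨p, hp1, hp2⟩
    by_contra h0
    obtain ⟨y', hy', hx', rfl⟩ := key p hp1 h0
    rw [Germ.mk_mul_mk hx' hy' rfl] at hp2
    exact hγ (hp2 ▸ mk_mem_Theta _)

theorem inv_mem_Theta_iff {s : S} {γ : θ.Germ} :
    γ.inv ∈ θ.Theta s (θ.dom s) ↔ γ ∈ θ.Theta (star s) (θ.dom (star s)) := by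
  have inv_inv : ∀ γ : θ.Germ, γ.inv.inv = γ := by
    refine Germ.ind ?_
    intro t x hx
    rw [Germ.inv_mk, Germ.inv_mk]
    refine Germ.mk_eq_mk.2 ⟨θ.act_star_act hx, star t * t, idem_star_mul t, ?_, ?_⟩
    · rw [θ.act_star_act hx]; exact θ.mem_dom_source.2 hx
    · rw [star_star_eq]
  constructor
  · rintro ⟨x, hx, _, h⟩
    rw [← inv_inv γ, h, Germ.inv_mk]
    exact mk_mem_Theta _
  · rintro ⟨x, hx, _, rfl⟩
    rw [Germ.inv_mk]
    have : Germ.mk (star (star s)) (θ.act (star s) x) (θ.act_mem_dom_star hx) =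
        Germ.mk s (θ.act (star s) x) (θ.act_star_mem_dom hx) := by
      refine Germ.mk_eq_mk.2 ⟨rfl, star s * s, idem_star_mul s,
        θ.mem_dom_source.2 (θ.act_star_mem_dom hx), by rw [star_star_eq]⟩
    rw [this]
    exact mk_mem_Theta _

theorem Germ.d_inv (γ : θ.Germ) : γ.inv.d = γ.r := by
  revert γ
  exact Germ.ind fun s x hx => rfl

theorem adj_deltaLeft (s : S) (f : X → ℂ) :
    adj (θ.deltaLeft s f) = θ.deltaLeft (star s) (fun x => star (f (θ.act (star s) x))) := by
  funext γ
  unfold adj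
  by_cases hγ : γ ∈ θ.Theta (star s) (θ.dom (star s))
  · have h1 := inv_mem_Theta_iff.2 hγ
    obtain ⟨x, hx, _, rfl⟩ := hγ
    rw [deltaLeft_mk, deltaLeft, if_pos h1, Germ.d_inv, Germ.r_mk]
  · have h1 := fun h => hγ (inv_mem_Theta_iff.1 h)
    rw [deltaLeft, deltaLeft, if_neg h1, if_neg hγ, star_zero]

/-- The functions `δ_s h` with `h` continuous and compactly supported on the domain of `s`. -/
def IsBasic (F : θ.Germ → ℂ) : Prop :=
  ∃ (s : S) (h : X → ℂ) (K : Set X), IsCompact K ∧ K ⊆ θ.dom s ∧ ContinuousOn h (θ.dom s) ∧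
    (∀ x ∈ θ.dom s, x ∉ K → h x = 0) ∧ F = θ.deltaLeft s h

theorem IsBasic.conv [T2Space X] {F G : θ.Germ → ℂ} (hF : IsBasic F) (hG : IsBasic G) :
    IsBasic (conv F G) := by
  obtain ⟨s, f, K, hK, hKs, hf, hf0, rfl⟩ := hF
  obtain ⟨t, g, L, hL, hLt, hg, hg0, rfl⟩ := hG
  refine ⟨s * t, _, L ∩ θ.act t ⁻¹' K, ?_, ?_, ?_, ?_, conv_deltaLeft s t f g⟩
  · obtain ⟨C, hC, hCeq⟩ := continuousOn_iff_isClosed.1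
      ((θ.continuousOn_act t).mono hLt) K hK.isClosed
    rw [Set.inter_comm, hCeq, Set.inter_comm]
    exact hL.inter_right hC
  · rintro x ⟨hx, hxK⟩
    exact (θ.mem_dom_mul _ _ _).2 ⟨hLt hx, hKs hxK⟩
  · have h1 : Set.MapsTo (θ.act t) (θ.dom (s * t)) (θ.dom s) :=
      fun x hx => ((θ.mem_dom_mul _ _ _).1 hx).2
    have h2 : θ.dom (s * t) ⊆ θ.dom t := fun x hx => ((θ.mem_dom_mul _ _ _).1 hx).1
    exact (hf.comp ((θ.continuousOn_act t).mono h2) h1).mul (hg.mono h2)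
  · intro x hx hxK
    obtain ⟨h1, h2⟩ := (θ.mem_dom_mul _ _ _).1 hx
    by_cases hxL : x ∈ L
    · have : θ.act t x ∉ K := fun h => hxK ⟨hxL, h⟩
      simp [hf0 _ h2 this]
    · simp [hg0 _ h1 hxL]

theorem IsBasic.adj {F : θ.Germ → ℂ} (hF : IsBasic F) : IsBasic (adj F) := by
  obtain ⟨s, f, K, hK, hKs, hf, hf0, rfl⟩ := hF
  refine ⟨star s, _, θ.act s '' K, ?_, ?_, ?_, ?_, adj_deltaLeft s f⟩
  · exact hK.image_of_continuousOn ((θ.continuousOn_act s).mono hKs)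
  · rintro _ ⟨x, hx, rfl⟩
    exact θ.act_mem_dom_star (hKs hx)
  · exact continuous_star.comp_continuousOn
      (hf.comp (θ.continuousOn_act (star s)) (fun x hx => θ.act_star_mem_dom hx))
  · intro x hx hxK
    have : θ.act (star s) x ∉ K := fun h => hxK ⟨_, h, θ.act_act_star hx⟩
    simp [hf0 _ (θ.act_star_mem_dom hx) this]

theorem IsBasic.mem_ccZero [T2Space X] {F : θ.Germ → ℂ} (hF : IsBasic F) : F ∈ θ.ccZero := by
  obtain ⟨s, f, K, hK, hKs, hf, hf0, rfl⟩ := hF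
  have hemb := θ.isOpenEmbedding_germSection s
  have hrange := θ.range_germSection s
  refine ⟨Set.range (θ.germSection s), hemb.isOpen_range, ?_, ?_, ?_, ?_⟩
  · exact hemb.isEmbedding.toHomeomorph.t2Space
  · intro γ hγ
    rw [hrange] at hγ
    exact if_neg hγ
  · have h : (fun γ : Set.range (θ.germSection s) => θ.deltaLeft s f γ) ∘
        hemb.isEmbedding.toHomeomorph = fun x : θ.dom s => f x := by
      funext x
      exact deltaLeft_mk x.2 f
    rw [← hemb.isEmbedding.toHomeomorph.comp_continuous_iff', h]
    exact continuousOn_iff_continuous_domRestrict.1 hf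
  · have : T2Space (Set.range (θ.germSection s)) := hemb.isEmbedding.toHomeomorph.t2Space
    have hK' : IsCompact (Subtype.val ⁻¹' K : Set (θ.dom s)) :=
      Topology.IsInducing.subtypeVal.isCompact_preimage' hK (by
        rwa [Subtype.range_coe])
    refine HasCompactSupport.intro (hK'.image hemb.isEmbedding.toHomeomorph.continuous) ?_
    rintro ⟨_, x, rfl⟩ hx
    have hxK : x.1 ∉ K := fun h => hx ⟨x, h, rfl⟩
    have h1 : θ.deltaLeft s f (θ.germSection s x) = f x.1 := deltaLeft_mk x.2 f
    change θ.deltaLeft s f (θ.germSection s x) = 0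
    rw [h1, hf0 _ x.2 hxK]

end Convolution

end PartialAction

namespace PartialAction

section Algebra

variable {S : Type u} {X : Type v} [InverseSemigroup S] [TopologicalSpace X]
  {θ : PartialAction S X}

theorem weaklyLocallyCompact_of_isOpen [LocallyCompactSpace X] {V : Set θ.Germ} (hV : IsOpen V) :
    WeaklyLocallyCompactSpace V := by
  refine ⟨?_⟩
  rintro ⟨γ, hγ⟩
  induction γ using Germ.ind with | h s x hx => ?_
  have hemb := θ.isOpenEmbedding_germSection s
  have : LocallyCompactSpace (θ.dom s) := (θ.isOpen_dom s).locallyCompactSpace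
  obtain ⟨K, hKn, hKV, hK⟩ := local_compact_nhds
    ((hV.preimage hemb.continuous).mem_nhds (show (⟨x, hx⟩ : θ.dom s) ∈ _ from hγ))
  refine ⟨Subtype.val ⁻¹' (θ.germSection s '' K), ?_, ?_⟩
  · refine Topology.IsInducing.subtypeVal.isCompact_preimage' (hK.image hemb.continuous) ?_
    rw [Subtype.range_coe]
    rintro _ ⟨y, hy, rfl⟩
    exact hKV hy
  · have h1 : θ.germSection s '' K ∈ nhds (Germ.mk s x hx) :=
      hemb.isOpenMap.image_mem_nhds hKn
    exact continuous_subtype_val.continuousAt.preimage_mem_nhds h1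

theorem ccZero_subset_span [T2Space X] [LocallyCompactSpace X] {f : θ.Germ → ℂ}
    (hf : f ∈ θ.ccZero) : f ∈ Submodule.span ℂ {F : θ.Germ → ℂ | IsBasic F} := by
  classical
  obtain ⟨V, hV, hT2, hf0, hfc, hfs⟩ := hf
  have := weaklyLocallyCompact_of_isOpen hV
  have hTheta : ∀ s : S, IsOpen (Subtype.val ⁻¹' θ.Theta s (θ.dom s) : Set V) := fun s =>
    (θ.isOpen_Theta (θ.isOpen_dom s) subset_rfl).preimage continuous_subtype_val
  obtain ⟨T, hT⟩ := hfs.isCompact.elim_finite_subcover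
    (fun s : S => (Subtype.val ⁻¹' θ.Theta s (θ.dom s) : Set V)) hTheta (by
      rintro ⟨γ, hγ⟩ -
      induction γ using Germ.ind with | h s x hx => ?_
      exact Set.mem_iUnion.2 ⟨s, mk_mem_Theta hx⟩)
  let e := T.equivFin.symm
  obtain ⟨φ, hφs, hφ1, -, -⟩ := exists_continuous_sum_one_of_isOpen_isCompact
    (s := fun i => (Subtype.val ⁻¹' θ.Theta (e i).1 (θ.dom (e i).1) : Set V))
    (fun i => hTheta _) hfs.isCompact (by
      intro v hv
      obtain ⟨s, hs, hvs⟩ := Set.mem_iUnion₂.1 (hT hv)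
      refine Set.mem_iUnion.2 ⟨e.symm ⟨s, hs⟩, ?_⟩
      rw [Equiv.apply_symm_apply]
      exact hvs)
  let F : Fin T.card → θ.Germ → ℂ := fun i γ => if h : γ ∈ V then (φ i ⟨γ, h⟩ : ℂ) * f γ else 0
  have hsum : f = ∑ i, F i := by
    funext γ
    rw [Finset.sum_apply]
    by_cases hγ : γ ∈ V
    · simp only [F, hγ, dif_pos]
      rw [← Finset.sum_mul]
      by_cases h0 : f γ = 0
      · rw [h0, mul_zero]
      · have h1 : (⟨γ, hγ⟩ : V) ∈ tsupport (fun γ : V => f γ) := subset_tsupport _ h0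
        have h2 := hφ1 h1
        rw [Finset.sum_apply] at h2
        have h3 : ∑ i, ((φ i ⟨γ, hγ⟩ : ℝ) : ℂ) = 1 := by
          rw [← Complex.ofReal_sum, h2]; simp
        rw [h3, one_mul]
    · simp only [F, hγ, dif_neg, not_false_eq_true, Finset.sum_const_zero]
      exact hf0 γ hγ
  rw [hsum]
  refine Submodule.sum_mem _ (fun i _ => Submodule.subset_span ?_)
  set s : S := (e i).1 with hs
  have hemb := θ.isOpenEmbedding_germSection s
  let C : Set V := tsupport (φ i) ∩ tsupport (fun γ : V => f γ)
  have hC : IsCompact C := hfs.isCompact.inter_left (isClosed_tsupport _)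
  have hCs : ∀ v ∈ C, v.1 ∈ θ.Theta s (θ.dom s) := fun v hv => hφs i hv.1
  have hF0 : ∀ γ : θ.Germ, (∀ h : γ ∈ V, (⟨γ, h⟩ : V) ∉ C) → F i γ = 0 := by
    intro γ h
    by_cases hγ : γ ∈ V
    · simp only [F, hγ, dif_pos]
      by_contra h0
      refine h hγ ⟨subset_tsupport _ ?_, subset_tsupport _ ?_⟩
      · intro h1; apply h0; rw [h1]; simp
      · intro h1
        have h1' : f γ = 0 := h1
        apply h0; rw [h1', mul_zero]
    · simp only [F, hγ, dif_neg, not_false_eq_true]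
  let D : Set (θ.dom s) := θ.germSection s ⁻¹' (Subtype.val '' C)
  have hD : IsCompact D := by
    refine hemb.isEmbedding.isInducing.isCompact_preimage' (hC.image continuous_subtype_val) ?_
    rw [θ.range_germSection]
    rintro _ ⟨v, hv, rfl⟩
    exact hCs v hv
  let h : X → ℂ := fun x => if hx : x ∈ θ.dom s then F i (Germ.mk s x hx) else 0
  have hh : ∀ x : θ.dom s, h x = F i (θ.germSection s x) := fun x => by
    simp only [h, x.2, dif_pos]; rfl
  have hh0 : ∀ x : θ.dom s, x ∉ D → h x = 0 := by
    intro x hx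
    rw [hh]
    refine hF0 _ (fun hV' hxC => hx ⟨_, hxC, rfl⟩)
  refine ⟨s, h, Subtype.val '' D, hD.image continuous_subtype_val, ?_, ?_, ?_, ?_⟩
  · rintro _ ⟨x, -, rfl⟩; exact x.2
  · rw [continuousOn_iff_continuous_domRestrict, continuous_iff_continuousAt]
    intro x
    by_cases hxV : θ.germSection s x ∈ V
    · have hU : IsOpen (θ.germSection s ⁻¹' V) := hV.preimage hemb.continuous
      have hcont : Continuous (fun y : (θ.germSection s ⁻¹' V : Set (θ.dom s)) =>
          ((φ i ⟨θ.germSection s y.1, y.2⟩ : ℝ) : ℂ) * f (θ.germSection s y.1)) := by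
        have h1 : Continuous (fun y : (θ.germSection s ⁻¹' V : Set (θ.dom s)) =>
            (⟨θ.germSection s y.1, y.2⟩ : V)) :=
          Continuous.subtype_mk (hemb.continuous.comp continuous_subtype_val) _
        exact (Complex.continuous_ofReal.comp ((φ i).continuous.comp h1)).mul (hfc.comp h1)
      have hon : ContinuousOn (fun y : θ.dom s => h y) (θ.germSection s ⁻¹' V) := by
        rw [continuousOn_iff_continuous_domRestrict]
        convert hcont using 1
        funext y
        change h y.1 = _
        rw [hh]
        have hy : θ.germSection s y.1 ∈ V := y.2
        simp only [F, hy, dif_pos]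
      exact hon.continuousAt (hU.mem_nhds hxV)
    · have hxD : x ∉ D := by
        rintro ⟨v, -, hv⟩
        exact hxV (hv ▸ v.2)
      have hn : Dᶜ ∈ nhds x := hD.isClosed.isOpen_compl.mem_nhds hxD
      refine (continuousAt_const (y := (0 : ℂ))).congr ?_
      filter_upwards [hn] with y hy
      exact (hh0 y hy).symm
  · intro x hx hxD
    exact hh0 ⟨x, hx⟩ (fun hx' => hxD ⟨_, hx', rfl⟩)
  · funext γ
    by_cases hγ : γ ∈ θ.Theta s (θ.dom s)
    · obtain ⟨x, hx, -, rfl⟩ := hγ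
      rw [deltaLeft_mk hx, hh ⟨x, hx⟩]
      rfl
    · rw [deltaLeft, if_neg hγ]
      exact hF0 γ (fun h1 h2 => hγ (hCs _ h2))

theorem ccSubmodule_eq_span [T2Space X] [LocallyCompactSpace X] :
    θ.ccSubmodule = Submodule.span ℂ {F : θ.Germ → ℂ | IsBasic F} := by
  apply le_antisymm
  · exact Submodule.span_le.2 fun f hf => ccZero_subset_span hf
  · exact Submodule.span_mono fun F hF => hF.mem_ccZero

/-- Finitely many nonzero values on each fibre of the source and range maps. -/
def FiberFinite (f : θ.Germ → ℂ) : Prop :=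
  ∀ x, {γ | f γ ≠ 0 ∧ γ.d = x}.Finite ∧ {γ | f γ ≠ 0 ∧ γ.r = x}.Finite

theorem fiberFinite_deltaLeft (s : S) (h : X → ℂ) : FiberFinite (θ.deltaLeft s h) := by
  have key : ∀ γ, θ.deltaLeft s h γ ≠ 0 → γ ∈ θ.Theta s (θ.dom s) := by
    intro γ h1
    by_contra h2
    exact h1 (if_neg h2)
  refine fun x => ⟨Set.Subsingleton.finite ?_, Set.Subsingleton.finite ?_⟩
  · rintro a ⟨ha, hax⟩ b ⟨hb, hbx⟩
    obtain ⟨y, hy, -, rfl⟩ := key a ha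
    obtain ⟨z, hz, -, rfl⟩ := key b hb
    obtain rfl : y = z := hax.trans hbx.symm
    rfl
  · rintro a ⟨ha, hax⟩ b ⟨hb, hbx⟩
    obtain ⟨y, hy, -, rfl⟩ := key a ha
    obtain ⟨z, hz, -, rfl⟩ := key b hb
    obtain rfl : y = z := θ.injOn_act s hy hz (hax.trans hbx.symm)
    rfl

theorem fiberFinite_of_mem [T2Space X] [LocallyCompactSpace X] {f : θ.Germ → ℂ}
    (hf : f ∈ θ.ccSubmodule) : FiberFinite f := by
  rw [ccSubmodule_eq_span] at hf
  induction hf using Submodule.span_induction with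
  | mem F hF => obtain ⟨s, h, -, -, -, -, -, rfl⟩ := hF; exact fiberFinite_deltaLeft s h
  | zero => intro x; simp
  | add f g _ _ hf hg =>
    intro x
    refine ⟨((hf x).1.union (hg x).1).subset ?_, ((hf x).2.union (hg x).2).subset ?_⟩ <;>
    · rintro γ ⟨h1, h2⟩
      by_cases h3 : f γ = 0
      · right; exact ⟨fun h4 => h1 (by simp [h3, h4]), h2⟩
      · left; exact ⟨h3, h2⟩
  | smul c f _ hf =>
    intro x
    refine ⟨(hf x).1.subset ?_, (hf x).2.subset ?_⟩ <;>
    · rintro γ ⟨h1, h2⟩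
      exact ⟨fun h3 => h1 (by simp [h3]), h2⟩

theorem conv_support_finite {f g : θ.Germ → ℂ} (hf : FiberFinite f) (hg : FiberFinite g)
    (γ : θ.Germ) : (Function.support
      (fun p : {p : θ.Germ × θ.Germ // p.1.d = p.2.r ∧ p.1.mul p.2 = γ} =>
        f p.1.1 * g p.1.2)).Finite := by
  have hmul : ∀ a b : θ.Germ, a.d = b.r → (a.mul b).r = a.r ∧ (a.mul b).d = b.d := by
    refine Germ.ind fun s x hx => Germ.ind fun t y hy h => ?_
    have h' : x = θ.act t y := h
    rw [Germ.mk_mul_mk hx hy h']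
    refine ⟨?_, rfl⟩
    rw [Germ.r_mk, Germ.r_mk, θ.act_mul, ← h']
    exact (θ.mem_dom_mul _ _ _).2 ⟨hy, h' ▸ hx⟩
  refine Set.Finite.of_finite_image (f := Subtype.val) ?_ Subtype.val_injective.injOn
  refine ((hf γ.r).2.prod (hg γ.d).1).subset ?_
  rintro _ ⟨⟨⟨a, b⟩, h1, h2⟩, h3, rfl⟩
  obtain ⟨h4, h5⟩ := hmul a b h1
  simp only [Function.mem_support] at h3
  simp only at h2
  rw [h2] at h4 h5
  exact ⟨⟨left_ne_zero_of_mul h3, h4.symm⟩, ⟨right_ne_zero_of_mul h3, h5.symm⟩⟩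

theorem conv_add_left {f f' g : θ.Germ → ℂ} (hf : FiberFinite f) (hf' : FiberFinite f')
    (hg : FiberFinite g) : conv (f + f') g = conv f g + conv f' g := by
  funext γ
  simp only [conv, Pi.add_apply, add_mul]
  exact finsum_add_distrib (conv_support_finite hf hg γ) (conv_support_finite hf' hg γ)

theorem conv_add_right {f g g' : θ.Germ → ℂ} (hf : FiberFinite f) (hg : FiberFinite g)
    (hg' : FiberFinite g') : conv f (g + g') = conv f g + conv f g' := by
  funext γ
  simp only [conv, Pi.add_apply, mul_add]
  exact finsum_add_distrib (conv_support_finite hf hg γ) (conv_support_finite hf hg' γ)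

theorem conv_smul_left (c : ℂ) (f g : θ.Germ → ℂ) : conv (c • f) g = c • conv f g := by
  funext γ
  simp only [conv, Pi.smul_apply, smul_eq_mul, mul_assoc]
  exact (mul_finsum _ _).symm

theorem conv_smul_right (c : ℂ) (f g : θ.Germ → ℂ) : conv f (c • g) = c • conv f g := by
  funext γ
  simp only [conv, Pi.smul_apply, smul_eq_mul, mul_left_comm _ c]
  exact (mul_finsum _ _).symm

theorem conv_zero_left (g : θ.Germ → ℂ) : conv 0 g = 0 := by
  funext γ; simp [conv]

theorem conv_zero_right (g : θ.Germ → ℂ) : conv g 0 = 0 := by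
  funext γ; simp [conv]

end Algebra

end PartialAction

namespace PartialAction

section CcAlgebra

variable {S : Type u} {X : Type v} [InverseSemigroup S] [TopologicalSpace X]
  {θ : PartialAction S X}

theorem basic_mem [T2Space X] {F : θ.Germ → ℂ} (hF : IsBasic F) : F ∈ θ.ccSubmodule :=
  Submodule.subset_span hF.mem_ccZero

theorem span_induction_basic [T2Space X] [LocallyCompactSpace X]
    {p : (f : θ.Germ → ℂ) → f ∈ θ.ccSubmodule → Prop}
    (basic : ∀ F (hF : IsBasic F), p F (basic_mem hF))
    (add : ∀ f g hf hg, p f hf → p g hg → p (f + g) (add_mem hf hg))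
    (zero : p 0 (zero_mem _))
    (smul : ∀ (c : ℂ) f hf, p f hf → p (c • f) (Submodule.smul_mem _ c hf))
    {f : θ.Germ → ℂ} (hf : f ∈ θ.ccSubmodule) : p f hf := by
  have key : ∀ g, g ∈ Submodule.span ℂ {F : θ.Germ → ℂ | IsBasic F} → g ∈ θ.ccSubmodule :=
    fun g hg => by rw [ccSubmodule_eq_span]; exact hg
  have hf' : f ∈ Submodule.span ℂ {F : θ.Germ → ℂ | IsBasic F} := by
    rw [← ccSubmodule_eq_span]; exact hf
  exact Submodule.span_induction (s := {F : θ.Germ → ℂ | IsBasic F})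
    (p := fun f h => p f (key f h)) (fun F hF => basic F hF) zero
    (fun f g h1 h2 => add f g (key f h1) (key g h2)) (fun c f h1 => smul c f (key f h1)) hf'

theorem adj_add (f g : θ.Germ → ℂ) : adj (f + g) = adj f + adj g := by
  funext γ; simp [adj]

theorem adj_smul (c : ℂ) (f : θ.Germ → ℂ) : adj (c • f) = star c • adj f := by
  funext γ; simp [adj]

section

variable [T2Space X] [LocallyCompactSpace X]

theorem conv_mem {f g : θ.Germ → ℂ} (hf : f ∈ θ.ccSubmodule) (hg : g ∈ θ.ccSubmodule) :
    conv f g ∈ θ.ccSubmodule := by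
  induction hf using span_induction_basic with
  | basic F hF =>
    induction hg using span_induction_basic with
    | basic G hG => exact basic_mem (hF.conv hG)
    | add f g hf hg h1 h2 =>
      rw [conv_add_right (fiberFinite_of_mem (basic_mem hF)) (fiberFinite_of_mem hf)
        (fiberFinite_of_mem hg)]
      exact add_mem h1 h2
    | zero => rw [conv_zero_right]; exact zero_mem _
    | smul c f hf h => rw [conv_smul_right]; exact Submodule.smul_mem _ _ h
  | add f f' hf hf' h1 h2 =>
    rw [conv_add_left (fiberFinite_of_mem hf) (fiberFinite_of_mem hf') (fiberFinite_of_mem hg)]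
    exact add_mem h1 h2
  | zero => rw [conv_zero_left]; exact zero_mem _
  | smul c f hf h => rw [conv_smul_left]; exact Submodule.smul_mem _ _ h

theorem adj_mem {f : θ.Germ → ℂ} (hf : f ∈ θ.ccSubmodule) : adj f ∈ θ.ccSubmodule := by
  induction hf using span_induction_basic with
  | basic F hF => exact basic_mem hF.adj
  | add f g hf hg h1 h2 => rw [adj_add]; exact add_mem h1 h2
  | zero =>
    have : adj (0 : θ.Germ → ℂ) = 0 := by funext γ; simp [adj]
    rw [this]; exact zero_mem _
  | smul c f hf h => rw [adj_smul]; exact Submodule.smul_mem _ _ h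

theorem conv_assoc {f g h : θ.Germ → ℂ} (hf : f ∈ θ.ccSubmodule) (hg : g ∈ θ.ccSubmodule)
    (hh : h ∈ θ.ccSubmodule) : conv (conv f g) h = conv f (conv g h) := by
  induction hf using span_induction_basic with
  | basic F hF =>
    have hFm := basic_mem hF
    induction hg using span_induction_basic with
    | basic G hG =>
      have hGm := basic_mem hG
      induction hh using span_induction_basic with
      | basic H hH =>
        obtain ⟨s, a, -, -, -, -, -, rfl⟩ := hF
        obtain ⟨t, b, -, -, -, -, -, rfl⟩ := hG
        obtain ⟨r, c, -, -, -, -, -, rfl⟩ := hH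
        rw [conv_deltaLeft, conv_deltaLeft, conv_deltaLeft, conv_deltaLeft, mul_assoc]
        refine deltaLeft_congr fun x hx => ?_
        rw [← mul_assoc] at hx
        obtain ⟨h1, h2⟩ := (θ.mem_dom_mul _ _ _).1 hx
        obtain ⟨h3, h4⟩ := (θ.mem_dom_mul _ _ _).1 h2
        rw [θ.act_mul t r x ((θ.mem_dom_mul _ _ _).2 ⟨h1, h3⟩), mul_assoc]
      | add f g hf hg h1 h2 =>
        rw [conv_add_right (fiberFinite_of_mem (conv_mem hFm hGm)) (fiberFinite_of_mem hf)
          (fiberFinite_of_mem hg), conv_add_right (fiberFinite_of_mem hGm) (fiberFinite_of_mem hf)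
          (fiberFinite_of_mem hg), conv_add_right (fiberFinite_of_mem hFm)
          (fiberFinite_of_mem (conv_mem hGm hf)) (fiberFinite_of_mem (conv_mem hGm hg)), h1, h2]
      | zero => simp only [conv_zero_right]
      | smul c f hf h => simp only [conv_smul_right, h]
    | add f g hf hg h1 h2 =>
      rw [conv_add_right (fiberFinite_of_mem hFm) (fiberFinite_of_mem hf) (fiberFinite_of_mem hg),
        conv_add_left (fiberFinite_of_mem (conv_mem hFm hf))
          (fiberFinite_of_mem (conv_mem hFm hg)) (fiberFinite_of_mem hh),
        conv_add_left (fiberFinite_of_mem hf) (fiberFinite_of_mem hg) (fiberFinite_of_mem hh),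
        conv_add_right (fiberFinite_of_mem hFm) (fiberFinite_of_mem (conv_mem hf hh))
          (fiberFinite_of_mem (conv_mem hg hh)), h1, h2]
    | zero => simp only [conv_zero_right, conv_zero_left]
    | smul c f hf h => simp only [conv_smul_right, conv_smul_left, h]
  | add f f' hf hf' h1 h2 =>
    rw [conv_add_left (fiberFinite_of_mem hf) (fiberFinite_of_mem hf') (fiberFinite_of_mem hg),
      conv_add_left (fiberFinite_of_mem (conv_mem hf hg)) (fiberFinite_of_mem (conv_mem hf' hg))
        (fiberFinite_of_mem hh),
      conv_add_left (fiberFinite_of_mem hf) (fiberFinite_of_mem hf')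
        (fiberFinite_of_mem (conv_mem hg hh)), h1, h2]
  | zero => simp only [conv_zero_left]
  | smul c f hf h => simp only [conv_smul_left, h]

theorem adj_conv {f g : θ.Germ → ℂ} (hf : f ∈ θ.ccSubmodule) (hg : g ∈ θ.ccSubmodule) :
    adj (conv f g) = conv (adj g) (adj f) := by
  induction hf using span_induction_basic with
  | basic F hF =>
    have hFm := basic_mem hF
    induction hg using span_induction_basic with
    | basic G hG =>
      obtain ⟨s, a, -, -, -, -, -, rfl⟩ := hF
      obtain ⟨t, b, -, -, -, -, -, rfl⟩ := hG
      rw [conv_deltaLeft, adj_deltaLeft, adj_deltaLeft, adj_deltaLeft, conv_deltaLeft, star_mul_rev]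
      refine deltaLeft_congr fun x hx => ?_
      have h0 := hx
      obtain ⟨h1, h2⟩ := (θ.mem_dom_mul _ _ _).1 hx
      rw [θ.act_mul _ _ _ h0, θ.act_act_star h2, mul_comm, star_mul']
    | add f g hf hg h1 h2 =>
      rw [conv_add_right (fiberFinite_of_mem hFm) (fiberFinite_of_mem hf) (fiberFinite_of_mem hg),
        adj_add, adj_add, conv_add_left (fiberFinite_of_mem (adj_mem hf))
        (fiberFinite_of_mem (adj_mem hg)) (fiberFinite_of_mem (adj_mem hFm)), h1, h2]
    | zero =>
      have : adj (0 : θ.Germ → ℂ) = 0 := by funext γ; simp [adj]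
      rw [conv_zero_right, this, conv_zero_left]
    | smul c f hf h => rw [conv_smul_right, adj_smul, adj_smul, conv_smul_left, h]
  | add f f' hf hf' h1 h2 =>
    rw [conv_add_left (fiberFinite_of_mem hf) (fiberFinite_of_mem hf') (fiberFinite_of_mem hg),
      adj_add, adj_add, conv_add_right (fiberFinite_of_mem (adj_mem hg))
      (fiberFinite_of_mem (adj_mem hf)) (fiberFinite_of_mem (adj_mem hf')), h1, h2]
  | zero =>
    have : adj (0 : θ.Germ → ℂ) = 0 := by funext γ; simp [adj]
    rw [conv_zero_left, this, conv_zero_right]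
  | smul c f hf h => rw [conv_smul_left, adj_smul, adj_smul, conv_smul_right, h]

end

variable (θ)

/-- The space `C_c(G)` as a type; it is a *-algebra under convolution. -/
def Cc : Type (max u v) := ↥(θ.ccSubmodule)

noncomputable instance : AddCommGroup θ.Cc := inferInstanceAs (AddCommGroup ↥(θ.ccSubmodule))
noncomputable instance : Module ℂ θ.Cc := inferInstanceAs (Module ℂ ↥(θ.ccSubmodule))

variable {θ}

/-- The function underlying an element of `C_c(G)`. -/
def Cc.fn (f : θ.Cc) : θ.Germ → ℂ := f.1

theorem Cc.ext {f g : θ.Cc} (h : f.fn = g.fn) : f = g := Subtype.ext h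
theorem Cc.mem (f : θ.Cc) : f.fn ∈ θ.ccSubmodule := f.2
@[simp] theorem Cc.fn_add (f g : θ.Cc) : (f + g).fn = f.fn + g.fn := rfl
@[simp] theorem Cc.fn_smul (c : ℂ) (f : θ.Cc) : (c • f).fn = c • f.fn := rfl
@[simp] theorem Cc.fn_zero : (0 : θ.Cc).fn = 0 := rfl

variable [T2Space X] [LocallyCompactSpace X]

noncomputable instance : Mul θ.Cc := ⟨fun f g => ⟨conv f.fn g.fn, conv_mem f.mem g.mem⟩⟩
noncomputable instance : Star θ.Cc := ⟨fun f => ⟨adj f.fn, adj_mem f.mem⟩⟩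

@[simp] theorem Cc.fn_mul (f g : θ.Cc) : (f * g).fn = conv f.fn g.fn := rfl
@[simp] theorem Cc.fn_star (f : θ.Cc) : (star f).fn = adj f.fn := rfl

theorem Cc.fib (f : θ.Cc) : FiberFinite f.fn := fiberFinite_of_mem f.mem

noncomputable instance : NonUnitalRing θ.Cc where
  left_distrib f g h := Cc.ext (conv_add_right f.fib g.fib h.fib)
  right_distrib f g h := Cc.ext (conv_add_left f.fib g.fib h.fib)
  zero_mul f := Cc.ext (conv_zero_left f.fn)
  mul_zero f := Cc.ext (conv_zero_right f.fn)
  mul_assoc f g h := Cc.ext (conv_assoc f.mem g.mem h.mem)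

noncomputable instance : StarRing θ.Cc where
  star_involutive f := Cc.ext (by
    have inv_inv : ∀ γ : θ.Germ, γ.inv.inv = γ := by
      refine Germ.ind ?_
      intro t x hx
      rw [Germ.inv_mk, Germ.inv_mk]
      refine Germ.mk_eq_mk.2 ⟨θ.act_star_act hx, star t * t, idem_star_mul t, ?_, ?_⟩
      · rw [θ.act_star_act hx]; exact θ.mem_dom_source.2 hx
      · rw [star_star_eq]
    funext γ
    simp [adj, inv_inv])
  star_mul f g := Cc.ext (adj_conv f.mem g.mem)
  star_add f g := Cc.ext (adj_add f.fn g.fn)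

instance : IsScalarTower ℂ θ.Cc θ.Cc where
  smul_assoc c f g := Cc.ext (conv_smul_left c f.fn g.fn)

instance : SMulCommClass ℂ θ.Cc θ.Cc where
  smul_comm c f g := Cc.ext (conv_smul_right c f.fn g.fn).symm

instance : StarModule ℂ θ.Cc where
  star_smul c f := Cc.ext (adj_smul c f.fn)

end CcAlgebra

end PartialAction

namespace PartialAction

section Norm

variable {S : Type u} {X : Type v} [InverseSemigroup S] [TopologicalSpace X]
  [T2Space X] [LocallyCompactSpace X] {θ : PartialAction S X}

theorem norm_basic_le {H : Type w} [NormedAddCommGroup H] [InnerProductSpace ℂ H]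
    [CompleteSpace H] (π : θ.Cc →⋆ₙₐ[ℂ] (H →L[ℂ] H)) {s : S} {h : X → ℂ} {K : Set X} {C : ℝ}
    (hK : IsCompact K) (hKs : K ⊆ θ.dom s) (hc : ContinuousOn h (θ.dom s))
    (h0 : ∀ x ∈ θ.dom s, x ∉ K → h x = 0) (hC0 : 0 ≤ C) (hC : ∀ x ∈ θ.dom s, ‖h x‖ ^ 2 ≤ C)
    (F : θ.Cc) (hF : F.fn = θ.deltaLeft s h) : ‖π F‖ ^ 2 ≤ C := by
  have hdom : θ.dom (star s * s) = θ.dom s := Set.ext fun x => θ.mem_dom_source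
  set e := star s * s with he
  have hee : e * e = e := idem_star_mul s
  -- elements supported on the idempotent `e`
  have mk : ∀ k : X → ℂ, ContinuousOn k (θ.dom s) → (∀ x ∈ θ.dom s, x ∉ K → k x = 0) →
      ∃ G : θ.Cc, G.fn = θ.deltaLeft e k := fun k hk hk0 =>
    ⟨⟨_, basic_mem ⟨e, k, K, hK, hdom ▸ hKs, hdom ▸ hk, hdom ▸ hk0, rfl⟩⟩, rfl⟩
  let k : X → ℂ := fun x => star (h x) * h x
  have hkc : ContinuousOn k (θ.dom s) := (continuous_star.comp_continuousOn hc).mul hc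
  have hk0 : ∀ x ∈ θ.dom s, x ∉ K → k x = 0 := fun x hx hxK => by simp [k, h0 x hx hxK]
  have hkn : ∀ x ∈ θ.dom s, ‖k x‖ ≤ C := fun x hx => by
    have := hC x hx
    simp only [k, norm_mul, norm_star]
    rwa [← sq]
  have hstar : (star F * F).fn = θ.deltaLeft e k := by
    rw [Cc.fn_mul, Cc.fn_star, hF, adj_deltaLeft, conv_deltaLeft]
    refine deltaLeft_congr fun x hx => ?_
    simp only [k]
    rw [θ.act_star_act (hdom ▸ hx)]
  set T : H →L[ℂ] H := π (star F * F) with hT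
  have hTsa : IsSelfAdjoint T := by
    rw [hT, isSelfAdjoint_iff, ← map_star, star_mul, star_star]
  have hspec : ∀ z ∈ spectrum ℂ T, ‖z‖ ≤ C := by
    intro z hz
    by_contra hzC
    rw [not_le] at hzC
    have hne : ∀ x ∈ θ.dom s, z - k x ≠ 0 := fun x hx h => by
      have h1 := hkn x hx
      rw [← sub_eq_zero.1 h] at h1
      linarith
    obtain ⟨G, hG⟩ := mk (fun x => k x / (z - k x))
      (hkc.div (continuousOn_const.sub hkc) hne) (fun x hx hxK => by simp [hk0 x hx hxK])
    have hdm : ∀ a b : X → ℂ, conv (θ.deltaLeft e a) (θ.deltaLeft e b) =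
        θ.deltaLeft e (fun x => a x * b x) := by
      intro a b
      rw [conv_deltaLeft, hee]
      exact deltaLeft_congr fun x hx => by rw [θ.act_idem hee hx]
    have hlin : ∀ a b : X → ℂ, θ.deltaLeft e (fun x => z * a x - b x) =
        z • θ.deltaLeft e a - θ.deltaLeft e b := by
      intro a b
      funext γ
      simp only [Pi.sub_apply, Pi.smul_apply, smul_eq_mul, deltaLeft]
      split_ifs <;> simp
    have e1 : z • G - (star F * F) * G = star F * F := by
      apply Cc.ext
      change z • G.fn - conv (star F * F).fn G.fn = (star F * F).fn
      rw [hstar, hG, hdm, ← hlin]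
      refine deltaLeft_congr fun x hx => ?_
      have := hne x (hdom ▸ hx)
      field_simp
      try ring
    have e2 : z • G - G * (star F * F) = star F * F := by
      apply Cc.ext
      change z • G.fn - conv G.fn (star F * F).fn = (star F * F).fn
      rw [hstar, hG, hdm, ← hlin]
      refine deltaLeft_congr fun x hx => ?_
      have := hne x (hdom ▸ hx)
      field_simp
      try ring
    have e1' := congrArg π e1
    have e2' := congrArg π e2
    rw [map_sub, map_smul, map_mul, ← hT] at e1' e2'
    have hz0 : z ≠ 0 := fun h => by rw [h, norm_zero] at hzC; linarith
    apply hz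
    rw [spectrum.mem_resolventSet_iff, Algebra.algebraMap_eq_smul_one]
    refine ⟨⟨z • 1 - T, z⁻¹ • (1 + π G), ?_, ?_⟩, rfl⟩
    · have : (z • (1 : H →L[ℂ] H) - T) * (1 + π G) = z • 1 + ((z • π G - T * π G) - T) := by
        rw [sub_mul, mul_add, mul_add, smul_mul_assoc, smul_mul_assoc, one_mul, one_mul, mul_one]
        abel
      rw [mul_smul_comm, this, e1', sub_self, add_zero, smul_smul, inv_mul_cancel₀ hz0, one_smul]
    · have : (1 + π G) * (z • (1 : H →L[ℂ] H) - T) = z • 1 + ((z • π G - π G * T) - T) := by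
        rw [mul_sub, add_mul, add_mul, mul_smul_comm, mul_smul_comm, one_mul, one_mul, mul_one]
        abel
      rw [smul_mul_assoc, this, e2', sub_self, add_zero, smul_smul, inv_mul_cancel₀ hz0, one_smul]
  have hr : spectralRadius ℂ T ≤ (C.toNNReal : ENNReal) := by
    refine iSup₂_le fun z hz => ?_
    rw [ENNReal.coe_le_coe, ← NNReal.coe_le_coe, Real.coe_toNNReal _ hC0]
    exact hspec z hz
  rw [hTsa.spectralRadius_eq_nnnorm, ENNReal.coe_le_coe, ← NNReal.coe_le_coe,
    Real.coe_toNNReal _ hC0, coe_nnnorm, hT, map_mul, map_star, CStarRing.norm_star_mul_self] at hr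
  rwa [sq]

/-- The norms of the images of `f` under all *-representations have a common bound. -/
theorem exists_norm_bound (f : θ.Cc) : ∃ C : ℝ, ∀ (H : Type w) [NormedAddCommGroup H]
    [InnerProductSpace ℂ H] [CompleteSpace H] (π : θ.Cc →⋆ₙₐ[ℂ] (H →L[ℂ] H)), ‖π f‖ ≤ C := by
  obtain ⟨f, hf⟩ := f
  induction hf using span_induction_basic with
  | basic F hF =>
    obtain ⟨s, h, K, hK, hKs, hc, h0, rfl⟩ := hF
    obtain ⟨C, hC⟩ := hK.exists_bound_of_continuousOn (hc.mono hKs)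
    refine ⟨|C|, fun H _ _ _ π => ?_⟩
    have := norm_basic_le (C := |C| ^ 2) π hK hKs hc h0 (by positivity) (by
      intro x hx
      by_cases hxK : x ∈ K
      · exact pow_le_pow_left₀ (norm_nonneg _) ((hC x hxK).trans (le_abs_self C)) 2
      · rw [h0 x hx hxK, norm_zero, zero_pow two_ne_zero]; positivity)
      ⟨θ.deltaLeft s h, basic_mem ⟨s, h, K, hK, hKs, hc, h0, rfl⟩⟩ rfl
    exact le_of_sq_le_sq this (abs_nonneg _)
  | add f g hf hg h1 h2 =>
    obtain ⟨C, hC⟩ := h1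
    obtain ⟨D, hD⟩ := h2
    refine ⟨C + D, fun H _ _ _ π => ?_⟩
    have : π (⟨f + g, add_mem hf hg⟩ : θ.Cc) = π (⟨f, hf⟩ : θ.Cc) + π (⟨g, hg⟩ : θ.Cc) :=
      map_add π (⟨f, hf⟩ : θ.Cc) ⟨g, hg⟩
    rw [this]
    exact (norm_add_le _ _).trans (add_le_add (hC H π) (hD H π))
  | zero =>
    refine ⟨0, fun H _ _ _ π => ?_⟩
    have : π (⟨0, zero_mem _⟩ : θ.Cc) = 0 := map_zero π
    rw [this, norm_zero]
  | smul c f hf h =>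
    obtain ⟨C, hC⟩ := h
    refine ⟨‖c‖ * C, fun H _ _ _ π => ?_⟩
    have : π (⟨c • f, Submodule.smul_mem _ c hf⟩ : θ.Cc) = c • π (⟨f, hf⟩ : θ.Cc) :=
      map_smul π c (⟨f, hf⟩ : θ.Cc)
    rw [this, norm_smul]
    exact mul_le_mul_of_nonneg_left (hC H π) (norm_nonneg _)

/-- The values `‖π(f)‖`, where `π` runs over all *-representations of `C_c(G)` on Hilbert spaces.
(Hilbert spaces in the universe of `G` suffice: every cyclic representation of `C_c(G)` is
equivalent to one on such a space, and `‖π(f)‖` is attained as a supremum over the cyclic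
subrepresentations of `π`.) -/
def repNorms (f : θ.Cc) : Set ℝ :=
  {c | ∃ (H : Type (max u v)) (_ : NormedAddCommGroup H) (_ : InnerProductSpace ℂ H)
    (_ : CompleteSpace H) (π : θ.Cc →⋆ₙₐ[ℂ] (H →L[ℂ] H)), c = ‖π f‖}

/-- The C*-seminorm `f ↦ sup_π ‖π(f)‖` on `C_c(G)`. -/
noncomputable def fullNorm (f : θ.Cc) : ℝ := sSup (repNorms f)

theorem repNorms_bddAbove (f : θ.Cc) : BddAbove (repNorms f) := by
  obtain ⟨C, hC⟩ := exists_norm_bound.{u, v, max u v} f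
  refine ⟨C, ?_⟩
  rintro _ ⟨H, _, _, _, π, rfl⟩
  exact hC H π

theorem repNorms_nonempty (f : θ.Cc) : (repNorms f).Nonempty :=
  ⟨_, lp (fun _ : ULift.{max u v} ℕ => ℂ) 2, inferInstance, inferInstance, inferInstance, 0, rfl⟩

theorem le_fullNorm {H : Type (max u v)} [NormedAddCommGroup H] [InnerProductSpace ℂ H]
    [CompleteSpace H] (π : θ.Cc →⋆ₙₐ[ℂ] (H →L[ℂ] H)) (f : θ.Cc) : ‖π f‖ ≤ fullNorm f :=
  le_csSup (repNorms_bddAbove f) ⟨H, _, _, _, π, rfl⟩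

theorem fullNorm_le {f : θ.Cc} {c : ℝ} (h : ∀ (H : Type (max u v)) [NormedAddCommGroup H]
    [InnerProductSpace ℂ H] [CompleteSpace H] (π : θ.Cc →⋆ₙₐ[ℂ] (H →L[ℂ] H)), ‖π f‖ ≤ c) :
    fullNorm f ≤ c := by
  refine csSup_le (repNorms_nonempty f) ?_
  rintro _ ⟨H, _, _, _, π, rfl⟩
  exact h H π

theorem fullNorm_nonneg (f : θ.Cc) : 0 ≤ fullNorm f := by
  obtain ⟨_, H, _, _, _, π, rfl⟩ := repNorms_nonempty f
  exact (norm_nonneg _).trans (le_fullNorm π f)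

noncomputable instance : NonUnitalSeminormedRing θ.Cc :=
  let core : AddGroupSeminorm θ.Cc :=
    { toFun := fullNorm
      map_zero' := le_antisymm
        (fullNorm_le fun H _ _ _ π => by rw [map_zero, norm_zero]) (fullNorm_nonneg 0)
      add_le' := fun f g => fullNorm_le fun H _ _ _ π => by
        rw [map_add]
        exact (norm_add_le _ _).trans (add_le_add (le_fullNorm π f) (le_fullNorm π g))
      neg' := fun f => by
        apply le_antisymm
        · exact fullNorm_le fun H _ _ _ π => by rw [map_neg, norm_neg]; exact le_fullNorm π f
        · exact fullNorm_le fun H _ _ _ π => by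
            rw [← norm_neg, ← map_neg]; exact le_fullNorm π (-f) }
  { core.toSeminormedAddCommGroup, (inferInstance : NonUnitalRing θ.Cc) with
    norm_mul_le := fun f g => fullNorm_le fun H _ _ _ π => by
      rw [map_mul]
      exact (norm_mul_le _ _).trans
        (mul_le_mul (le_fullNorm π f) (le_fullNorm π g) (norm_nonneg _) (fullNorm_nonneg f)) }

theorem Cc.norm_def (f : θ.Cc) : ‖f‖ = fullNorm f := rfl

noncomputable instance : NormedSpace ℂ θ.Cc where
  norm_smul_le c f := fullNorm_le fun H _ _ _ π => by
    rw [map_smul, norm_smul]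
    exact mul_le_mul_of_nonneg_left (le_fullNorm π f) (norm_nonneg _)

theorem Cc.norm_star (f : θ.Cc) : ‖star f‖ = ‖f‖ := by
  have h : ∀ f : θ.Cc, ‖star f‖ ≤ ‖f‖ := fun f => fullNorm_le fun H _ _ _ π => by
    rw [map_star, _root_.norm_star]; exact le_fullNorm π f
  exact le_antisymm (h f) (by simpa using h (star f))

theorem Cc.norm_mul_self_le (f : θ.Cc) : ‖f‖ * ‖f‖ ≤ ‖star f * f‖ := by
  have h1 : ‖f‖ ≤ Real.sqrt ‖star f * f‖ := fullNorm_le fun H _ _ _ π => by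
    apply Real.le_sqrt_of_sq_le
    rw [sq, ← CStarRing.norm_star_mul_self, ← map_star, ← map_mul]
    exact le_fullNorm π _
  calc ‖f‖ * ‖f‖ ≤ Real.sqrt ‖star f * f‖ * Real.sqrt ‖star f * f‖ :=
        mul_self_le_mul_self (norm_nonneg _) h1
    _ = ‖star f * f‖ := Real.mul_self_sqrt (norm_nonneg _)

end Norm

end PartialAction

/-- A complex *-algebra with a C*-seminorm. -/
class PreCStarAlgebra (A : Type u) extends NonUnitalSeminormedRing A, StarRing A,
    NormedSpace ℂ A, IsScalarTower ℂ A A, SMulCommClass ℂ A A, StarModule ℂ A where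
  norm_star (a : A) : ‖star a‖ = ‖a‖
  norm_mul_self_le (a : A) : ‖a‖ * ‖a‖ ≤ ‖star a * a‖

/-- The Hausdorff completion of a *-algebra with a C*-seminorm; it is a C*-algebra. -/
def CStarCompletion (A : Type u) [PreCStarAlgebra A] : Type u := UniformSpace.Completion A

section Completion

variable {A : Type u} [PreCStarAlgebra A]

open UniformSpace

noncomputable instance : NormedAddCommGroup (CStarCompletion A) :=
  inferInstanceAs (NormedAddCommGroup (Completion A))

noncomputable instance : NormedSpace ℂ (CStarCompletion A) :=
  inferInstanceAs (NormedSpace ℂ (Completion A))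

instance : CompleteSpace (CStarCompletion A) := inferInstanceAs (CompleteSpace (Completion A))

/-- The canonical map `i : A → the completion`, as an additive map. -/
noncomputable def ofPre : A →+ CStarCompletion A := Completion.toCompl

theorem isDenseInducing_ofPre : IsDenseInducing (ofPre : A → CStarCompletion A) :=
  Completion.isDenseInducing_coe

theorem continuous_ofPre : Continuous (ofPre : A → CStarCompletion A) :=
  isDenseInducing_ofPre.continuous

theorem norm_ofPre (f : A) : ‖ofPre f‖ = ‖f‖ := Completion.norm_coe f

theorem ofPre_smul (c : ℂ) (f : A) : ofPre (c • f) = c • ofPre f :=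
  Completion.coe_smul c f

theorem CStarCompletion.induction {p : CStarCompletion A → Prop} (hp : IsClosed {a | p a})
    (h : ∀ f : A, p (ofPre f)) (a : CStarCompletion A) : p a :=
  Completion.induction_on a hp h

theorem CStarCompletion.induction₂ {p : CStarCompletion A → CStarCompletion A → Prop}
    (hp : IsClosed {a : CStarCompletion A × CStarCompletion A | p a.1 a.2})
    (h : ∀ f g : A, p (ofPre f) (ofPre g)) (a b : CStarCompletion A) : p a b :=
  Completion.induction_on₂ a b hp h

theorem CStarCompletion.induction₃
    {p : CStarCompletion A → CStarCompletion A → CStarCompletion A → Prop}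
    (hp : IsClosed {a : CStarCompletion A × CStarCompletion A × CStarCompletion A |
      p a.1 a.2.1 a.2.2})
    (h : ∀ f g k : A, p (ofPre f) (ofPre g) (ofPre k)) (a b c : CStarCompletion A) : p a b c :=
  Completion.induction_on₃ a b c hp h

/-- The multiplication is the continuous extension of that of `A`. -/
noncomputable instance : Mul (CStarCompletion A) :=
  ⟨Function.curry <| ((isDenseInducing_ofPre (A := A)).prodMap (isDenseInducing_ofPre (A := A))).extend
    ((ofPre : A → CStarCompletion A) ∘ Function.uncurry (· * ·))⟩

theorem uniformContinuous_star_pre : UniformContinuous (fun f : A => star f) := by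
  have : Isometry (fun f : A => star f) := by
    refine Isometry.of_dist_eq fun f g => ?_
    rw [dist_eq_norm, dist_eq_norm, ← star_sub, PreCStarAlgebra.norm_star]
  exact this.uniformContinuous

/-- The adjoint is the continuous extension of that of `A`. -/
noncomputable instance : Star (CStarCompletion A) :=
  ⟨Completion.map (fun f : A => star f)⟩

theorem ofPre_mul (f g : A) : ofPre (f * g) = ofPre f * ofPre g :=
  (((isDenseInducing_ofPre (A := A)).prodMap (isDenseInducing_ofPre (A := A))).extend_eq
    (continuous_ofPre.comp continuous_mul) (f, g)).symm

instance : ContinuousMul (CStarCompletion A) where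
  continuous_mul := by
    let m := (AddMonoidHom.mul : A →+ A →+ A).compr₂ ofPre
    have h : Continuous fun p : A × A => m p.1 p.2 :=
      continuous_ofPre.comp continuous_mul
    have di : IsDenseInducing (ofPre : A → CStarCompletion A) := isDenseInducing_ofPre
    exact (di.extend_Z_bilin di h :)

theorem ofPre_star (f : A) : ofPre (star f) = star (ofPre f) :=
  (Completion.map_coe uniformContinuous_star_pre f).symm

theorem CStarCompletion.continuous_star : Continuous (fun a : CStarCompletion A => star a) :=
  Completion.continuous_map

namespace CStarCompletion

theorem mul_add_aux (a b c : CStarCompletion A) : a * (b + c) = a * b + a * c :=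
  induction₃ (p := fun a b c => a * (b + c) = a * b + a * c)
    (isClosed_eq (by fun_prop) (by fun_prop)) (fun f g k => by
      rw [← map_add, ← ofPre_mul, ← ofPre_mul, ← ofPre_mul, ← map_add, mul_add]) a b c

theorem add_mul_aux (a b c : CStarCompletion A) : (a + b) * c = a * c + b * c :=
  induction₃ (p := fun a b c => (a + b) * c = a * c + b * c)
    (isClosed_eq (by fun_prop) (by fun_prop)) (fun f g k => by
      rw [← map_add, ← ofPre_mul, ← ofPre_mul, ← ofPre_mul, ← map_add, add_mul]) a b c

theorem zero_mul_aux (a : CStarCompletion A) : 0 * a = 0 :=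
  induction (p := fun a => 0 * a = 0) (isClosed_eq (by fun_prop) (by fun_prop)) (fun f => by
    rw [← map_zero ofPre, ← ofPre_mul, zero_mul]) a

theorem mul_zero_aux (a : CStarCompletion A) : a * 0 = 0 :=
  induction (p := fun a => a * 0 = 0) (isClosed_eq (by fun_prop) (by fun_prop)) (fun f => by
    rw [← map_zero ofPre, ← ofPre_mul, mul_zero]) a

theorem mul_assoc_aux (a b c : CStarCompletion A) : a * b * c = a * (b * c) :=
  induction₃ (p := fun a b c => a * b * c = a * (b * c))
    (isClosed_eq (by fun_prop) (by fun_prop)) (fun f g k => by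
      rw [← ofPre_mul, ← ofPre_mul, ← ofPre_mul, ← ofPre_mul, mul_assoc]) a b c

theorem norm_mul_aux (a b : CStarCompletion A) : ‖a * b‖ ≤ ‖a‖ * ‖b‖ :=
  induction₂ (p := fun a b => ‖a * b‖ ≤ ‖a‖ * ‖b‖)
    (isClosed_le (by fun_prop) (by fun_prop)) (fun f g => by
      rw [← ofPre_mul, norm_ofPre, norm_ofPre, norm_ofPre]
      exact norm_mul_le f g) a b

theorem star_star_aux (a : CStarCompletion A) : star (star a) = a :=
  induction (p := fun a => star (star a) = a)
    (isClosed_eq (continuous_star.comp continuous_star) continuous_id)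
    (fun f => by rw [← ofPre_star, ← ofPre_star, star_star]) a

theorem star_mul_aux (a b : CStarCompletion A) : star (a * b) = star b * star a :=
  induction₂ (p := fun a b => star (a * b) = star b * star a)
    (isClosed_eq (continuous_star.comp continuous_mul)
      ((continuous_star.comp continuous_snd).mul (continuous_star.comp continuous_fst)))
    (fun f g => by
      rw [← ofPre_mul, ← ofPre_star, ← ofPre_star, ← ofPre_star, ← ofPre_mul, star_mul]) a b

theorem star_add_aux (a b : CStarCompletion A) : star (a + b) = star a + star b :=
  induction₂ (p := fun a b => star (a + b) = star a + star b)
    (isClosed_eq (continuous_star.comp continuous_add)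
      ((continuous_star.comp continuous_fst).add (continuous_star.comp continuous_snd)))
    (fun f g => by
      rw [← map_add, ← ofPre_star, ← ofPre_star, ← ofPre_star, ← map_add, star_add]) a b

theorem norm_mul_self_aux (a : CStarCompletion A) : ‖a‖ * ‖a‖ ≤ ‖star a * a‖ :=
  induction (p := fun a => ‖a‖ * ‖a‖ ≤ ‖star a * a‖)
    (isClosed_le (by fun_prop) ((continuous_star.mul continuous_id).norm))
    (fun f => by
      rw [← ofPre_star, ← ofPre_mul, norm_ofPre, norm_ofPre]
      exact PreCStarAlgebra.norm_mul_self_le f) a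

theorem smul_mul_aux (c : ℂ) (a b : CStarCompletion A) : (c • a) * b = c • (a * b) :=
  induction₂ (p := fun a b => (c • a) * b = c • (a * b))
    (isClosed_eq (((continuous_const_smul c).comp continuous_fst).mul continuous_snd)
      ((continuous_const_smul c).comp continuous_mul)) (fun f g => by
      rw [← ofPre_smul, ← ofPre_mul, ← ofPre_mul, ← ofPre_smul, smul_mul_assoc]) a b

theorem mul_smul_aux (c : ℂ) (a b : CStarCompletion A) : c • (a * b) = a * (c • b) :=
  induction₂ (p := fun a b => c • (a * b) = a * (c • b))
    (isClosed_eq ((continuous_const_smul c).comp continuous_mul)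
      (continuous_fst.mul ((continuous_const_smul c).comp continuous_snd))) (fun f g => by
      rw [← ofPre_smul, ← ofPre_mul, ← ofPre_mul, ← ofPre_smul, mul_smul_comm]) a b

theorem star_smul_aux (c : ℂ) (a : CStarCompletion A) : star (c • a) = star c • star a :=
  induction (p := fun a => star (c • a) = star c • star a)
    (isClosed_eq (continuous_star.comp (continuous_const_smul c))
      ((continuous_const_smul (star c)).comp continuous_star))
    (fun f => by
      rw [← ofPre_smul, ← ofPre_star, ← ofPre_star, ← ofPre_smul, star_smul]) a

end CStarCompletion

noncomputable instance : NonUnitalNormedRing (CStarCompletion A) :=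
  { (inferInstance : NormedAddCommGroup (CStarCompletion A)),
    (inferInstance : Mul (CStarCompletion A)) with
    left_distrib := CStarCompletion.mul_add_aux
    right_distrib := CStarCompletion.add_mul_aux
    zero_mul := CStarCompletion.zero_mul_aux
    mul_zero := CStarCompletion.mul_zero_aux
    mul_assoc := CStarCompletion.mul_assoc_aux
    norm_mul_le := CStarCompletion.norm_mul_aux }

noncomputable instance : StarRing (CStarCompletion A) where
  star_involutive := CStarCompletion.star_star_aux
  star_mul := CStarCompletion.star_mul_aux
  star_add := CStarCompletion.star_add_aux

/-- The completion is a C*-algebra. -/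
noncomputable instance : NonUnitalCStarAlgebra (CStarCompletion A) where
  norm_smul_le := norm_smul_le
  norm_mul_self_le := CStarCompletion.norm_mul_self_aux
  smul_assoc := CStarCompletion.smul_mul_aux
  smul_comm := CStarCompletion.mul_smul_aux
  star_smul := CStarCompletion.star_smul_aux

/-- The canonical *-homomorphism from `A` to its completion. -/
noncomputable def toCStarCompletion : A →⋆ₙₐ[ℂ] CStarCompletion A where
  toFun := ofPre
  map_smul' := ofPre_smul
  map_zero' := map_zero ofPre
  map_add' := map_add ofPre
  map_mul' := ofPre_mul
  map_star' := ofPre_star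

end Completion


namespace PartialAction

section

variable {S : Type u} {X : Type v} [InverseSemigroup S] [TopologicalSpace X]
  [T2Space X] [LocallyCompactSpace X]

noncomputable instance {θ : PartialAction S X} : PreCStarAlgebra θ.Cc where
  norm_smul_le := norm_smul_le
  norm_star := Cc.norm_star
  norm_mul_self_le := Cc.norm_mul_self_le
  smul_assoc := smul_assoc
  smul_comm := smul_comm
  star_smul := star_smul

/-- The C*-algebra `C*(G)` of the groupoid of germs `G`: the Hausdorff completion of `C_c(G)` in the
C*-seminorm `f ↦ sup_π ‖π(f)‖`. -/
abbrev CStarGpd (θ : PartialAction S X) : Type (max u v) := CStarCompletion θ.Cc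

/-- The canonical *-homomorphism `i : C_c(G) → C*(G)`. -/
noncomputable def toCStar (θ : PartialAction S X) : θ.Cc →⋆ₙₐ[ℂ] θ.CStarGpd :=
  toCStarCompletion

end

end PartialAction

section SpectralAction

variable {S : Type u} [InverseSemigroup S]

theorem Idem.ext' {a b : Idem S} (h : a.1 = b.1) : a = b := Subtype.ext h

theorem conj_inf (s : S) (e f : Idem S) : conj s (e ⊓ f) = conj s e ⊓ conj s f := by
  apply Idem.ext'
  change star s * (e.1 * f.1) * s = star s * e.1 * s * (star s * f.1 * s)
  symm
  calc star s * e.1 * s * (star s * f.1 * s) = star s * (e.1 * (s * star s)) * f.1 * s := by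
        simp only [mul_assoc]
    _ = (star s * s * star s) * (e.1 * f.1) * s := by
        rw [idem_comm e.2 (idem_mul_star s)]; simp only [mul_assoc]
    _ = star s * (e.1 * f.1) * s := by rw [star_mul_mul_star]

theorem conj_conj (s t : S) (e : Idem S) : conj t (conj s e) = conj (s * t) e := by
  apply Idem.ext'
  change star t * (star s * e.1 * s) * t = star (s * t) * e.1 * (s * t)
  rw [star_mul_rev]
  simp only [mul_assoc]

theorem source_mul (s t : S) : source (s * t) = conj t (source s) := by
  apply Idem.ext'
  change star (s * t) * (s * t) = star t * (star s * s) * t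
  rw [star_mul_rev]
  simp only [mul_assoc]

theorem source_idem (e : Idem S) : source e.1 = e := by
  apply Idem.ext'
  change star e.1 * e.1 = e.1
  rw [star_of_idem e.2, e.2]

theorem conj_idem (e f : Idem S) : conj e.1 f = e ⊓ f := by
  apply Idem.ext'
  change star e.1 * f.1 * e.1 = e.1 * f.1
  rw [star_of_idem e.2, mul_assoc, idem_comm f.2 e.2, ← mul_assoc, e.2]

theorem conj_le_source (s : S) (e : Idem S) : conj s e ≤ source s := by
  change star s * e.1 * s * (star s * s) = star s * e.1 * s
  calc star s * e.1 * s * (star s * s) = star s * e.1 * (s * star s * s) := by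
        simp only [mul_assoc]
    _ = star s * e.1 * s := by rw [mul_star_mul_self]

theorem conj_source_star (s : S) : conj s (source (star s)) = source s := by
  apply Idem.ext'
  change star s * (star (star s) * star s) * s = star s * s
  rw [star_star_eq]
  calc star s * (s * star s) * s = (star s * s * star s) * s := by simp only [mul_assoc]
    _ = star s * s := by rw [star_mul_mul_star]

theorem conj_conj_star (s : S) (e : Idem S) : conj s (conj (star s) e) = source s ⊓ e := by
  rw [conj_conj]
  exact conj_idem (source s) e

theorem conj_mono (s : S) {e f : Idem S} (h : e ≤ f) : conj s e ≤ conj s f := by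
  rw [← inf_eq_left] at h ⊢
  rw [← conj_inf, h]

/-- `θ_s(φ)(e) = φ(s* e s)` is a semicharacter if `φ(s* s) = 1`. -/
theorem spectrum_conj {s : S} (φ : Spectrum (Idem S)) (h : φ.1 (source s) = true) :
    (∃ e, φ.1 (conj s e) = true) ∧
      ∀ e f, φ.1 (conj s (e ⊓ f)) = (φ.1 (conj s e) && φ.1 (conj s f)) :=
  ⟨⟨source (star s), by rw [conj_source_star, h]⟩, fun e f => by rw [conj_inf, φ.2.2]⟩

theorem Spectrum.mono {E : Type u} [SemilatticeInf E] (φ : Spectrum E) {e f : E} (h : e ≤ f)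
    (he : φ.1 e = true) : φ.1 f = true := by
  have := φ.2.2 e f
  rw [inf_eq_left.2 h, he] at this
  simpa using this.symm

open Classical in
/-- The map `θ_s(φ)(e) = φ(s* e s)`, defined when `φ(s* s) = 1`. (Elsewhere the value carries no
meaning.) -/
noncomputable def spectralMap (s : S) (φ : Spectrum (Idem S)) : Spectrum (Idem S) :=
  if h : φ.1 (source s) = true then ⟨fun e => φ.1 (conj s e), spectrum_conj φ h⟩ else φ

theorem spectralMap_apply {s : S} {φ : Spectrum (Idem S)} (h : φ.1 (source s) = true)
    (e : Idem S) : (spectralMap s φ).1 e = φ.1 (conj s e) := by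
  have h1 : spectralMap s φ = ⟨fun e => φ.1 (conj s e), spectrum_conj φ h⟩ := dif_pos h
  rw [h1]

theorem continuous_spectrum_apply {E : Type u} [SemilatticeInf E] (e : E) :
    Continuous (fun φ : Spectrum E => φ.1 e) :=
  (continuous_apply e).comp continuous_subtype_val

variable (S) in
/-- The standard action of `S` on the spectrum of `E(S)`: the domain of `s` is
`{φ : φ(s* s) = 1}` and `θ_s(φ)(e) = φ(s* e s)`. -/
noncomputable def spectralAction : PartialAction S (Spectrum (Idem S)) where
  dom s := {φ | φ.1 (source s) = true}
  act s := spectralMap s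
  isOpen_dom s := (isOpen_discrete {true}).preimage (continuous_spectrum_apply (source s))
  continuousOn_act s := by
    refine Topology.IsInducing.subtypeVal.continuousOn_iff.2 ?_
    refine ContinuousOn.congr (f := fun φ : Spectrum (Idem S) => fun e => φ.1 (conj s e)) ?_ ?_
    · exact (continuous_pi fun e => continuous_spectrum_apply (conj s e)).continuousOn
    · intro φ hφ
      funext e
      exact spectralMap_apply hφ e
  injOn_act s φ hφ ψ hψ h := by
    apply Subtype.ext
    funext e
    have key : ∀ φ : Spectrum (Idem S), φ.1 (source s) = true →
        (spectralMap s φ).1 (conj (star s) e) = φ.1 e := by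
      intro φ hφ
      rw [spectralMap_apply hφ, conj_conj_star, φ.2.2, hφ, Bool.true_and]
    rw [← key φ hφ, ← key ψ hψ, h]
  mem_dom_mul s t φ := by
    simp only [Set.mem_ofPred_eq]
    rw [source_mul]
    constructor
    · intro h
      have h1 := Spectrum.mono φ (conj_le_source t _) h
      exact ⟨h1, by rwa [spectralMap_apply h1]⟩
    · rintro ⟨h1, h2⟩
      rwa [spectralMap_apply h1] at h2
  act_mul s t φ hφ := by
    have h0 : φ.1 (source (s * t)) = true := hφ
    have h0' := h0
    rw [source_mul] at h0'
    have h1 := Spectrum.mono φ (conj_le_source t _) h0'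
    have h2 : (spectralMap t φ).1 (source s) = true := by rwa [spectralMap_apply h1]
    apply Subtype.ext
    funext e
    rw [spectralMap_apply h0, spectralMap_apply h2, spectralMap_apply h1, conj_conj]
  exists_mem_dom φ := by
    obtain ⟨e, he⟩ := φ.2.1
    exact ⟨e.1, by simpa only [Set.mem_ofPred_eq, source_idem] using he⟩

end SpectralAction

section TightAction

/-- For `{0,1}`-valued maps the tightness inequality is a statement about values. -/
theorem bool_tight_iff {E : Type u} (β : E → Bool) (X Y Z : Finset E) :
    X.inf β ⊓ Y.inf (fun y => (β y)ᶜ) ≤ Z.sup β ↔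
      ((∀ x ∈ X, β x = true) → (∀ y ∈ Y, β y = false) → ∃ z ∈ Z, β z = true) := by
  have h1 : ∀ γ : E → Bool, ∀ X : Finset E, X.inf γ = true ↔ ∀ x ∈ X, γ x = true := by
    intro γ X
    have : X.inf γ = true ↔ ⊤ ≤ X.inf γ := (top_le_iff (a := X.inf γ)).symm
    rw [this, Finset.le_inf_iff]
    exact forall₂_congr fun x _ => top_le_iff
  have h2 : Z.sup β = true ↔ ∃ z ∈ Z, β z = true := by
    rw [← not_iff_not, Bool.not_eq_true]
    have : Z.sup β = false ↔ Z.sup β ≤ ⊥ := (le_bot_iff (a := Z.sup β)).symm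
    rw [this, Finset.sup_le_iff]
    push Not
    refine forall₂_congr fun z _ => ?_
    rw [le_bot_iff]
    change β z = false ↔ _
    simp
  have h3 : ∀ a b c : Bool, a ⊓ b ≤ c ↔ (a = true → b = true → c = true) := by decide
  rw [h3, h1, h1, h2]
  refine imp_congr_right fun _ => imp_congr_left (forall₂_congr fun y _ => ?_)
  cases β y <;> decide

variable {S : Type u} [InverseSemigroupWithZero S]

theorem conj_bot (s : S) : conj s (⊥ : Idem S) = ⊥ := by
  apply Idem.ext'
  change star s * 0 * s = 0
  rw [mul_zero, zero_mul]

open Classical in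
/-- The tight spectrum is invariant under the standard action. -/
theorem spectralMap_mem_tight {s : S} {φ : Spectrum (Idem S)} (h : φ.1 (source s) = true)
    (hφ : φ ∈ tightSpectrum (Idem S)) : spectralMap s φ ∈ tightSpectrum (Idem S) := by
  refine ⟨⟨?_, (spectralMap s φ).2.2⟩, ?_⟩
  · rw [spectralMap_apply h, conj_bot]; exact hφ.map_bot
  · intro X Y Z hZ
    rw [bool_tight_iff]
    simp only [spectralMap_apply h]
    intro hX hY
    have key := hφ.tight (insert (source s) (X.image (conj s))) (Y.image (conj s))
      (Z.image (conj s)) ?_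
    · rw [bool_tight_iff] at key
      obtain ⟨z, hz, hz'⟩ := key (by simpa [h] using hX) (by simpa using hY)
      obtain ⟨w, hw, rfl⟩ := Finset.mem_image.1 hz
      exact ⟨w, hw, hz'⟩
    · have cc : ∀ w : Idem S, w ≤ source s → conj s (conj (star s) w) = w := fun w hw => by
        rw [conj_conj_star]; exact inf_eq_right.2 hw
      have cc' : ∀ w : Idem S, conj (star s) (conj s w) ≤ w := fun w => by
        have := conj_conj_star (star s) w
        rw [star_star_eq] at this
        rw [this]; exact inf_le_right
      have nz : ∀ w : Idem S, w ≤ source s → w ≠ ⊥ → conj (star s) w ≠ ⊥ := by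
        intro w hw hne h0
        apply hne
        rw [← cc w hw, h0, conj_bot]
      have int1 : ∀ w y : Idem S, Intersects w (conj s y) → Intersects (conj (star s) w) y := by
        rintro w y ⟨a, ha, haw, hay⟩
        exact ⟨conj (star s) a, nz a (hay.trans (conj_le_source s y)) ha, conj_mono _ haw,
          (conj_mono _ hay).trans (cc' y)⟩
      have int2 : ∀ w y : Idem S, w ≤ source s → Intersects (conj (star s) w) y →
          Intersects w (conj s y) := by
        rintro w y hw ⟨a, ha, haw, hay⟩
        refine ⟨conj s a, ?_, ?_, conj_mono _ hay⟩
        · intro h0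
          apply ha
          have h1 : a ≤ source (star s) := haw.trans (conj_le_source _ _)
          have h2 := conj_conj_star (star s) a
          rw [star_star_eq, h0, conj_bot, inf_eq_right.2 h1] at h2
          exact h2.symm
        · have := conj_mono s haw
          rwa [cc w hw] at this
      constructor
      · intro z' hz'
        obtain ⟨z, hz, rfl⟩ := Finset.mem_image.1 (Finset.mem_coe.1 hz')
        obtain ⟨h1, h2⟩ := hZ.1 (Finset.mem_coe.2 hz)
        constructor
        · intro x hx
          rcases Finset.mem_insert.1 hx with rfl | hx
          · exact conj_le_source s z
          · obtain ⟨a, ha, rfl⟩ := Finset.mem_image.1 hx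
            exact conj_mono s (h1 a ha)
        · intro y hy hi
          obtain ⟨b, hb, rfl⟩ := Finset.mem_image.1 hy
          obtain ⟨a, ha, haz, hay⟩ := int1 _ _ hi
          exact h2 b hb ⟨a, ha, haz.trans (cc' z), hay⟩
      · rintro w ⟨hw1, hw2⟩ hne
        have hws : w ≤ source s := hw1 _ (Finset.mem_insert_self _ _)
        have hmem : conj (star s) w ∈ between X Y := by
          constructor
          · intro x hx
            exact (conj_mono _ (hw1 _ (Finset.mem_insert_of_mem
              (Finset.mem_image_of_mem _ hx)))).trans (cc' x)
          · intro y hy hi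
            exact hw2 _ (Finset.mem_image_of_mem _ hy) (int2 w y hws hi)
        obtain ⟨z, hz, a, ha, haz, haw⟩ := hZ.2 _ hmem (nz w hws hne)
        obtain ⟨b, hb, hbw, hbz⟩ := int2 w z hws ⟨a, ha, haw, haz⟩
        exact ⟨conj s z, Finset.mem_coe.2 (Finset.mem_image_of_mem _ (Finset.mem_coe.1 hz)),
          b, hb, hbz, hbw⟩

variable (S) in
/-- The restriction of the standard action to the tight spectrum. Its groupoid of germs is
`G_tight`. -/
noncomputable def tightAction : PartialAction S (tightSpectrum (Idem S)) :=
  (spectralAction S).restrict (tightSpectrum (Idem S)) fun _ _ h hφ =>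
    spectralMap_mem_tight h hφ

theorem mem_dom_tightAction {s : S} {φ : tightSpectrum (Idem S)} :
    φ ∈ (tightAction S).dom s ↔ φ.1.1 (source s) = true := Iff.rfl

instance {E : Type u} [SemilatticeInf E] : T2Space (Spectrum E) :=
  inferInstanceAs (T2Space {φ : E → Bool // _})

theorem isCompact_tight {E : Type u} [SemilatticeInf E] [OrderBot E] (e : E) :
    IsCompact {φ : tightSpectrum E | φ.1.1 e = true} := by
  have hemb : Topology.IsInducing (fun φ : tightSpectrum E => (φ.1.1 : E → Bool)) :=
    Topology.IsInducing.subtypeVal.comp Topology.IsInducing.subtypeVal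
  rw [hemb.isCompact_iff]
  have himg : (fun φ : tightSpectrum E => (φ.1.1 : E → Bool)) '' {φ | φ.1.1 e = true} =
      {f : E → Bool | f e = true} ∩ {f | f ⊥ = false} ∩ (⋂ a : E, ⋂ b : E,
        {f | f (a ⊓ b) = (f a && f b)}) ∩ ⋂ X : Finset E, ⋂ Y : Finset E, ⋂ Z : Finset E,
          {f | IsCover (Z : Set E) (between X Y) → (∀ x ∈ X, f x = true) →
            (∀ y ∈ Y, f y = false) → ∃ z ∈ Z, f z = true} := by
    ext f
    simp only [Set.mem_image, Set.mem_inter_iff, Set.mem_iInter, Set.mem_ofPred_eq]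
    constructor
    · rintro ⟨φ, hφ, rfl⟩
      refine ⟨⟨⟨hφ, φ.2.map_bot⟩, φ.1.2.2⟩, fun X Y Z hZ => ?_⟩
      rw [← bool_tight_iff]
      exact φ.2.tight X Y Z hZ
    · rintro ⟨⟨⟨h1, h2⟩, h3⟩, h4⟩
      refine ⟨⟨⟨f, ⟨e, h1⟩, h3⟩, ⟨⟨h2, h3⟩, fun X Y Z hZ => ?_⟩⟩, h1, rfl⟩
      rw [bool_tight_iff]
      exact h4 X Y Z hZ
  rw [himg]
  apply IsClosed.isCompact
  refine IsClosed.inter (IsClosed.inter (IsClosed.inter ?_ ?_) ?_) ?_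
  · exact isClosed_eq (continuous_apply e) continuous_const
  · exact isClosed_eq (continuous_apply _) continuous_const
  · refine isClosed_iInter fun a => isClosed_iInter fun b => ?_
    refine isClosed_eq (continuous_apply _) ?_
    exact (continuous_of_discreteTopology (f := fun p : Bool × Bool => (p.1 && p.2))).comp
      ((continuous_apply (A := fun _ : E => Bool) a).prodMk (continuous_apply b))
  · refine isClosed_iInter fun X => isClosed_iInter fun Y => isClosed_iInter fun Z => ?_
    by_cases hZ : IsCover (Z : Set E) (between X Y)
    · simp only [hZ, true_imp_iff]
      have ho : ∀ (X : Finset E) (c : Bool), IsOpen {f : E → Bool | ∀ x ∈ X, f x = c} := by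
        intro X c
        have : {f : E → Bool | ∀ x ∈ X, f x = c} = ⋂ x ∈ X, {f | f x = c} := by
          ext f; simp
        rw [this]
        refine isOpen_biInter_finset fun x _ => ?_
        have h := (isOpen_discrete ({c} : Set Bool)).preimage
          (continuous_apply (A := fun _ : E => Bool) x)
        exact h
      have hc : IsClosed {f : E → Bool | ∃ z ∈ Z, f z = true} := by
        have : {f : E → Bool | ∃ z ∈ Z, f z = true} = (⋃ z ∈ Z, {f | f z = true}) := by
          ext f; simp
        rw [this]
        exact Z.finite_toSet.isClosed_biUnion fun z _ =>
          isClosed_eq (continuous_apply z) continuous_const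
      exact isClosed_imp (ho X true) (isClosed_imp (ho Y false) hc)
    · simp [hZ]

instance {E : Type u} [SemilatticeInf E] [OrderBot E] : LocallyCompactSpace (tightSpectrum E) := by
  have : WeaklyLocallyCompactSpace (tightSpectrum E) := ⟨by
    intro φ
    obtain ⟨e, he⟩ := φ.1.2.1
    refine ⟨_, isCompact_tight e, IsOpen.mem_nhds ?_ he⟩
    exact (isOpen_discrete {true}).preimage
      ((continuous_spectrum_apply e).comp continuous_subtype_val)⟩
  infer_instance

theorem isCompact_dom_tightAction (s : S) : IsCompact ((tightAction S).dom s) :=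
  isCompact_tight (source s)

theorem tightGen_mem (s : S) :
    (tightAction S).deltaRight (Set.indicator ((tightAction S).dom (s * star s)) fun _ => 1) s ∈
      (tightAction S).ccSubmodule := by
  have h : (tightAction S).deltaRight
      (Set.indicator ((tightAction S).dom (s * star s)) fun _ => 1) s =
      (tightAction S).deltaLeft s (fun _ => 1) := by
    funext γ
    unfold PartialAction.deltaRight PartialAction.deltaLeft
    split_ifs with hγ
    · obtain ⟨x, hx, _, rfl⟩ := hγ
      rw [PartialAction.Germ.r_mk]
      apply Set.indicator_of_mem
      have h1 := (tightAction S).act_mem_dom_star hx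
      rw [← (tightAction S).mem_dom_source, star_star_eq] at h1
      exact h1
    · rfl
  rw [h]
  exact PartialAction.basic_mem ⟨s, fun _ => 1, _, isCompact_dom_tightAction s, subset_rfl,
    continuousOn_const, fun x hx hx' => absurd hx hx', rfl⟩

/-- The element `1_{s s*} δ_s` of `C_c(G_tight)`, where `1_{s s*}` is the characteristic function
of the domain of `s s*` in the tight spectrum. -/
noncomputable def tightGen (s : S) : (tightAction S).Cc :=
  ⟨(tightAction S).deltaRight (Set.indicator ((tightAction S).dom (s * star s)) fun _ => 1) s,
    tightGen_mem s⟩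

end TightAction

/-- A representation of an inverse semigroup `S` on a Hilbert space `H`. -/
structure HilbertRep (S : Type u) [InverseSemigroup S] (H : Type v) [NormedAddCommGroup H]
    [InnerProductSpace ℂ H] [CompleteSpace H] where
  toFun : S → H →L[ℂ] H
  map_mul (s t : S) : toFun (s * t) = toFun s * toFun t
  map_star (s : S) : toFun (star s) = star (toFun s)

namespace HilbertRep

section

variable {S : Type u} [InverseSemigroup S] {H : Type v} [NormedAddCommGroup H]
  [InnerProductSpace ℂ H] [CompleteSpace H] (σ : HilbertRep S H)

/-- The unital *-subalgebra of `B(H)` generated by the operators `σ_e`, `e ∈ E(S)`. -/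
noncomputable def idemSubalgebra : StarSubalgebra ℂ (H →L[ℂ] H) :=
  StarAlgebra.adjoin ℂ (Set.range fun e : Idem S => σ.toFun e.1)

/-- The closed unital *-subalgebra of `B(H)` generated by the operators `σ_e`, `e ∈ E(S)`. -/
noncomputable def idemAlgebra : StarSubalgebra ℂ (H →L[ℂ] H) := σ.idemSubalgebra.topologicalClosure

theorem idemSubalgebra_comm (x y : σ.idemSubalgebra) : x * y = y * x := by
  have hs : ∀ e : Idem S, star (σ.toFun e.1) = σ.toFun e.1 := fun e => by
    rw [← σ.map_star, star_of_idem e.2]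
  have hc : ∀ e f : Idem S, σ.toFun e.1 * σ.toFun f.1 = σ.toFun f.1 * σ.toFun e.1 := fun e f => by
    rw [← σ.map_mul, ← σ.map_mul, idem_comm e.2 f.2]
  have h : IsMulCommutative (StarAlgebra.adjoin ℂ (Set.range fun e : Idem S => σ.toFun e.1)) := by
    refine StarAlgebra.isMulCommutative_adjoin ℂ ?_ ?_
    · rintro _ ⟨e, rfl⟩ _ ⟨f, rfl⟩
      exact hc e f
    · rintro _ ⟨e, rfl⟩ _ ⟨f, rfl⟩
      simp only [hs]
      exact hc e f
  exact h.is_comm.comm x y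

noncomputable instance : CommRing σ.idemAlgebra :=
  StarSubalgebra.commRingTopologicalClosure σ.idemSubalgebra σ.idemSubalgebra_comm

theorem map_idem_mem (e : Idem S) : σ.toFun e.1 ∈ σ.idemAlgebra :=
  σ.idemSubalgebra.le_topologicalClosure (StarAlgebra.subset_adjoin ℂ _ ⟨e, rfl⟩)

/-- The Boolean algebra of idempotents of the commutative algebra `idemAlgebra`, with the operations
`a ⊓ b = a b`, `a ⊔ b = a + b - a b` and `aᶜ = 1 - a`. -/
abbrev IdemBoolean : Type v := {a : σ.idemAlgebra // IsIdempotentElem a}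

/-- The restriction of `σ` to `E(S)`. -/
def onIdem (e : Idem S) : σ.IdemBoolean :=
  ⟨⟨σ.toFun e.1, σ.map_idem_mem e⟩, Subtype.ext (by
    change σ.toFun e.1 * σ.toFun e.1 = σ.toFun e.1
    rw [← σ.map_mul, e.2])⟩

/-- `σ` is nondegenerate: the vectors `σ_s ξ` span a dense subspace. -/
def Nondegenerate : Prop :=
  (Submodule.span ℂ {η : H | ∃ (s : S) (ξ : H), η = σ.toFun s ξ}).topologicalClosure = ⊤

end

/-- A representation `σ` of `S` is tight if its restriction to `E(S)` is a tight representation in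
the Boolean algebra of idempotents of the closed unital algebra generated by the `σ_e`. -/
def IsTight {S : Type u} [InverseSemigroupWithZero S] {H : Type v} [NormedAddCommGroup H]
    [InnerProductSpace ℂ H] [CompleteSpace H] (σ : HilbertRep S H) : Prop :=
  Semilattice.IsTight σ.onIdem

end HilbertRep

/-- A *-representation `ρ` of a C*-algebra is nondegenerate: the vectors `ρ(a) ξ` span a dense
subspace. -/
def NondegenerateRep {A : Type u} [NonUnitalCStarAlgebra A] {H : Type v} [NormedAddCommGroup H]
    [InnerProductSpace ℂ H] [CompleteSpace H] (ρ : A →⋆ₙₐ[ℂ] (H →L[ℂ] H)) : Prop :=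
  (Submodule.span ℂ {η : H | ∃ (a : A) (ξ : H), η = ρ a ξ}).topologicalClosure = ⊤

/-! Two facts make the generators $1_{ss^*}\delta_s$ decisive. Every element of $C_c(\mathcal G_{\rm
tight})$ is a finite sum of sections $\delta_s h$ with $h\in C_0(\widehat E_{\rm tight})$
(`tightSection_induction`), and the indicators $1_e$ of the compact open sets $D_e$ span
$C_0(\widehat E_{\rm tight})$ densely (`span_tightInd_dense`, by Stone–Weierstrass). Since $\delta_s
1_e$ is the generator of $se$ and $h\mapsto\pi(\delta_s h)$ is contractive, a representation is
determined by its values on generators (`rep_ext`).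

From $\sigma$ to $\rho$: a character of the commutative C*-algebra generated by the $\sigma_e$ turns
$e\mapsto\sigma_e$ into a tight $\{0,1\}$-valued map, that is, zero or a point of $\widehat E_{\rm
tight}$. Gelfand duality then gives $\Phi:C_0(\widehat E_{\rm tight})\to B(H)$ with
$\Phi(1_e)=\sigma_e$ (`exists_functionalCalculus`). The integrated form should be $\delta_s
h\mapsto\sigma_s\Phi(h)$; it is multiplicative because
$\Phi(f)\sigma_t=\sigma_t\Phi(f\circ\theta_t)$ (`covariance`). The hard point is that it is well
defined, since sections over different $s$ overlap and the groupoid need not be Hausdorff. If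
$\sum\delta_{s_i}h_i=0$, then near each $\varphi$ a single idempotent $e$ realises all coincidences
among the germs $[s_i,\varphi]$, whence $\sum h_i(\varphi)\sigma_{s_ie}=0$ over the $i$ with
$\varphi\in D_{s_i^*s_i}$. A partition of unity subordinate to neighbourhoods where the $h_i$ are
nearly constant makes $\sum\sigma_{s_i}\Phi(h_i)$ arbitrarily small
(`sum_eq_zero_of_sum_tightSection_eq_zero`). The result is bounded by the full norm and extends to
the completion.

From $\rho$ to $\sigma$: put $\sigma_s=\rho(i(1_{ss^*}\delta_s))$. For a cover $Z$ of $E^{X,Y}$ let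
$q=\bigwedge_X\sigma_x\wedge\bigwedge_Y\neg\sigma_y\wedge\bigwedge_Z\neg\sigma_z$. Below a fixed
$e$, the projection $q$ acts as a function on $\widehat E_{\rm tight}$ that vanishes at every tight
point, so $q\sigma_e=0$ (`mul_rep_tightGen_eq_zero`). If some $x\in X$ exists, then $q=q\sigma_x=0$.
If $X=\emptyset$, then $Y\cup Z$ is a finite cover of $E$, and the nondegeneracy imposed on $\rho$
in that case gives $q=0$. Conversely, a finite cover $Z$ of $E$ forces $\bigvee_Z\sigma_z=1$ for
tight $\sigma$, so the condition on $\rho$ is necessary. -/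

open scoped ZeroAtInfty Topology

/-! ### Functions vanishing at infinity: extension by zero and the one-point compactification -/

namespace ZeroAtInftyContinuousMap

section

open Filter

variable {X : Type u} [TopologicalSpace X]

open Classical in
/-- The extension by zero of a function that is continuous on a compact clopen set. -/
noncomputable def ofClopen (K : Set X) (hK : IsClopen K) (hc : IsCompact K) (h : X → ℂ)
    (hh : ContinuousOn h K) : C₀(X, ℂ) where
  toFun := K.indicator h
  -- A clopen set has empty frontier, so no matching condition at the boundary arises.
  continuous_toFun := continuous_indicator (by simp [hK.frontier_eq]) (by rwa [hK.1.closure_eq])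
  zero_at_infty' := by
    refine Tendsto.congr' ?_ tendsto_const_nhds
    filter_upwards [hc.compl_mem_cocompact] with x hx
    exact (Set.indicator_of_notMem hx h).symm

open Classical in
theorem ofClopen_apply (K : Set X) (hK : IsClopen K) (hc : IsCompact K) (h : X → ℂ)
    (hh : ContinuousOn h K) (x : X) : ofClopen K hK hc h hh x = if x ∈ K then h x else 0 :=
  Set.indicator_apply K h x

theorem norm_apply_le_norm (f : C₀(X, ℂ)) (x : X) : ‖f x‖ ≤ ‖f‖ := by
  rw [← norm_toBCF_eq_norm]
  exact f.toBCF.norm_coe_le_norm x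

theorem norm_le_of_forall {f : C₀(X, ℂ)} {C : ℝ} (hC : 0 ≤ C) (h : ∀ x, ‖f x‖ ≤ C) : ‖f‖ ≤ C := by
  rw [← norm_toBCF_eq_norm]
  exact (BoundedContinuousFunction.norm_le hC).2 h

/-- Functions vanishing at infinity extend to the one-point compactification. -/
noncomputable def toOnePoint [T2Space X] (f : C₀(X, ℂ)) : C(OnePoint X, ℂ) :=
  OnePoint.continuousMapMk f.toContinuousMap 0 (by
    rw [coclosedCompact_eq_cocompact]; exact f.zero_at_infty')

end

end ZeroAtInftyContinuousMap

/-! ### Density of the indicators of basic compact open sets -/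

namespace Semilattice

section TightFunctions

open ZeroAtInftyContinuousMap (ofClopen ofClopen_apply norm_le_of_forall norm_apply_le_norm toOnePoint)

variable {E : Type u} [SemilatticeInf E] [OrderBot E]

/-- The compact open set of all tight semicharacters that do not vanish at `e`. -/
def tightBasic (e : E) : Set (tightSpectrum E) := {φ | φ.1.1 e = true}

theorem mem_tightBasic {e : E} {φ : tightSpectrum E} : φ ∈ tightBasic e ↔ φ.1.1 e = true := Iff.rfl

theorem isClopen_tightBasic (e : E) : IsClopen (tightBasic e) :=
  (isClopen_discrete ({true} : Set Bool)).preimage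
    ((continuous_spectrum_apply e).comp continuous_subtype_val)

theorem isCompact_tightBasic (e : E) : IsCompact (tightBasic e) := isCompact_tight e

theorem mem_tightBasic_inf {e f : E} {φ : tightSpectrum E} :
    φ ∈ tightBasic (e ⊓ f) ↔ φ ∈ tightBasic e ∧ φ ∈ tightBasic f := by
  simp only [mem_tightBasic, φ.1.2.2, Bool.and_eq_true]

/-- The characteristic function of `tightBasic e`. -/
noncomputable def tightInd (e : E) : C₀(tightSpectrum E, ℂ) :=
  ofClopen (tightBasic e) (isClopen_tightBasic e) (isCompact_tightBasic e) (fun _ => 1)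
    continuousOn_const

open Classical in
theorem tightInd_apply (e : E) (φ : tightSpectrum E) :
    tightInd e φ = if φ ∈ tightBasic e then 1 else 0 :=
  ofClopen_apply _ _ _ _ _ φ

theorem tightInd_inf (e f : E) : tightInd (e ⊓ f) = tightInd e * tightInd f := by
  ext φ
  have h := mem_tightBasic_inf (e := e) (f := f) (φ := φ)
  simp only [ZeroAtInftyContinuousMap.mul_apply, tightInd_apply]
  by_cases h1 : φ ∈ tightBasic e <;> by_cases h2 : φ ∈ tightBasic f <;> simp [h, h1, h2]

theorem star_tightInd (e : E) : star (tightInd e) = tightInd e := by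
  ext φ
  rw [ZeroAtInftyContinuousMap.star_apply, tightInd_apply]
  split_ifs <;> simp

theorem exists_mem_tightBasic (φ : tightSpectrum E) : ∃ e, φ ∈ tightBasic e := φ.1.2.1

/-- Since $1_e1_f=1_{e\wedge f}$, the linear span of the indicators is already an algebra; no
products of generators need to be adjoined. -/
theorem mul_mem_span_tightInd {a b : C₀(tightSpectrum E, ℂ)}
    (ha : a ∈ Submodule.span ℂ (Set.range (tightInd (E := E))))
    (hb : b ∈ Submodule.span ℂ (Set.range (tightInd (E := E)))) :
    a * b ∈ Submodule.span ℂ (Set.range (tightInd (E := E))) := by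
  induction ha using Submodule.span_induction with
  | mem x hx =>
    obtain ⟨e, rfl⟩ := hx
    induction hb using Submodule.span_induction with
    | mem y hy =>
      obtain ⟨f, rfl⟩ := hy
      rw [← tightInd_inf]
      exact Submodule.subset_span ⟨_, rfl⟩
    | zero => rw [mul_zero]; exact zero_mem _
    | add y z _ _ h1 h2 => rw [mul_add]; exact add_mem h1 h2
    | smul c y _ h => rw [mul_smul_comm]; exact Submodule.smul_mem _ _ h
  | zero => rw [zero_mul]; exact zero_mem _
  | add y z _ _ h1 h2 => rw [add_mul]; exact add_mem h1 h2
  | smul c y _ h => rw [smul_mul_assoc]; exact Submodule.smul_mem _ _ h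

/-- The unital *-algebra generated by the functions `tightInd e` on the one-point compactification
of the tight spectrum. -/
noncomputable def tightIndAlgebra (E : Type u) [SemilatticeInf E] [OrderBot E] :
    StarSubalgebra ℂ C(OnePoint (tightSpectrum E), ℂ) :=
  StarAlgebra.adjoin ℂ (Set.range fun e : E => (tightInd e).toOnePoint)

/-- Distinct semicharacters differ at some $e$. The point at infinity is separated from each
$\varphi$ because $\varphi$ is not identically zero, while every $1_e$ extends by $0$ at infinity.
-/
theorem tightIndAlgebra_separatesPoints :
    (tightIndAlgebra E).SeparatesPoints := by
  have key : ∀ (e : E) (x y : OnePoint (tightSpectrum E)),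
      (tightInd e).toOnePoint x ≠ (tightInd e).toOnePoint y →
      ∃ f ∈ (fun f : C(OnePoint (tightSpectrum E), ℂ) => (f : OnePoint (tightSpectrum E) → ℂ)) ''
        (tightIndAlgebra E : Set C(OnePoint (tightSpectrum E), ℂ)), f x ≠ f y :=
    fun e x y h => ⟨_, ⟨_, StarAlgebra.subset_adjoin ℂ _ ⟨e, rfl⟩, rfl⟩, h⟩
  have val : ∀ (e : E) (φ : tightSpectrum E),
    (tightInd e).toOnePoint (φ : OnePoint (tightSpectrum E)) = tightInd e φ := fun _ _ => rfl
  have val' : ∀ (e : E), (tightInd e).toOnePoint OnePoint.infty = 0 := fun _ => rfl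
  have inf_ne : ∀ φ : tightSpectrum E, ∃ e, tightInd e φ ≠ 0 := by
    intro φ
    obtain ⟨e, he⟩ := exists_mem_tightBasic φ
    exact ⟨e, by simp [tightInd_apply, he]⟩
  intro x y hxy
  induction x using OnePoint.rec with
  | infty =>
    induction y using OnePoint.rec with
    | infty => exact absurd rfl hxy
    | coe ψ =>
      obtain ⟨e, he⟩ := inf_ne ψ
      exact key e _ _ (by rw [val, val']; exact he.symm)
  | coe φ =>
    induction y using OnePoint.rec with
    | infty =>
      obtain ⟨e, he⟩ := inf_ne φ
      exact key e _ _ (by rw [val, val']; exact he)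
    | coe ψ =>
      have hne : ∃ e, φ.1.1 e ≠ ψ.1.1 e := by
        by_contra! h
        exact hxy (congrArg _ (Subtype.ext (Subtype.ext (funext h))))
      obtain ⟨e, he⟩ := hne
      refine key e _ _ ?_
      rw [val, val, tightInd_apply, tightInd_apply, mem_tightBasic, mem_tightBasic]
      cases h1 : φ.1.1 e <;> cases h2 : ψ.1.1 e <;> simp_all

/-- Adjoining a unit to the span of the indicators adds only the constants. The constant is the
value at infinity, which is how it is controlled in the density proof. -/
theorem exists_of_mem_tightIndAlgebra {a : C(OnePoint (tightSpectrum E), ℂ)}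
    (ha : a ∈ tightIndAlgebra E) :
    ∃ (c : ℂ), ∃ b ∈ Submodule.span ℂ (Set.range (tightInd (E := E))),
      a OnePoint.infty = c ∧ ∀ φ : tightSpectrum E, a φ = c + b φ := by
  induction ha using StarAlgebra.adjoin_induction with
  | mem x hx =>
    obtain ⟨e, rfl⟩ := hx
    exact ⟨0, tightInd e, Submodule.subset_span ⟨e, rfl⟩, rfl, fun φ => (zero_add _).symm⟩
  | algebraMap c => exact ⟨c, 0, zero_mem _, rfl, fun φ => by simp⟩
  | add x y _ _ h1 h2 =>
    obtain ⟨c, b, hb, h3, h4⟩ := h1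
    obtain ⟨c', b', hb', h3', h4'⟩ := h2
    exact ⟨c + c', b + b', add_mem hb hb', by simp [h3, h3'],
      fun φ => by simp only [ContinuousMap.add_apply, h4, h4', ZeroAtInftyContinuousMap.add_apply]; ring⟩
  | mul x y _ _ h1 h2 =>
    obtain ⟨c, b, hb, h3, h4⟩ := h1
    obtain ⟨c', b', hb', h3', h4'⟩ := h2
    refine ⟨c * c', c • b' + c' • b + b * b', add_mem (add_mem (Submodule.smul_mem _ _ hb')
      (Submodule.smul_mem _ _ hb)) (mul_mem_span_tightInd hb hb'), by simp [h3, h3'],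
      fun φ => ?_⟩
    simp only [ContinuousMap.mul_apply, h4, h4', ZeroAtInftyContinuousMap.add_apply,
      ZeroAtInftyContinuousMap.smul_apply, ZeroAtInftyContinuousMap.mul_apply, smul_eq_mul]
    ring
  | star x _ h1 =>
    obtain ⟨c, b, hb, h3, h4⟩ := h1
    refine ⟨star c, star b, ?_, by simp [h3], fun φ => by simp [h4]⟩
    clear h4
    induction hb using Submodule.span_induction with
    | mem x hx =>
      obtain ⟨e, rfl⟩ := hx
      rw [star_tightInd]
      exact Submodule.subset_span ⟨e, rfl⟩
    | zero => rw [star_zero]; exact zero_mem _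
    | add y z _ _ h1 h2 => rw [star_add]; exact add_mem h1 h2
    | smul c y _ h => rw [star_smul]; exact Submodule.smul_mem _ _ h

variable (E) in
/-- The characteristic functions of the sets `tightBasic e` span a dense subspace. -/
theorem span_tightInd_dense :
    (Submodule.span ℂ (Set.range (tightInd (E := E)))).topologicalClosure = ⊤ := by
  rw [Submodule.eq_top_iff']
  intro f
  change f ∈ closure _
  rw [Metric.mem_closure_iff]
  intro ε hε
  have h1 := ContinuousMap.starSubalgebra_topologicalClosure_eq_top_of_separatesPoints
    (tightIndAlgebra E) tightIndAlgebra_separatesPoints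
  have h2 : f.toOnePoint ∈ closure (tightIndAlgebra E : Set C(OnePoint (tightSpectrum E), ℂ)) := by
    have : f.toOnePoint ∈ (tightIndAlgebra E).topologicalClosure := by rw [h1]; trivial
    exact this
  obtain ⟨a, ha, hfa⟩ := Metric.mem_closure_iff.1 h2 (ε / 3) (by positivity)
  obtain ⟨c, b, hb, h3, h4⟩ := exists_of_mem_tightIndAlgebra ha
  refine ⟨b, hb, ?_⟩
  have h5 : ∀ x, ‖f.toOnePoint x - a x‖ ≤ ε / 3 := fun x => by
    rw [← dist_eq_norm]
    exact (ContinuousMap.dist_apply_le_dist x).trans hfa.le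
  -- The extension of $f$ vanishes at infinity, so the constant part of the approximant is itself
  -- small. Dropping it costs a second $\varepsilon/3$, which still leaves a strict inequality.
  have h6 : ‖c‖ ≤ ε / 3 := by
    have := h5 OnePoint.infty
    rwa [h3, show f.toOnePoint OnePoint.infty = 0 from rfl, zero_sub, norm_neg] at this
  rw [dist_eq_norm]
  refine (norm_le_of_forall (C := ε / 3 + ε / 3) (by positivity) fun φ => ?_).trans_lt
    (by linarith)
  have h7 := h5 φ
  rw [h4, show f.toOnePoint (φ : OnePoint (tightSpectrum E)) = f φ from rfl] at h7
  calc ‖(f - b) φ‖ = ‖(f φ - (c + b φ)) + c‖ := by rw [ZeroAtInftyContinuousMap.sub_apply]; congr 1; ring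
    _ ≤ ε / 3 + ε / 3 := (norm_add_le _ _).trans (add_le_add h7 h6)

/-- This is density in the form of an induction principle: a closed linear condition has to be
checked on indicators only. -/
theorem tightInd_induction {p : C₀(tightSpectrum E, ℂ) → Prop} (hp : IsClosed {f | p f})
    (ind : ∀ e, p (tightInd e)) (zero : p 0) (add : ∀ f g, p f → p g → p (f + g))
    (smul : ∀ (c : ℂ) f, p f → p (c • f)) (f : C₀(tightSpectrum E, ℂ)) : p f := by
  have h : f ∈ (Submodule.span ℂ (Set.range (tightInd (E := E)))).topologicalClosure := by
    rw [span_tightInd_dense]; trivial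
  refine closure_minimal ?_ hp h
  intro g hg
  induction (show g ∈ Submodule.span ℂ (Set.range (tightInd (E := E))) from hg) using
    Submodule.span_induction with
  | mem x hx => obtain ⟨e, rfl⟩ := hx; exact ind e
  | zero => exact zero
  | add x y hx hy h1 h2 => exact add _ _ (h1 hx) (h2 hy)
  | smul c x hx h1 => exact smul _ _ (h1 hx)

end TightFunctions

end Semilattice

/-! ### Functional calculus of a tight representation of the semilattice -/

namespace Semilattice

section CommutativeTight

open WeakDual

variable {E : Type u} [SemilatticeInf E] [OrderBot E]

open Classical in
/-- The homomorphism of Boolean algebras induced on idempotents by a character. -/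
noncomputable def boolOfCharacter {R : Type v} [CommRing R] (χ : R →+* ℂ) :
    BoundedLatticeHom {a : R // IsIdempotentElem a} Bool :=
  have h01 : ∀ a : {a : R // IsIdempotentElem a}, χ a.1 = 0 ∨ χ a.1 = 1 := fun a =>
    IsIdempotentElem.iff_eq_zero_or_one.1 (a.2.map χ)
  { toFun := fun a => decide (χ a.1 = 1)
    map_inf' := fun a b => by
      have h : χ (a ⊓ b).1 = χ a.1 * χ b.1 := map_mul χ a.1 b.1
      rw [h]
      rcases h01 a with ha | ha <;> rcases h01 b with hb | hb <;> simp [ha, hb]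
    map_sup' := fun a b => by
      have h : χ (a ⊔ b).1 = χ a.1 + χ b.1 - χ a.1 * χ b.1 := by
        change χ (a.1 + b.1 - a.1 * b.1) = _
        rw [map_sub, map_add, map_mul]
      rw [h]
      rcases h01 a with ha | ha <;> rcases h01 b with hb | hb <;> simp [ha, hb]
    map_top' := by
      have h : χ (⊤ : {a : R // IsIdempotentElem a}).1 = 1 := map_one χ
      simp [h]
    map_bot' := by
      have h : χ (⊥ : {a : R // IsIdempotentElem a}).1 = 0 := map_zero χ
      simp [h] }

theorem boolOfCharacter_eq_true {R : Type v} [CommRing R] {χ : R →+* ℂ}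
    {a : {a : R // IsIdempotentElem a}} : boolOfCharacter χ a = true ↔ χ a.1 = 1 := by
  classical
  exact decide_eq_true_iff

/-- A homomorphism of Boolean algebras preserves order, finite meets and joins, and complements,
hence every tightness inequality. -/
theorem IsTight.comp {B : Type v} {C : Type w} [BooleanAlgebra B] [BooleanAlgebra C] {β : E → B}
    (hβ : IsTight β) (f : BoundedLatticeHom B C) : IsTight fun e => f (β e) where
  map_bot := by rw [hβ.map_bot, map_bot]
  map_inf x y := by rw [hβ.map_inf, map_inf]
  tight X Y Z hZ := by
    have h := OrderHomClass.mono f (hβ.tight X Y Z hZ)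
    rw [map_inf, map_finset_inf, map_finset_inf, map_finset_sup] at h
    have h2 : (⇑f ∘ fun y => (β y)ᶜ) = fun y => (f (β y))ᶜ := funext fun y => map_compl' f (β y)
    rw [h2] at h
    exact h

variable {A : Type v} [CommCStarAlgebra A] {β : E → {a : A // IsIdempotentElem a}}

/-- A character takes the values $0$ and $1$ on idempotents and so induces a Boolean homomorphism to
$\{0,1\}$. Composing it with `β` yields a tight map, and `h` says that this map is not zero. This is
where tightness of `β` enters. -/
theorem exists_tight_of_character (hβ : IsTight β) (χ : characterSpace ℂ A)
    (h : ∃ e, χ (β e).1 = 1) :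
    ∃ φ : tightSpectrum E, ∀ e, χ (β e).1 = tightInd e φ := by
  let f := boolOfCharacter (CharacterSpace.toAlgHom χ : A →+* ℂ)
  have hf : ∀ a, f a = true ↔ χ a.1 = 1 := fun a => boolOfCharacter_eq_true
  have ht := hβ.comp f
  obtain ⟨e, he⟩ := h
  refine ⟨⟨⟨fun e => f (β e), ⟨e, (hf _).2 he⟩, ht.map_inf⟩, ht⟩, fun e => ?_⟩
  rw [tightInd_apply, mem_tightBasic]
  split_ifs with h1
  · exact (hf _).1 h1
  · exact (IsIdempotentElem.iff_eq_zero_or_one.1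
      ((β e).2.map (CharacterSpace.toAlgHom χ))).resolve_right fun h => h1 ((hf _).2 h)

open Classical in
/-- The function on the character space of `A` that corresponds to a function on the tight
spectrum. -/
noncomputable def pullChar (hβ : IsTight β) (f : C₀(tightSpectrum E, ℂ))
    (χ : characterSpace ℂ A) : ℂ :=
  -- Characters that vanish on every `β e` play the role of the point at infinity, hence the value
  -- $0$. For the others the chosen point is the only one possible, since its values on $E$ are
  -- prescribed.
  if h : ∃ e, χ (β e).1 = 1 then f (exists_tight_of_character hβ χ h).choose else 0

theorem pullChar_tightInd (hβ : IsTight β) (e : E) (χ : characterSpace ℂ A) :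
    pullChar hβ (tightInd e) χ = χ (β e).1 := by
  unfold pullChar
  split_ifs with h
  · exact ((exists_tight_of_character hβ χ h).choose_spec e).symm
  · push Not at h
    exact ((IsIdempotentElem.iff_eq_zero_or_one.1
      ((β e).2.map (CharacterSpace.toAlgHom χ))).resolve_right (h e)).symm

theorem pullChar_add (hβ : IsTight β) (f g : C₀(tightSpectrum E, ℂ)) (χ : characterSpace ℂ A) :
    pullChar hβ (f + g) χ = pullChar hβ f χ + pullChar hβ g χ := by
  unfold pullChar; split_ifs <;> simp

theorem pullChar_mul (hβ : IsTight β) (f g : C₀(tightSpectrum E, ℂ)) (χ : characterSpace ℂ A) :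
    pullChar hβ (f * g) χ = pullChar hβ f χ * pullChar hβ g χ := by
  unfold pullChar; split_ifs <;> simp

theorem pullChar_smul (hβ : IsTight β) (c : ℂ) (f : C₀(tightSpectrum E, ℂ))
    (χ : characterSpace ℂ A) : pullChar hβ (c • f) χ = c • pullChar hβ f χ := by
  unfold pullChar; split_ifs <;> simp

theorem pullChar_star (hβ : IsTight β) (f : C₀(tightSpectrum E, ℂ)) (χ : characterSpace ℂ A) :
    pullChar hβ (star f) χ = star (pullChar hβ f χ) := by
  unfold pullChar; split_ifs <;> simp

theorem pullChar_zero (hβ : IsTight β) (χ : characterSpace ℂ A) :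
    pullChar hβ (0 : C₀(tightSpectrum E, ℂ)) χ = 0 := by
  unfold pullChar; split_ifs <;> simp

theorem norm_pullChar_sub_le (hβ : IsTight β) (f g : C₀(tightSpectrum E, ℂ))
    (χ : characterSpace ℂ A) : ‖pullChar hβ f χ - pullChar hβ g χ‖ ≤ ‖f - g‖ := by
  unfold pullChar; split_ifs
  · rw [← ZeroAtInftyContinuousMap.sub_apply]
    exact ZeroAtInftyContinuousMap.norm_apply_le_norm _ _
  · simp

/-- For an indicator the pullback is the Gelfand transform of `β e`, which is continuous. Linear
combinations and uniform limits preserve continuity, the latter through `norm_pullChar_sub_le`, and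
indicators span a dense subspace. No topological property of the map from characters to points is
needed. -/
theorem continuous_pullChar (hβ : IsTight β) (f : C₀(tightSpectrum E, ℂ)) :
    Continuous (pullChar hβ f) := by
  induction f using tightInd_induction with
  | hp =>
    refine isClosed_of_closure_subset fun f hf => ?_
    refine continuous_of_uniform_approx_of_continuous fun s hs => ?_
    obtain ⟨ε, hε, hεs⟩ := Metric.mem_uniformity_dist.1 hs
    obtain ⟨g, hg, hfg⟩ := Metric.mem_closure_iff.1 hf ε hε
    refine ⟨pullChar hβ g, hg, fun χ => hεs ?_⟩
    rw [dist_eq_norm] at hfg ⊢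
    exact (norm_pullChar_sub_le hβ f g χ).trans_lt hfg
  | ind e =>
    refine (map_continuous (gelfandTransform ℂ A (β e).1)).congr fun χ => ?_
    rw [pullChar_tightInd]; rfl
  | zero => exact continuous_const.congr fun χ => (pullChar_zero hβ χ).symm
  | add f g hf hg => exact (hf.add hg).congr fun χ => (pullChar_add hβ f g χ).symm
  | smul c f hf => exact (hf.const_smul c).congr fun χ => (pullChar_smul hβ c f χ).symm

/-- A tight representation of `E` in the idempotents of a commutative C*-algebra extends to the
algebra of functions on the tight spectrum. -/
noncomputable def tightFunctionalCalculus (hβ : IsTight β) : C₀(tightSpectrum E, ℂ) →⋆ₙₐ[ℂ] A :=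
  ((gelfandStarTransform A).symm : C(characterSpace ℂ A, ℂ) →⋆ₙₐ[ℂ] A).comp
    { toFun := fun f => ⟨pullChar hβ f, continuous_pullChar hβ f⟩
      map_smul' := fun c f => ContinuousMap.ext fun χ => pullChar_smul hβ c f χ
      map_zero' := ContinuousMap.ext fun χ => pullChar_zero hβ χ
      map_add' := fun f g => ContinuousMap.ext fun χ => pullChar_add hβ f g χ
      map_mul' := fun f g => ContinuousMap.ext fun χ => pullChar_mul hβ f g χ
      map_star' := fun f => ContinuousMap.ext fun χ => pullChar_star hβ f χ }

theorem tightFunctionalCalculus_tightInd (hβ : IsTight β) (e : E) :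
    tightFunctionalCalculus hβ (tightInd e) = (β e).1 := by
  have h : (⟨pullChar hβ (tightInd e), continuous_pullChar hβ (tightInd e)⟩ :
      C(characterSpace ℂ A, ℂ)) = gelfandStarTransform A (β e).1 :=
    ContinuousMap.ext fun χ => pullChar_tightInd hβ e χ
  exact (congrArg (gelfandStarTransform A).symm h).trans
    ((gelfandStarTransform A).symm_apply_apply _)

end CommutativeTight

end Semilattice

/-! ### From a tight representation to a representation of functions on the tight spectrum -/

namespace HilbertRep

section

variable {S : Type u} [InverseSemigroupWithZero S] {H : Type v} [NormedAddCommGroup H]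
  [InnerProductSpace ℂ H] [CompleteSpace H] (σ : HilbertRep S H)

/-- The closed algebra generated by the `σ_e` is a commutative C*-algebra. -/
@[reducible] noncomputable def commCStarAlgebraIdem : CommCStarAlgebra σ.idemAlgebra :=
  { StarSubalgebra.cstarAlgebra σ.idemAlgebra
      (h_closed := StarSubalgebra.isClosed_topologicalClosure _) with
    mul_comm := fun a b => mul_comm a b }

/-- A tight representation of `S` gives a representation of the algebra of functions on the tight
spectrum. -/
theorem exists_functionalCalculus (hσ : σ.IsTight) :
    ∃ Φ : C₀(tightSpectrum (Idem S), ℂ) →⋆ₙₐ[ℂ] (H →L[ℂ] H),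
      ∀ e, Φ (tightInd e) = σ.toFun e.1 := by
  let _ := σ.commCStarAlgebraIdem
  have h : Semilattice.IsTight (B := {a : σ.idemAlgebra // IsIdempotentElem a}) σ.onIdem := hσ
  let Φ := tightFunctionalCalculus h
  exact ⟨
    { toFun := fun f => (Φ f).1
      map_smul' := fun c f => congrArg Subtype.val (map_smul Φ c f)
      map_zero' := congrArg Subtype.val (map_zero Φ)
      map_add' := fun f g => congrArg Subtype.val (map_add Φ f g)
      map_mul' := fun f g => congrArg Subtype.val (_root_.map_mul Φ f g)
      map_star' := fun f => congrArg Subtype.val (StarHomClass.map_star Φ f) },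
    fun e => congrArg Subtype.val (tightFunctionalCalculus_tightInd h e)⟩

end

end HilbertRep

/-! ### Sections over elements of the semigroup and their algebra -/

section TightSections

open PartialAction

variable {S : Type u} [InverseSemigroupWithZero S]

theorem dom_tightAction (s : S) : (tightAction S).dom s = tightBasic (source s) := rfl

theorem source_mul_idem (s : S) (e : Idem S) : source (s * e.1) = e ⊓ source s := by
  rw [source_mul, conj_idem]

/-- The function `δ_s h` for `h` vanishing at infinity on the tight spectrum. -/
noncomputable def tightSection (s : S) :
    C₀(tightSpectrum (Idem S), ℂ) →ₗ[ℂ] (tightAction S).Cc where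
  toFun h := ⟨(tightAction S).deltaLeft s h, basic_mem ⟨s, h, _, isCompact_dom_tightAction s,
    subset_rfl, h.continuous.continuousOn, fun _ hx hx' => absurd hx hx', rfl⟩⟩
  map_add' f g := Cc.ext (by
    funext γ
    change deltaLeft _ _ _ _ = deltaLeft _ _ _ _ + deltaLeft _ _ _ _
    unfold deltaLeft
    split_ifs <;> simp)
  map_smul' c f := Cc.ext (by
    funext γ
    change deltaLeft _ _ _ _ = c * deltaLeft _ _ _ _
    unfold deltaLeft
    split_ifs <;> simp)

theorem fn_tightSection (s : S) (h : C₀(tightSpectrum (Idem S), ℂ)) :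
    (tightSection s h).fn = (tightAction S).deltaLeft s h := rfl

theorem tightSection_congr {s : S} {f g : C₀(tightSpectrum (Idem S), ℂ)}
    (h : ∀ x ∈ tightBasic (source s), f x = g x) : tightSection s f = tightSection s g :=
  Cc.ext (deltaLeft_congr h)

/-- A basic function $\delta_s h$ only involves $h$ on the domain of $s$, which is compact and open
in the tight spectrum. Extending $h$ by zero from there gives an element of $C_0$ with the same
section. -/
theorem tightSection_induction {p : (tightAction S).Cc → Prop}
    (basic : ∀ s h, p (tightSection s h)) (add : ∀ f g, p f → p g → p (f + g))
    (smul : ∀ (c : ℂ) f, p f → p (c • f)) (f : (tightAction S).Cc) : p f := by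
  obtain ⟨f, hf⟩ := f
  induction hf using span_induction_basic with
  | basic F hF =>
    obtain ⟨s, h, K, -, -, hh, -, rfl⟩ := hF
    let k := ZeroAtInftyContinuousMap.ofClopen (tightBasic (source s))
      (isClopen_tightBasic _) (isCompact_tightBasic _) h hh
    have h1 : (tightAction S).deltaLeft s h = (tightAction S).deltaLeft s k :=
      deltaLeft_congr fun x hx => ?_
    · have h2 := basic s k
      simp only [h1]
      exact h2
    exact ((ZeroAtInftyContinuousMap.ofClopen_apply _ _ _ _ _ x).trans (if_pos hx)).symm
  | add f g hf hg h1 h2 => exact add _ _ h1 h2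
  | zero =>
    -- The zero element is itself a section, by linearity, so `basic` covers it.
    have h : p (tightSection 0 0) := basic 0 0
    rwa [map_zero] at h
  | smul c f hf h => exact smul c _ h

/-- Pulling back functions along the partial homeomorphism `θ_t`. -/
noncomputable def tightPull (t : S) :
    C₀(tightSpectrum (Idem S), ℂ) →ₗ[ℂ] C₀(tightSpectrum (Idem S), ℂ) where
  toFun f := ZeroAtInftyContinuousMap.ofClopen (tightBasic (source t))
      (isClopen_tightBasic _) (isCompact_tightBasic _) (fun x => f ((tightAction S).act t x))
      (f.continuous.comp_continuousOn ((tightAction S).continuousOn_act t))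
  map_add' f g := by
    ext x
    simp only [ZeroAtInftyContinuousMap.ofClopen_apply, ZeroAtInftyContinuousMap.add_apply]
    split_ifs <;> simp
  map_smul' c f := by
    ext x
    simp only [ZeroAtInftyContinuousMap.ofClopen_apply, ZeroAtInftyContinuousMap.smul_apply,
      RingHom.id_apply]
    split_ifs <;> simp

open Classical in
theorem tightPull_apply (t : S) (f : C₀(tightSpectrum (Idem S), ℂ)) (x : tightSpectrum (Idem S)) :
    tightPull t f x = if x ∈ tightBasic (source t) then f ((tightAction S).act t x) else 0 :=
  ZeroAtInftyContinuousMap.ofClopen_apply (tightBasic (source t)) (isClopen_tightBasic _)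
    (isCompact_tightBasic _) (fun x => f ((tightAction S).act t x))
    (f.continuous.comp_continuousOn ((tightAction S).continuousOn_act t)) x

theorem norm_tightPull_le (t : S) (f : C₀(tightSpectrum (Idem S), ℂ)) : ‖tightPull t f‖ ≤ ‖f‖ := by
  refine ZeroAtInftyContinuousMap.norm_le_of_forall (norm_nonneg _) fun x => ?_
  rw [tightPull_apply]
  split_ifs
  · exact f.norm_apply_le_norm _
  · simp

theorem continuous_tightPull (t : S) : Continuous (tightPull t) :=
  AddMonoidHomClass.continuous_of_bound (tightPull t) 1 fun f => by
    simpa using norm_tightPull_le t f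

theorem act_tightAction_apply {t : S} {x : tightSpectrum (Idem S)}
    (hx : x ∈ tightBasic (source t)) (e : Idem S) :
    ((tightAction S).act t x).1.1 e = x.1.1 (conj t e) := by
  have h : (tightAction S).act t x = ⟨spectralMap t x.1, spectralMap_mem_tight hx x.2⟩ :=
    dif_pos hx
  rw [h]
  exact spectralMap_apply hx e

-- By definition of the action, $\theta_t(x)(e)=x(t^*et)$.
open Classical in
theorem tightPull_tightInd (t : S) (e : Idem S) : tightPull t (tightInd e) = tightInd (conj t e) := by
  ext x
  rw [tightPull_apply, tightInd_apply, tightInd_apply]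
  by_cases hx : x ∈ tightBasic (source t)
  · rw [if_pos hx]
    refine if_congr ?_ rfl rfl
    rw [mem_tightBasic, mem_tightBasic, act_tightAction_apply hx]
  -- Outside the domain of $t$ both sides vanish, because $t^*et\le t^*t$.
  · exact (if_neg hx).trans (if_neg fun h => hx (Spectrum.mono x.1 (conj_le_source t e) h)).symm

theorem tightSection_mul (s t : S) (f g : C₀(tightSpectrum (Idem S), ℂ)) :
    tightSection s f * tightSection t g = tightSection (s * t) (tightPull t f * g) := by
  refine Cc.ext ?_
  rw [Cc.fn_mul, fn_tightSection, fn_tightSection, fn_tightSection, conv_deltaLeft]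
  refine deltaLeft_congr fun x hx => ?_
  have h : x ∈ tightBasic (source t) := (((tightAction S).mem_dom_mul s t x).1 hx).1
  rw [ZeroAtInftyContinuousMap.mul_apply, tightPull_apply, if_pos h]

theorem star_tightSection (s : S) (f : C₀(tightSpectrum (Idem S), ℂ)) :
    star (tightSection s f) = tightSection (star s) (tightPull (star s) (star f)) := by
  refine Cc.ext ?_
  rw [Cc.fn_star, fn_tightSection, fn_tightSection, adj_deltaLeft]
  refine deltaLeft_congr fun x hx => ?_
  rw [dom_tightAction] at hx
  rw [tightPull_apply, if_pos hx, ZeroAtInftyContinuousMap.star_apply]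

theorem fn_tightGen (s : S) : (tightGen s).fn = (tightAction S).deltaLeft s (fun _ => 1) := by
  funext γ
  change deltaRight _ _ _ _ = _
  unfold PartialAction.deltaRight PartialAction.deltaLeft
  split_ifs with hγ
  · obtain ⟨x, hx, _, rfl⟩ := hγ
    rw [PartialAction.Germ.r_mk]
    apply Set.indicator_of_mem
    have h1 := (tightAction S).act_mem_dom_star hx
    rw [← (tightAction S).mem_dom_source, star_star_eq] at h1
    exact h1
  · rfl

/-- The idempotent $e$ itself witnesses the equality of germs, as $se=(se)e$. -/
theorem germ_mk_mul_idem {s : S} {e : Idem S} {x : tightSpectrum (Idem S)}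
    (hx : x ∈ (tightAction S).dom s) (hx' : x ∈ (tightAction S).dom (s * e.1))
    (he : x ∈ tightBasic e) : Germ.mk s x hx = Germ.mk (s * e.1) x hx' := by
  refine Germ.mk_eq_mk.2 ⟨rfl, e.1, e.2, ?_, by rw [mul_assoc, e.2]⟩
  rw [dom_tightAction, source_idem]
  exact he

-- Over $D_e$ the germs of $s$ and $se$ coincide, and the domain of $se$ is the part of the domain
-- of $s$ inside $D_e$. Thus cutting a section down by an indicator amounts to multiplying in $S$,
-- which is the bridge between functions and generators.
open Classical in
theorem tightSection_tightInd (s : S) (e : Idem S) :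
    tightSection s (tightInd e) = tightGen (s * e.1) := by
  refine Cc.ext ?_
  rw [fn_tightSection, fn_tightGen]
  funext γ
  induction γ using Germ.ind with | h t x hx => ?_
  have key : x ∈ tightBasic e →
      (Germ.mk t x hx ∈ (tightAction S).Theta s ((tightAction S).dom s) ↔
        Germ.mk t x hx ∈ (tightAction S).Theta (s * e.1) ((tightAction S).dom (s * e.1))) := by
    intro he
    constructor
    · rintro ⟨y, hy, -, h⟩
      obtain rfl := (Germ.mk_eq_mk.1 h).1
      have h2 : x ∈ (tightAction S).dom (s * e.1) := by
        rw [dom_tightAction, source_mul_idem]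
        exact mem_tightBasic_inf.2 ⟨he, hy⟩
      exact ⟨x, h2, h2, h.trans (germ_mk_mul_idem hy h2 he)⟩
    · rintro ⟨y, hy, -, h⟩
      obtain rfl := (Germ.mk_eq_mk.1 h).1
      have h2 : x ∈ (tightAction S).dom s := by
        rw [dom_tightAction, source_mul_idem] at hy
        exact (mem_tightBasic_inf.1 hy).2
      exact ⟨x, h2, h2, h.trans (germ_mk_mul_idem h2 hy he).symm⟩
  unfold deltaLeft
  rw [Germ.d_mk, tightInd_apply]
  by_cases he : x ∈ tightBasic e
  · rw [if_pos he]
    exact if_congr (key he) rfl rfl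
  · rw [if_neg he, ite_self, if_neg]
    rintro ⟨y, hy, -, h⟩
    obtain rfl := (Germ.mk_eq_mk.1 h).1
    rw [dom_tightAction, source_mul_idem] at hy
    exact he (mem_tightBasic_inf.1 hy).1

theorem tightGen_eq_tightSection (s : S) : tightGen s = tightSection s (tightInd (source s)) := by
  rw [tightSection_tightInd]
  congr 1
  change s = s * (star s * s)
  rw [← mul_assoc, mul_star_mul_self]

theorem tightGen_mul (s t : S) : tightGen s * tightGen t = tightGen (s * t) := by
  refine Cc.ext ?_
  rw [Cc.fn_mul, fn_tightGen, fn_tightGen, fn_tightGen, conv_deltaLeft]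
  simp

theorem star_tightGen (s : S) : star (tightGen s) = tightGen (star s) := by
  refine Cc.ext ?_
  rw [Cc.fn_star, fn_tightGen, fn_tightGen, adj_deltaLeft]
  simp

/-- The generator of $ss^*$ is a left unit for all sections over $s$. Hence the image of any section
under a representation lies in the range of the operator of an idempotent; nondegeneracy and
annihilation arguments rest on this. -/
theorem tightGen_mul_tightSection (s : S) (h : C₀(tightSpectrum (Idem S), ℂ)) :
    tightGen (s * star s) * tightSection s h = tightSection s h := by
  rw [tightGen_eq_tightSection, tightSection_mul, mul_star_mul_self]
  refine tightSection_congr fun x hx => ?_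
  rw [ZeroAtInftyContinuousMap.mul_apply, tightPull_tightInd, tightInd_apply, if_pos, one_mul]
  convert hx using 2
  apply Idem.ext'
  change star s * (star (s * star s) * (s * star s)) * s = star s * s
  rw [star_of_idem (idem_mul_star s), idem_mul_star, ← mul_assoc, star_mul_mul_star]

variable {H : Type v} [NormedAddCommGroup H] [InnerProductSpace ℂ H] [CompleteSpace H]

/-- The bound comes from `norm_basic_le`, which controls the spectrum of $F^*F$ for $F=\delta_s h$.
It makes $h\mapsto\pi(\delta_s h)$ continuous for every $\pi$, so that density of the indicators can
be used. -/
theorem norm_tightSection_le (π : (tightAction S).Cc →⋆ₙₐ[ℂ] (H →L[ℂ] H)) (s : S)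
    (h : C₀(tightSpectrum (Idem S), ℂ)) : ‖π (tightSection s h)‖ ≤ ‖h‖ := by
  refine le_of_sq_le_sq ?_ (norm_nonneg h)
  exact norm_basic_le π (isCompact_dom_tightAction s) subset_rfl h.continuous.continuousOn
    (fun _ hx hx' => absurd hx hx') (by positivity)
    (fun x _ => pow_le_pow_left₀ (norm_nonneg _) (h.norm_apply_le_norm x) 2) _ rfl

theorem continuous_rep_tightSection (π : (tightAction S).Cc →⋆ₙₐ[ℂ] (H →L[ℂ] H)) (s : S) :
    Continuous fun h => π (tightSection s h) :=
  AddMonoidHomClass.continuous_of_bound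
    ((π : (tightAction S).Cc →ₗ[ℂ] (H →L[ℂ] H)).comp (tightSection s)) 1 fun h => by
    simpa using norm_tightSection_le π s h

/-- A *-representation of `C_c(G_tight)` is determined by its values on the generators. -/
theorem rep_ext {π π' : (tightAction S).Cc →⋆ₙₐ[ℂ] (H →L[ℂ] H)}
    (h : ∀ s, π (tightGen s) = π' (tightGen s)) : π = π' := by
  ext1 f
  induction f using tightSection_induction with
  | basic s k =>
    induction k using tightInd_induction with
    | hp => exact isClosed_eq (continuous_rep_tightSection π s) (continuous_rep_tightSection π' s)
    | ind e => rw [tightSection_tightInd, h]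
    | zero => simp only [map_zero]
    | add f g hf hg => simp only [map_add, hf, hg]
    | smul c f hf => simp only [map_smul, hf]
  | add f g hf hg => simp only [map_add, hf, hg]
  | smul c f hf => simp only [map_smul, hf]

end TightSections

/-! ### Integration of a tight representation -/

section TightIntegration

open PartialAction

variable {S : Type u} [InverseSemigroupWithZero S]

/-- Each equality of germs at $\varphi$ has its own witnessing idempotent. The product of finitely
many of them still contains $\varphi$ in its set $D_e$ and witnesses all the equalities at once. -/
theorem exists_idem_of_germ_eq {ι : Type w} (T : Finset (ι × ι)) (s : ι → S)
    (φ : tightSpectrum (Idem S)) : ∃ e : Idem S, φ ∈ tightBasic e ∧ ∀ p ∈ T,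
      ∀ (h1 : φ ∈ (tightAction S).dom (s p.1)) (h2 : φ ∈ (tightAction S).dom (s p.2)),
        Germ.mk (s p.1) φ h1 = Germ.mk (s p.2) φ h2 → s p.1 * e.1 = s p.2 * e.1 := by
  classical
  induction T using Finset.induction_on with
  | empty =>
    obtain ⟨e, he⟩ := exists_mem_tightBasic φ
    exact ⟨e, he, fun p hp => absurd hp (Finset.notMem_empty p)⟩
  | insert p T _ ih =>
    obtain ⟨e, he, h⟩ := ih
    have hp : ∃ f : Idem S, φ ∈ tightBasic f ∧
        ∀ (h1 : φ ∈ (tightAction S).dom (s p.1)) (h2 : φ ∈ (tightAction S).dom (s p.2)),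
        Germ.mk (s p.1) φ h1 = Germ.mk (s p.2) φ h2 → s p.1 * f.1 = s p.2 * f.1 := by
      by_cases hg : ∃ (h1 : φ ∈ (tightAction S).dom (s p.1)) (h2 : φ ∈ (tightAction S).dom (s p.2)),
          Germ.mk (s p.1) φ h1 = Germ.mk (s p.2) φ h2
      · obtain ⟨h1, h2, h3⟩ := hg
        obtain ⟨-, f, hf, hφ, hs⟩ := Germ.mk_eq_mk.1 h3
        refine ⟨⟨f, hf⟩, ?_, fun _ _ _ => hs⟩
        rwa [dom_tightAction, source_idem ⟨f, hf⟩] at hφ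
      -- There is no equality to witness for this pair, so any idempotent that $\varphi$ does not
      -- kill will do.
      · exact ⟨e, he, fun h1 h2 h3 => absurd ⟨h1, h2, h3⟩ hg⟩
    obtain ⟨f, hf, hpf⟩ := hp
    refine ⟨f ⊓ e, mem_tightBasic_inf.2 ⟨hf, he⟩, fun q hq h1 h2 h3 => ?_⟩
    rcases Finset.mem_insert.1 hq with rfl | hq
    · rw [Idem.coe_inf, ← mul_assoc, ← mul_assoc, hpf h1 h2 h3]
    · rw [Idem.coe_inf, idem_comm f.2 e.2, ← mul_assoc, ← mul_assoc, h q hq h1 h2 h3]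

open Classical in
/-- If a sum of functions `δ_s h` vanishes then it vanishes locally for algebraic reasons. -/
theorem exists_idem_sum_eq_zero {M : Type v} [AddCommGroup M] [Module ℂ M] (m : S → M) {ι : Type w}
    (T : Finset ι) (s : ι → S) (h : ι → C₀(tightSpectrum (Idem S), ℂ))
    (h0 : ∑ i ∈ T, tightSection (s i) (h i) = 0) (φ : tightSpectrum (Idem S)) :
    ∃ e : Idem S, φ ∈ tightBasic e ∧
      ∑ i ∈ T with φ ∈ tightBasic (source (s i)), h i φ • m (s i * e.1) = 0 := by
  obtain ⟨e, he, hT⟩ := exists_idem_of_germ_eq (T ×ˢ T) s φ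
  refine ⟨e, he, ?_⟩
  set T' := T.filter fun i => φ ∈ tightBasic (source (s i)) with hT'
  -- The terms are grouped by the value of $s_ie$. Within one group the vector $m(s_ie)$ is
  -- constant, so only the sum of the coefficients matters.
  rw [← Finset.sum_fiberwise_of_maps_to (t := T'.image fun i => s i * e.1)
    (g := fun i => s i * e.1) (fun i hi => Finset.mem_image_of_mem _ hi)]
  refine Finset.sum_eq_zero fun r hr => ?_
  obtain ⟨j, hj, rfl⟩ := Finset.mem_image.1 hr
  obtain ⟨hjT, hjφ⟩ := Finset.mem_filter.1 hj
  have hjφ' : φ ∈ (tightAction S).dom (s j) := hjφ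
  have h1 : ∑ i ∈ T' with s i * e.1 = s j * e.1, h i φ • m (s i * e.1) =
      (∑ i ∈ T' with s i * e.1 = s j * e.1, h i φ) • m (s j * e.1) := by
    rw [Finset.sum_smul]
    exact Finset.sum_congr rfl fun i hi => by rw [(Finset.mem_filter.1 hi).2]
  rw [h1]
  have h2 : ∀ g : (tightAction S).Germ,
      ∑ i ∈ T, (tightAction S).deltaLeft (s i) (h i) g = 0 := by
    intro g
    have h3 : ∀ T : Finset ι, (∑ i ∈ T, tightSection (s i) (h i)).fn g =
        ∑ i ∈ T, (tightAction S).deltaLeft (s i) (h i) g := by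
      intro T
      induction T using Finset.induction_on with
      | empty => rfl
      | insert a T ha ih =>
        rw [Finset.sum_insert ha, Finset.sum_insert ha, Cc.fn_add, Pi.add_apply, ih]; rfl
    rw [← h3, h0]; rfl
  have h3 := h2 (Germ.mk (s j) φ hjφ')
  -- By the choice of $e$, the germs $[s_i,\varphi]$ and $[s_j,\varphi]$ agree exactly when
  -- $s_ie=s_je$. The sum over a group is therefore the value of the vanishing function at the germ
  -- $[s_j,\varphi]$.
  have h4 : ∑ i ∈ T' with s i * e.1 = s j * e.1, h i φ = 0 := by
    rw [← h3, hT', Finset.filter_filter, Finset.sum_filter]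
    refine Finset.sum_congr rfl fun i hi => ?_
    unfold deltaLeft
    rw [Germ.d_mk]
    refine if_congr ⟨?_, ?_⟩ rfl rfl
    · rintro ⟨hi', hie⟩
      have hi'' : φ ∈ (tightAction S).dom (s i) := hi'
      refine ⟨φ, hi'', hi'', Germ.mk_eq_mk.2 ⟨rfl, e.1, e.2, ?_, hie.symm⟩⟩
      rw [dom_tightAction, source_idem]; exact he
    · rintro ⟨x, hx, -, hg⟩
      obtain rfl := (Germ.mk_eq_mk.1 hg).1
      exact ⟨hx, hT (i, j) (Finset.mk_mem_product hi hjT) hx hjφ' hg.symm⟩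
  rw [h4, zero_smul]

variable {H : Type v} [NormedAddCommGroup H] [InnerProductSpace ℂ H] [CompleteSpace H]
  (σ : HilbertRep S H) (Φ : C₀(tightSpectrum (Idem S), ℂ) →⋆ₙₐ[ℂ] (H →L[ℂ] H))

/-- Both sides are linear and continuous in $f$, so it is enough to take $f=1_e$. There the claim is
$et=t(t^*et)$, which holds because $e$ commutes with $tt^*$. -/
theorem covariance (hΦ : ∀ e, Φ (tightInd e) = σ.toFun e.1) (t : S)
    (f : C₀(tightSpectrum (Idem S), ℂ)) :
    Φ f * σ.toFun t = σ.toFun t * Φ (tightPull t f) := by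
  have hc : Continuous Φ :=
    AddMonoidHomClass.continuous_of_bound Φ 1 fun f => by
      simpa using NonUnitalStarAlgHom.norm_apply_le Φ f
  induction f using tightInd_induction with
  | hp =>
    exact isClosed_eq (hc.mul continuous_const)
      (continuous_const.mul (hc.comp (continuous_tightPull t)))
  | ind e =>
    rw [tightPull_tightInd, hΦ, hΦ, ← σ.map_mul, ← σ.map_mul]
    congr 1
    change e.1 * t = t * (star t * e.1 * t)
    calc e.1 * t = e.1 * (t * star t) * t := by
          rw [mul_assoc, mul_star_mul_self]
      _ = t * (star t * e.1 * t) := by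
          rw [idem_comm e.2 (idem_mul_star t)]; simp only [mul_assoc]
  | zero => simp
  | add f g hf hg => simp only [map_add, add_mul, mul_add, hf, hg]
  | smul c f hf => simp only [map_smul, smul_mul_assoc, mul_smul_comm, hf]

theorem toFun_mul_source (hΦ : ∀ e, Φ (tightInd e) = σ.toFun e.1) (s : S) :
    σ.toFun s * Φ (tightInd (source s)) = σ.toFun s := by
  rw [hΦ, ← σ.map_mul]
  congr 1
  change s * (star s * s) = s
  rw [← mul_assoc, mul_star_mul_self]

/-- As $\sigma_s=\sigma_s\Phi(1_{s^*s})$, only the restriction of the function to the domain of $s$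
is felt. -/
theorem toFun_mul_congr (hΦ : ∀ e, Φ (tightInd e) = σ.toFun e.1) (s : S)
    {f g : C₀(tightSpectrum (Idem S), ℂ)} (h : ∀ x ∈ tightBasic (source s), f x = g x) :
    σ.toFun s * Φ f = σ.toFun s * Φ g := by
  rw [← toFun_mul_source σ Φ hΦ s, mul_assoc, mul_assoc, ← map_mul, ← map_mul]
  congr 2
  ext x
  rw [ZeroAtInftyContinuousMap.mul_apply, ZeroAtInftyContinuousMap.mul_apply, tightInd_apply]
  split_ifs with hx
  · rw [h x hx]
  · simp

/-- This is the well-definedness of $\delta_s h\mapsto\sigma_s\Phi(h)$. Pointwise, the relation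
holds already in $S$ after multiplying by an idempotent (`exists_idem_sum_eq_zero`). Replacing each
$h_i$ by a combination of bump functions with constant coefficients $h_i(\varphi_k)$ reduces the
claim to these pointwise relations, up to an error of size $\varepsilon$ in each $h_i$. -/
theorem sum_eq_zero_of_sum_tightSection_eq_zero (hΦ : ∀ e, Φ (tightInd e) = σ.toFun e.1)
    {ι : Type w} (T : Finset ι) (s : ι → S) (h : ι → C₀(tightSpectrum (Idem S), ℂ))
    (h0 : ∑ i ∈ T, tightSection (s i) (h i) = 0) : ∑ i ∈ T, σ.toFun (s i) * Φ (h i) = 0 := by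
  classical
  have main : ∀ ε : ℝ, 0 < ε →
      ‖∑ i ∈ T, σ.toFun (s i) * Φ (h i)‖ ≤ (∑ i ∈ T, ‖σ.toFun (s i)‖) * ε := by
    intro ε hε
    choose e heφ he0 using exists_idem_sum_eq_zero σ.toFun T s h h0
    -- On $U_\varphi$ the idempotent $e_\varphi$ is active and every $h_i$ is within $\varepsilon$
    -- of $h_i(\varphi)$. Moreover $U_\varphi$ avoids the domain of each $s_i$ that is undefined at
    -- $\varphi$; this last condition is open since domains are closed as well.
    let U : tightSpectrum (Idem S) → Set (tightSpectrum (Idem S)) := fun φ =>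
      tightBasic (e φ) ∩ ⋂ i ∈ T, ({x | ‖h i x - h i φ‖ < ε} ∩
        {x | x ∈ tightBasic (source (s i)) → φ ∈ tightBasic (source (s i))})
    have hUo : ∀ φ, IsOpen (U φ) := by
      intro φ
      refine (isClopen_tightBasic _).2.inter (isOpen_biInter_finset fun i _ => IsOpen.inter ?_ ?_)
      · exact isOpen_lt ((h i).continuous.sub continuous_const).norm continuous_const
      · by_cases hφ : φ ∈ tightBasic (source (s i))
        · simp [hφ]
        · simp only [hφ, imp_false]
          exact (isClopen_tightBasic (source (s i))).compl.2
    have hUφ : ∀ φ, φ ∈ U φ := by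
      intro φ
      refine ⟨heφ φ, Set.mem_iInter₂.2 fun i _ => ⟨?_, id⟩⟩
      simpa using hε
    have hK : IsCompact (⋃ i ∈ T, tightBasic (source (s i))) :=
      T.isCompact_biUnion fun i _ => isCompact_tightBasic _
    obtain ⟨F, hF⟩ := hK.elim_finite_subcover U hUo fun φ _ => Set.mem_iUnion.2 ⟨φ, hUφ φ⟩
    let q := F.equivFin.symm
    obtain ⟨p, hps, hp1, hp01, hpc⟩ := exists_continuous_sum_one_of_isOpen_isCompact
      (s := fun k => U (q k).1) (fun k => hUo _) hK (by
        intro x hx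
        obtain ⟨φ, hφ, hxφ⟩ := Set.mem_iUnion₂.1 (hF hx)
        refine Set.mem_iUnion.2 ⟨q.symm ⟨φ, hφ⟩, ?_⟩
        simpa using hxφ)
    let P : Fin F.card → C₀(tightSpectrum (Idem S), ℂ) := fun k =>
      { toFun := fun x => (p k x : ℂ)
        continuous_toFun := Complex.continuous_ofReal.comp (p k).continuous
        zero_at_infty' := by
          refine Filter.Tendsto.congr' ?_ tendsto_const_nhds
          filter_upwards [(hpc k).isCompact.compl_mem_cocompact] with x hx
          rw [image_eq_zero_of_notMem_tsupport hx, Complex.ofReal_zero] }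
    have hP : ∀ k x, P k x = (p k x : ℂ) := fun k x => rfl
    have hPU : ∀ k x, x ∉ U (q k).1 → P k x = 0 := fun k x hx => by
      rw [hP, image_eq_zero_of_notMem_tsupport fun h => hx (hps k h), Complex.ofReal_zero]
    -- With constant coefficients the contribution of each bump function vanishes exactly. Terms
    -- with $s_i$ undefined at the centre drop out because the bump is zero on the domain of $s_i$;
    -- the others are handled by the relation at the centre.
    have hloc : ∀ k, ∑ i ∈ T, h i (q k).1 • (σ.toFun (s i) * Φ (P k)) = 0 := by
      intro k
      have h1 : ∑ i ∈ T, h i (q k).1 • (σ.toFun (s i) * Φ (P k)) =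
          ∑ i ∈ T with (q k).1 ∈ tightBasic (source (s i)),
            h i (q k).1 • (σ.toFun (s i) * Φ (P k)) := by
        refine (Finset.sum_filter_of_ne fun i hi hne => ?_).symm
        by_contra hφ
        apply hne
        rw [toFun_mul_congr σ Φ hΦ (s i) (g := 0), map_zero, mul_zero, smul_zero]
        intro x hx
        refine hPU k x fun hxU => hφ ?_
        exact ((Set.mem_iInter₂.1 hxU.2) i hi).2 hx
      -- The bump function lives inside $D_{e_k}$, so the idempotent $e_k$ can be inserted next to
      -- $\sigma_{s_i}$.
      have h2 : Φ (P k) = σ.toFun (e (q k).1).1 * Φ (P k) := by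
        rw [← hΦ, ← map_mul]
        congr 1
        ext x
        rw [ZeroAtInftyContinuousMap.mul_apply, tightInd_apply]
        split_ifs with hx
        · rw [one_mul]
        · rw [hPU k x fun hxU => hx hxU.1, mul_zero]
      rw [h1]
      calc ∑ i ∈ T with (q k).1 ∈ tightBasic (source (s i)),
            h i (q k).1 • (σ.toFun (s i) * Φ (P k))
          = (∑ i ∈ T with (q k).1 ∈ tightBasic (source (s i)),
            h i (q k).1 • σ.toFun (s i * (e (q k).1).1)) * Φ (P k) := by
            rw [Finset.sum_mul]
            refine Finset.sum_congr rfl fun i _ => ?_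
            rw [smul_mul_assoc, σ.map_mul, mul_assoc, ← h2]
        _ = 0 := by rw [he0, zero_mul]
    -- The error of the approximation is cut down to the domain of $s_i$, since the bump functions
    -- sum to $1$ only on the union of these domains.
    let g : ι → C₀(tightSpectrum (Idem S), ℂ) := fun i =>
      tightInd (source (s i)) * (h i - ∑ k, h i (q k).1 • P k)
    have sum_apply : ∀ (i : ι) (J : Finset (Fin F.card)) (x : tightSpectrum (Idem S)),
        (∑ k ∈ J, h i (q k).1 • P k) x = ∑ k ∈ J, h i (q k).1 * P k x := by
      intro i J x
      induction J using Finset.induction_on with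
      | empty => rfl
      | insert a J ha ih =>
        rw [Finset.sum_insert ha, Finset.sum_insert ha, ZeroAtInftyContinuousMap.add_apply, ih,
          ZeroAtInftyContinuousMap.smul_apply, smul_eq_mul]
    have hg : ∀ i ∈ T, ‖g i‖ ≤ ε := by
      intro i hi
      refine ZeroAtInftyContinuousMap.norm_le_of_forall hε.le fun x => ?_
      simp only [g]
      rw [ZeroAtInftyContinuousMap.mul_apply, tightInd_apply]
      split_ifs with hx
      · have hsum : ∑ k, p k x = 1 := by
          have := hp1 (Set.mem_iUnion₂.2 ⟨i, hi, hx⟩)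
          rwa [Finset.sum_apply] at this
        have hsum' : ∑ k, P k x = 1 := by
          simp only [hP, ← Complex.ofReal_sum, hsum, Complex.ofReal_one]
        rw [one_mul, ZeroAtInftyContinuousMap.sub_apply, sum_apply]
        calc ‖h i x - ∑ k, h i (q k).1 * P k x‖ = ‖∑ k, (h i x - h i (q k).1) * P k x‖ := by
              congr 1
              simp only [sub_mul, Finset.sum_sub_distrib]
              rw [← Finset.mul_sum, hsum', mul_one]
          _ ≤ ∑ k, ε * p k x := by
              refine norm_sum_le_of_le _ fun k _ => ?_
              by_cases hxU : x ∈ U (q k).1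
              · rw [norm_mul, hP, Complex.norm_real, Real.norm_of_nonneg (hp01 k x).1]
                exact mul_le_mul_of_nonneg_right ((Set.mem_iInter₂.1 hxU.2) i hi).1.le
                  (hp01 k x).1
              · rw [hPU k x hxU, mul_zero, norm_zero]
                exact mul_nonneg hε.le (hp01 k x).1
          _ = ε := by rw [← Finset.mul_sum, hsum, mul_one]
      · rw [zero_mul, norm_zero]; exact hε.le
    have hsub : ∀ i, σ.toFun (s i) * Φ (g i) =
        σ.toFun (s i) * Φ (h i) - ∑ k, h i (q k).1 • (σ.toFun (s i) * Φ (P k)) := by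
      intro i
      simp only [g]
      rw [map_mul, ← mul_assoc, toFun_mul_source σ Φ hΦ, map_sub, mul_sub, map_sum, Finset.mul_sum]
      congr 1
      exact Finset.sum_congr rfl fun k _ => by rw [map_smul, mul_smul_comm]
    -- Interchanging the sums over $i$ and $k$ makes the approximating part vanish by `hloc`; only
    -- the errors remain.
    have htot : ∑ i ∈ T, σ.toFun (s i) * Φ (h i) = ∑ i ∈ T, σ.toFun (s i) * Φ (g i) := by
      simp only [hsub, Finset.sum_sub_distrib]
      rw [Finset.sum_comm, Finset.sum_eq_zero (s := Finset.univ) fun k _ => hloc k, sub_zero]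
    rw [htot, Finset.sum_mul]
    refine norm_sum_le_of_le _ fun i hi => (norm_mul_le _ _).trans ?_
    exact mul_le_mul_of_nonneg_left
      ((NonUnitalStarAlgHom.norm_apply_le Φ (g i)).trans (hg i hi)) (norm_nonneg _)
  rw [← norm_le_zero_iff]
  refine le_of_forall_pos_le_add fun δ hδ => ?_
  have hC : 0 ≤ ∑ i ∈ T, ‖σ.toFun (s i)‖ := Finset.sum_nonneg fun i _ => norm_nonneg _
  -- The summand $1$ keeps the denominator positive when all $\sigma_{s_i}$ vanish.
  refine (main (δ / (∑ i ∈ T, ‖σ.toFun (s i)‖ + 1)) (by positivity)).trans ?_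
  rw [zero_add, mul_div_assoc', div_le_iff₀ (by positivity)]
  nlinarith

/-- A tight representation of `S` integrates to a *-representation of `C_c(G_tight)`. -/
theorem HilbertRep.exists_integrated {σ : HilbertRep S H} (hσ : σ.IsTight) :
    ∃ π : (tightAction S).Cc →⋆ₙₐ[ℂ] (H →L[ℂ] H), ∀ s, π (tightGen s) = σ.toFun s := by
  obtain ⟨Φ, hΦ⟩ := σ.exists_functionalCalculus hσ
  -- Formal combinations of pairs $(s,h)$ map onto $C_c(\mathcal G_{\rm tight})$ by `L` and to
  -- operators by `M`. The representation is `M` factored through `L`, which requires the kernel of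
  -- `L` to lie in that of `M`.
  let L : (S × C₀(tightSpectrum (Idem S), ℂ) →₀ ℂ) →ₗ[ℂ] (tightAction S).Cc :=
    Finsupp.linearCombination ℂ fun p => tightSection p.1 p.2
  let M : (S × C₀(tightSpectrum (Idem S), ℂ) →₀ ℂ) →ₗ[ℂ] (H →L[ℂ] H) :=
    Finsupp.linearCombination ℂ fun p => σ.toFun p.1 * Φ p.2
  have hL1 : ∀ s h, L (Finsupp.single (s, h) 1) = tightSection s h := fun s h => by simp [L]
  have hM1 : ∀ s h, M (Finsupp.single (s, h) 1) = σ.toFun s * Φ h := fun s h => by simp [M]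
  have hLs : Function.Surjective L := by
    intro f
    induction f using tightSection_induction with
    | basic s h => exact ⟨_, hL1 s h⟩
    | add f g hf hg =>
      obtain ⟨a, rfl⟩ := hf
      obtain ⟨b, rfl⟩ := hg
      exact ⟨a + b, map_add L a b⟩
    | smul c f hf =>
      obtain ⟨a, rfl⟩ := hf
      exact ⟨c • a, map_smul L c a⟩
  have hker : ∀ x, L x = 0 → M x = 0 := by
    intro x hx
    -- The scalar coefficients are absorbed into the functions, to reach the form treated by
    -- `sum_eq_zero_of_sum_tightSection_eq_zero`.
    have h1 : ∑ i ∈ x.support, tightSection i.1 (x i • i.2) = 0 := by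
      rw [← hx, Finsupp.linearCombination_apply, Finsupp.sum]
      exact Finset.sum_congr rfl fun i _ => by rw [map_smul]
    have h2 : M x = ∑ i ∈ x.support, σ.toFun i.1 * Φ (x i • i.2) := by
      rw [Finsupp.linearCombination_apply, Finsupp.sum]
      exact Finset.sum_congr rfl fun i _ => by rw [map_smul, mul_smul_comm]
    rw [h2]
    exact sum_eq_zero_of_sum_tightSection_eq_zero σ Φ hΦ x.support (fun i => Prod.fst i)
      (fun i => x i • i.2) h1
  -- Any linear right inverse of `L` serves: by `hker`, the composite with `M` does not depend on
  -- the choice.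
  obtain ⟨r, hr⟩ := L.exists_rightInverse_of_surjective (LinearMap.range_eq_top.2 hLs)
  let π : (tightAction S).Cc →ₗ[ℂ] (H →L[ℂ] H) := M.comp r
  have hπ : ∀ s h, π (tightSection s h) = σ.toFun s * Φ h := by
    intro s h
    rw [← hM1, ← hL1]
    change M (r _) = _
    rw [← sub_eq_zero, ← map_sub]
    apply hker
    have h1 : ∀ y, L (r y) = y := fun y => LinearMap.congr_fun hr y
    rw [map_sub, h1, sub_self]
  have hmul : ∀ f g, π (f * g) = π f * π g := by
    intro f g
    induction f using tightSection_induction with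
    | basic s f =>
      induction g using tightSection_induction with
      | basic t g =>
        rw [tightSection_mul, hπ, hπ, hπ, σ.map_mul, _root_.map_mul]
        calc σ.toFun s * σ.toFun t * (Φ (tightPull t f) * Φ g)
            = σ.toFun s * (σ.toFun t * Φ (tightPull t f)) * Φ g := by simp only [mul_assoc]
          _ = _ := by rw [← covariance σ Φ hΦ]; simp only [mul_assoc]
      | add g g' h1 h2 => simp only [mul_add, map_add, h1, h2]
      | smul c g h1 => simp only [mul_smul_comm, map_smul, h1]
    | add f f' h1 h2 => simp only [add_mul, map_add, h1, h2]
    | smul c f h1 => simp only [smul_mul_assoc, map_smul, h1]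
  have hstar : ∀ f, π (star f) = star (π f) := by
    intro f
    induction f using tightSection_induction with
    | basic s f =>
      -- Covariance for $s^*$ gives $\sigma_{s^*}\Phi(f^*\circ\theta_{s^*})=\Phi(f^*)\sigma_{s^*}$,
      -- which is $(\sigma_s\Phi(f))^*$.
      rw [star_tightSection, hπ, hπ, star_mul, ← covariance σ Φ hΦ, σ.map_star,
        StarHomClass.map_star]
    | add f g h1 h2 => simp only [star_add, map_add, h1, h2]
    | smul c f h1 => simp only [star_smul, map_smul, h1]
  refine ⟨{ π with
    map_zero' := map_zero π
    map_mul' := hmul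
    map_star' := hstar }, fun s => ?_⟩
  change π _ = _
  rw [tightGen_eq_tightSection, hπ, toFun_mul_source σ Φ hΦ]

end TightIntegration

/-! ### Hilbert spaces in a prescribed universe -/

section SmallModels

/-- The Hilbert space structure is transported along the bijection with a small model. This brings
cyclic subspaces into the universe over which the full norm takes its supremum. -/
theorem exists_linearIsometryEquiv_small (K : Type v) [NormedAddCommGroup K]
    [InnerProductSpace ℂ K] [CompleteSpace K] [Small.{w} K] :
    ∃ (H : Type w) (_ : NormedAddCommGroup H) (_ : InnerProductSpace ℂ H) (_ : CompleteSpace H),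
      Nonempty (K ≃ₗᵢ[ℂ] H) := by
  let e := (equivShrink.{w} K).symm.linearEquiv ℂ
  have hn : ∀ x : Shrink.{w} K, ‖x‖ = ‖e x‖ := fun _ => rfl
  let ips : InnerProductSpace ℂ (Shrink.{w} K) :=
    { (inferInstance : NormedSpace ℂ (Shrink.{w} K)) with
      inner := fun x y => inner ℂ (e x) (e y)
      norm_sq_eq_re_inner := fun x => by rw [hn]; exact norm_sq_eq_re_inner (e x)
      conj_inner_symm := fun x y => inner_conj_symm (e x) (e y)
      add_left := fun x y z => by rw [map_add, inner_add_left]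
      smul_left := fun x y r => by rw [map_smul, inner_smul_left] }
  let E : Shrink.{w} K ≃ₗᵢ[ℂ] K := { e with norm_map' := fun x => rfl }
  exact ⟨Shrink.{w} K, inferInstance, ips,
    E.toIsometryEquiv.completeSpace, ⟨E.symm⟩⟩

/-- By first countability every point of the closure is the limit of a sequence from the range.
Limits are unique, so the sequences $\mathbb N\to A$, which live in the universe of $A$, map onto a
set containing the closure. -/
theorem small_closure_range {A : Type u} {X : Type v} [TopologicalSpace X] [FirstCountableTopology X]
    [T2Space X] (f : A → X) : Small.{u} (closure (Set.range f)) := by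
  classical
  rcases isEmpty_or_nonempty X with hX | hX
  · have : IsEmpty (closure (Set.range f)) := ⟨fun x => hX.elim x.1⟩
    infer_instance
  have h : closure (Set.range f) ⊆
      Set.range (fun a : ℕ → A => Filter.limUnder Filter.atTop fun n => f (a n)) := by
    intro x hx
    obtain ⟨y, hy, hyx⟩ := mem_closure_iff_seq_limit.1 hx
    choose a ha using hy
    have hlim : Filter.Tendsto (fun n => f (a n)) Filter.atTop (𝓝 x) := by simpa only [ha] using hyx
    exact ⟨a, hlim.limUnder_eq⟩
  exact small_subset h

end SmallModels

/-! ### The full norm dominates representations in every universe -/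

namespace PartialAction

section UniversalNorm

variable {S : Type u} {X : Type v} [InverseSemigroup S] [TopologicalSpace X]
  [T2Space X] [LocallyCompactSpace X] {θ : PartialAction S X}

variable {H : Type w} [NormedAddCommGroup H] [InnerProductSpace ℂ H] [CompleteSpace H]

/-- The restriction of a *-representation to a closed invariant subspace. -/
noncomputable def restrictRep (π : θ.Cc →⋆ₙₐ[ℂ] (H →L[ℂ] H)) (K : Submodule ℂ H) [CompleteSpace K]
    (hK : ∀ f, ∀ x ∈ K, π f x ∈ K) : θ.Cc →⋆ₙₐ[ℂ] (K →L[ℂ] K) where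
  toFun f := ((π f).comp K.subtypeL).codRestrict K fun x => hK f x.1 x.2
  map_smul' c f := by
    ext x
    change π (c • f) x.1 = c • π f x.1
    rw [map_smul]; rfl
  map_zero' := by ext x; simp
  map_add' f g := by
    ext x
    change π (f + g) x.1 = π f x.1 + π g x.1
    rw [map_add]; rfl
  map_mul' f g := by
    ext x
    change π (f * g) x.1 = π f (π g x.1)
    rw [map_mul]; rfl
  map_star' f := by
    rw [ContinuousLinearMap.star_eq_adjoint, ContinuousLinearMap.eq_adjoint_iff]
    intro x y
    change inner ℂ (π (star f) x.1) y.1 = inner ℂ x.1 (π f y.1)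
    rw [map_star, ContinuousLinearMap.star_eq_adjoint, ContinuousLinearMap.adjoint_inner_left]

/-- Every *-representation, on a Hilbert space in any universe, is bounded by the full norm. -/
theorem norm_rep_le (π : θ.Cc →⋆ₙₐ[ℂ] (H →L[ℂ] H)) (f : θ.Cc) : ‖π f‖ ≤ ‖f‖ := by
  refine ContinuousLinearMap.opNorm_le_bound _ (norm_nonneg f) fun ξ => ?_
  -- The cyclic subspace of $\xi$ suffices to compute $\|\pi(f)\xi\|$. The scalar component puts
  -- $\xi$ itself into it, which could fail for a degenerate $\pi$.
  let ℓ : ℂ × θ.Cc →ₗ[ℂ] H :=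
    { toFun := fun a => a.1 • ξ + π a.2 ξ
      map_add' := fun a b => by
        simp only [Prod.fst_add, Prod.snd_add, map_add, add_smul, add_apply]
        abel
      map_smul' := fun c a => by
        simp only [Prod.smul_fst, Prod.smul_snd, map_smul, smul_add, smul_eq_mul, mul_smul,
          smul_apply, RingHom.id_apply] }
  let K := ℓ.range.topologicalClosure
  have hinv : ∀ g, ∀ x ∈ K, π g x ∈ K := by
    intro g x hx
    refine map_mem_closure (π g).continuous hx ?_
    rintro _ ⟨a, rfl⟩
    -- This is $\pi(g)(c\xi+\pi(a)\xi)=\pi(cg+ga)\xi$.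
    refine ⟨(0, a.1 • g + g * a.2), ?_⟩
    simp [ℓ]
  have : CompleteSpace K := ℓ.range.isClosed_topologicalClosure.completeSpace_coe
  have : Small.{max u v} K := by
    have := small_closure_range ℓ
    exact this
  obtain ⟨H', _, _, _, ⟨E⟩⟩ := exists_linearIsometryEquiv_small.{w, max u v} K
  let π' : θ.Cc →⋆ₙₐ[ℂ] (H' →L[ℂ] H') :=
    (E.conjStarAlgEquiv : (K →L[ℂ] K) →⋆ₙₐ[ℂ] (H' →L[ℂ] H')).comp (restrictRep π K hinv)
  have hξ : ξ ∈ K := subset_closure ⟨(1, 0), by simp [ℓ]⟩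
  have h1 : ‖π' f (E ⟨ξ, hξ⟩)‖ = ‖π f ξ‖ := by
    change ‖E (restrictRep π K hinv f (E.symm (E ⟨ξ, hξ⟩)))‖ = _
    rw [E.symm_apply_apply, E.norm_map]
    rfl
  rw [← h1]
  refine ((π' f).le_opNorm _).trans ?_
  rw [E.norm_map]
  exact mul_le_mul_of_nonneg_right (le_fullNorm π' f) (norm_nonneg _)

end UniversalNorm

end PartialAction

/-! ### Extension of homomorphisms to the completion -/

section CompletionExtension

variable {A : Type u} [PreCStarAlgebra A] {B : Type v} [NonUnitalCStarAlgebra B]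

/-- The extension of a contractive *-homomorphism to the completion. -/
noncomputable def CStarCompletion.lift (π : A →⋆ₙₐ[ℂ] B) (hπ : ∀ a, ‖π a‖ ≤ ‖a‖) :
    CStarCompletion A →⋆ₙₐ[ℂ] B :=
  have huc : UniformContinuous π :=
    (AddMonoidHomClass.lipschitz_of_bound π 1 fun a => by simpa using hπ a).uniformContinuous
  let F : CStarCompletion A → B := UniformSpace.Completion.extension π
  have hF : Continuous F := UniformSpace.Completion.continuous_extension
  have hFc : ∀ a : A, F (ofPre a) = π a := UniformSpace.Completion.extension_coe huc
  { toFun := F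
    map_smul' := fun c a => CStarCompletion.induction (p := fun a => F (c • a) = c • F a)
      (isClosed_eq (hF.comp (continuous_const_smul c)) (hF.const_smul c))
      (fun f => by rw [← ofPre_smul, hFc, hFc, map_smul]) a
    map_zero' := by
      change F 0 = 0
      rw [← map_zero ofPre, hFc, map_zero]
    map_add' := fun a b => CStarCompletion.induction₂ (p := fun a b => F (a + b) = F a + F b)
      (isClosed_eq (hF.comp continuous_add)
        ((hF.comp continuous_fst).add (hF.comp continuous_snd)))
      (fun f g => by rw [← map_add, hFc, hFc, hFc, map_add]) a b
    map_mul' := fun a b => CStarCompletion.induction₂ (p := fun a b => F (a * b) = F a * F b)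
      (isClosed_eq (hF.comp continuous_mul)
        ((hF.comp continuous_fst).mul (hF.comp continuous_snd)))
      (fun f g => by rw [← ofPre_mul, hFc, hFc, hFc, map_mul]) a b
    map_star' := fun a => CStarCompletion.induction (p := fun a => F (star a) = star (F a))
      (isClosed_eq (hF.comp CStarCompletion.continuous_star) hF.star)
      (fun f => by rw [← ofPre_star, hFc, hFc, map_star]) a }

theorem CStarCompletion.lift_toCStarCompletion (π : A →⋆ₙₐ[ℂ] B) (hπ : ∀ a, ‖π a‖ ≤ ‖a‖) (a : A) :
    CStarCompletion.lift π hπ (toCStarCompletion a) = π a := by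
  change UniformSpace.Completion.extension π (ofPre a) = π a
  exact UniformSpace.Completion.extension_coe
    (AddMonoidHomClass.lipschitz_of_bound π 1 fun a => by simpa using hπ a).uniformContinuous a

/-- *-homomorphisms between C*-algebras are contractive, hence continuous, and the image of $A$ is
dense. -/
theorem CStarCompletion.hom_ext {ρ ρ' : CStarCompletion A →⋆ₙₐ[ℂ] B}
    (h : ∀ a, ρ (toCStarCompletion a) = ρ' (toCStarCompletion a)) : ρ = ρ' := by
  have hc : ∀ ρ : CStarCompletion A →⋆ₙₐ[ℂ] B, Continuous ρ := fun ρ =>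
    AddMonoidHomClass.continuous_of_bound ρ 1 fun f => by
      simpa using NonUnitalStarAlgHom.norm_apply_le ρ f
  ext1 a
  exact CStarCompletion.induction (p := fun a => ρ a = ρ' a) (isClosed_eq (hc ρ) (hc ρ')) h a

end CompletionExtension

/-! ### Tightness and nondegeneracy under the correspondence -/

section Correspondence

open PartialAction

variable {S : Type u} [InverseSemigroupWithZero S]
  {H : Type v} [NormedAddCommGroup H] [InnerProductSpace ℂ H] [CompleteSpace H]

/-- A nonzero $x$ that meets no $y\in Y$ lies in $E^{\emptyset,Y}$ and so meets some $z\in Z$; hence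
$Y\cup Z$ covers $E$. This explains why nondegeneracy of $\rho$ is needed only when $E$ has a finite
cover. -/
theorem Semilattice.hasFiniteCover_of_isCover {E : Type u} [SemilatticeInf E] [OrderBot E]
    {Y Z : Finset E} (h : IsCover (Z : Set E) (between ∅ Y)) : HasFiniteCover E := by
  classical
  refine ⟨Y ∪ Z, Set.subset_univ _, fun x _ hx => ?_⟩
  by_cases hy : ∃ y ∈ Y, Intersects x y
  · obtain ⟨y, hy, z, hz, hzx, hzy⟩ := hy
    exact ⟨y, Finset.mem_coe.2 (Finset.mem_union_left _ hy), z, hz, hzy, hzx⟩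
  · push Not at hy
    obtain ⟨z, hz, hzx⟩ := h.2 x ⟨fun a ha => absurd ha (Finset.notMem_empty a), hy⟩ hx
    exact ⟨z, Finset.mem_coe.2 (Finset.mem_union_right _ (Finset.mem_coe.1 hz)), hzx⟩

theorem finset_inf_inf_eq_self {ι : Type u} {B : Type v} [BooleanAlgebra B] (f : ι → B)
    {X : Finset ι} {x : ι} (hx : x ∈ X) (b : B) : X.inf f ⊓ b ⊓ f x = X.inf f ⊓ b :=
  inf_eq_left.2 (inf_le_left.trans (Finset.inf_le hx))

theorem HilbertRep.ext {σ τ : HilbertRep S H} (h : ∀ s, σ.toFun s = τ.toFun s) : σ = τ := by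
  cases σ; cases τ
  congr 1
  exact funext h

/-- The representation of `S` obtained from a *-representation of `C_c(G_tight)`. -/
noncomputable def HilbertRep.ofRep (π : (tightAction S).Cc →⋆ₙₐ[ℂ] (H →L[ℂ] H)) :
    HilbertRep S H where
  toFun s := π (tightGen s)
  map_mul s t := by rw [← tightGen_mul, _root_.map_mul]
  map_star s := by rw [← star_tightGen, StarHomClass.map_star]

/-- For $k=1_f$ both sides are the operator of $xef$, and density does the rest. Left multiplication
by $\sigma_x$ thus becomes multiplication by $1_x$ below $e$. -/
theorem rep_tightGen_mul_tightSection (π : (tightAction S).Cc →⋆ₙₐ[ℂ] (H →L[ℂ] H)) (x e : Idem S)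
    (k : C₀(tightSpectrum (Idem S), ℂ)) :
    π (tightGen x.1) * π (tightSection e.1 k) = π (tightSection e.1 (tightInd x * k)) := by
  have hc := continuous_rep_tightSection π e.1
  induction k using tightInd_induction with
  | hp =>
    exact isClosed_eq (continuous_const.mul hc) (hc.comp (continuous_const.mul continuous_id))
  | ind f =>
    rw [← tightInd_inf, tightSection_tightInd, tightSection_tightInd, ← map_mul, tightGen_mul,
      Idem.coe_inf, ← mul_assoc, ← mul_assoc, idem_comm x.2 e.2]
  | zero => simp
  | add f g hf hg => simp only [mul_add, map_add, hf, hg]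
  | smul c f hf => simp only [mul_smul_comm, map_smul, hf]

/-- `b` acts below `e` as a function supported in `U`. -/
def SupportedOn (π : (tightAction S).Cc →⋆ₙₐ[ℂ] (H →L[ℂ] H)) (e : Idem S)
    (b : (HilbertRep.ofRep π).IdemBoolean) (U : Set (tightSpectrum (Idem S))) : Prop :=
  ∃ k : C₀(tightSpectrum (Idem S), ℂ), b.1.1 * π (tightGen e.1) = π (tightSection e.1 k) ∧
    ∀ φ, φ ∉ U → k φ = 0

variable {π : (tightAction S).Cc →⋆ₙₐ[ℂ] (H →L[ℂ] H)} {e : Idem S}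

theorem SupportedOn.onIdem_inf {b : (HilbertRep.ofRep π).IdemBoolean}
    {U : Set (tightSpectrum (Idem S))} (h : SupportedOn π e b U) (x : Idem S) :
    SupportedOn π e ((HilbertRep.ofRep π).onIdem x ⊓ b) (tightBasic x ∩ U) := by
  obtain ⟨k, hk, hU⟩ := h
  refine ⟨tightInd x * k, ?_, fun φ hφ => ?_⟩
  · change (π (tightGen x.1) * b.1.1) * π (tightGen e.1) = _
    rw [mul_assoc, hk, rep_tightGen_mul_tightSection]
  · rw [ZeroAtInftyContinuousMap.mul_apply, tightInd_apply]
    split_ifs with hx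
    · rw [hU φ fun h => hφ ⟨hx, h⟩, mul_zero]
    · rw [zero_mul]

/-- The complement $1-\sigma_x$ belongs to the unital algebra and need not come from a function in
$C_0$. Below $e$ it does: it replaces $k$ by $k-1_xk$. -/
theorem SupportedOn.compl_onIdem_inf {b : (HilbertRep.ofRep π).IdemBoolean}
    {U : Set (tightSpectrum (Idem S))} (h : SupportedOn π e b U) (x : Idem S) :
    SupportedOn π e (((HilbertRep.ofRep π).onIdem x)ᶜ ⊓ b) ((tightBasic x)ᶜ ∩ U) := by
  obtain ⟨k, hk, hU⟩ := h
  refine ⟨k - tightInd x * k, ?_, fun φ hφ => ?_⟩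
  · change ((1 - π (tightGen x.1)) * b.1.1) * π (tightGen e.1) = _
    rw [mul_assoc, hk, sub_mul, one_mul, rep_tightGen_mul_tightSection, map_sub, map_sub]
  · rw [ZeroAtInftyContinuousMap.sub_apply, ZeroAtInftyContinuousMap.mul_apply, tightInd_apply]
    split_ifs with hx
    · rw [one_mul, sub_self]
    · rw [hU φ fun h => hφ ⟨hx, h⟩, mul_zero, sub_zero]

theorem SupportedOn.finset_inf {b : (HilbertRep.ofRep π).IdemBoolean}
    {U : Set (tightSpectrum (Idem S))} (h : SupportedOn π e b U) (X : Finset (Idem S)) :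
    SupportedOn π e (X.inf (HilbertRep.ofRep π).onIdem ⊓ b)
      ({φ | ∀ x ∈ X, φ ∈ tightBasic x} ∩ U) := by
  classical
  induction X using Finset.induction_on with
  | empty => simpa using h
  | insert x X _ ih =>
    rw [Finset.inf_insert, inf_assoc]
    convert ih.onIdem_inf x using 1
    ext φ
    simp [and_assoc]

theorem SupportedOn.finset_inf_compl {b : (HilbertRep.ofRep π).IdemBoolean}
    {U : Set (tightSpectrum (Idem S))} (h : SupportedOn π e b U) (X : Finset (Idem S)) :
    SupportedOn π e (X.inf (fun x => ((HilbertRep.ofRep π).onIdem x)ᶜ) ⊓ b)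
      ({φ | ∀ x ∈ X, φ ∉ tightBasic x} ∩ U) := by
  classical
  induction X using Finset.induction_on with
  | empty => simpa using h
  | insert x X _ ih =>
    rw [Finset.inf_insert, inf_assoc]
    convert ih.compl_onIdem_inf x using 1
    ext φ
    simp [and_assoc]

/-- Below $e$ the identity operator is represented by $1_e$. -/
theorem supportedOn_top : SupportedOn π e (⊤ : (HilbertRep.ofRep π).IdemBoolean) Set.univ := by
  refine ⟨tightInd e, ?_, fun φ hφ => absurd (Set.mem_univ φ) hφ⟩
  change 1 * π (tightGen e.1) = _
  rw [one_mul, tightSection_tightInd, e.2]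

/-- The representing function is supported at tight $\varphi$ with value $1$ on $X$ and $0$ on $Y$
and $Z$. Tightness of $\varphi$ for the cover $Z$ says that there are none. -/
theorem mul_rep_tightGen_eq_zero (e : Idem S) {X Y Z : Finset (Idem S)}
    (hZ : IsCover (Z : Set (Idem S)) (between X Y)) :
    (X.inf (HilbertRep.ofRep π).onIdem ⊓ (Y.inf (fun y => ((HilbertRep.ofRep π).onIdem y)ᶜ) ⊓
      (Z.inf (fun y => ((HilbertRep.ofRep π).onIdem y)ᶜ) ⊓ ⊤))).1.1 * π (tightGen e.1) = 0 := by
  obtain ⟨k, hk, hU⟩ := (((supportedOn_top (π := π) (e := e)).finset_inf_compl Z).finset_inf_compl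
    Y).finset_inf X
  have hk0 : k = 0 := by
    ext φ
    refine hU φ ?_
    rintro ⟨h1, h2, h3, -⟩
    obtain ⟨z, hz, hz'⟩ := (bool_tight_iff φ.1.1 X Y Z).1 (φ.2.tight X Y Z hZ) h1
      fun y hy => Bool.eq_false_iff.2 (h2 y hy)
    exact h3 z hz hz'
  rw [hk, hk0, map_zero, map_zero]

/-- Every section over $s$ has the generator of $ss^*$ as a left unit, so annihilating the
idempotent generators is enough. -/
theorem rep_mul_eq_zero {q : H →L[ℂ] H} (hq : ∀ e : Idem S, q * π (tightGen e.1) = 0)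
    (f : (tightAction S).Cc) : q * π f = 0 := by
  induction f using tightSection_induction with
  | basic s h =>
    rw [← tightGen_mul_tightSection, map_mul, ← mul_assoc, hq ⟨s * star s, idem_mul_star s⟩,
      zero_mul]
  | add f g hf hg => rw [map_add, mul_add, hf, hg, add_zero]
  | smul c f hf => rw [map_smul, mul_smul_comm, hf, smul_zero]

theorem continuous_rep {A : Type w} [NonUnitalCStarAlgebra A] (ρ : A →⋆ₙₐ[ℂ] (H →L[ℂ] H)) :
    Continuous ρ :=
  AddMonoidHomClass.continuous_of_bound ρ 1 fun f => by
    simpa using NonUnitalStarAlgHom.norm_apply_le ρ f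

/-- *-representations of `C*(G_tight)` restrict to tight representations of `S`. -/
theorem isTight_ofRep (ρ : (tightAction S).CStarGpd →⋆ₙₐ[ℂ] (H →L[ℂ] H))
    (hρ : HasFiniteCover (Idem S) → NondegenerateRep ρ) :
    (HilbertRep.ofRep (ρ.comp (tightAction S).toCStar)).IsTight := by
  set π := ρ.comp (tightAction S).toCStar with hπ
  refine ⟨⟨?_, fun x y => ?_⟩, fun X Y Z hZ => ?_⟩
  · refine Subtype.ext (Subtype.ext ?_)
    change π (tightGen (0 : S)) = 0
    have h : tightGen (0 : S) = tightSection 0 0 := by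
      rw [tightGen_eq_tightSection]
      refine tightSection_congr fun x hx => ?_
      have h1 : source (0 : S) = ⊥ := Idem.ext' (mul_zero _)
      rw [h1, mem_tightBasic, x.2.map_bot] at hx
      exact absurd hx (by decide)
    rw [h, map_zero, map_zero]
  · refine Subtype.ext (Subtype.ext ?_)
    change π (tightGen (x.1 * y.1)) = π (tightGen x.1) * π (tightGen y.1)
    rw [← tightGen_mul, map_mul]
  -- The inequality $a\le b$ is recast as $a\wedge\neg b=0$, so that one projection $q$ has to
  -- vanish.
  · refine disjoint_compl_right_iff.1 (disjoint_iff.2 ?_)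
    rw [Finset.compl_sup, inf_assoc]
    have h := fun e => mul_rep_tightGen_eq_zero (π := π) e hZ
    rw [inf_top_eq] at h
    set q := X.inf (HilbertRep.ofRep π).onIdem ⊓ (Y.inf (fun y => ((HilbertRep.ofRep π).onIdem y)ᶜ) ⊓
      Z.inf (fun y => ((HilbertRep.ofRep π).onIdem y)ᶜ)) with hqdef
    refine Subtype.ext (Subtype.ext ?_)
    change q.1.1 = 0
    -- So far $q$ is known to kill only the idempotent operators $\sigma_e$. Either some $\sigma_x$
    -- with $x\in X$ dominates $q$, or $E$ has a finite cover and the range of $\rho$ is total.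
    rcases X.eq_empty_or_nonempty with rfl | ⟨x, hx⟩
    · have hnd := hρ (hasFiniteCover_of_isCover hZ)
      have hq : ∀ a, q.1.1 * ρ a = 0 := by
        intro a
        refine CStarCompletion.induction (p := fun a => q.1.1 * ρ a = 0)
          (isClosed_eq (continuous_const.mul (continuous_rep ρ)) continuous_const) ?_ a
        exact rep_mul_eq_zero h
      ext ξ
      have hξ : ξ ∈ (Submodule.span ℂ
          {η : H | ∃ (a : (tightAction S).CStarGpd) (ξ : H), η = ρ a ξ}).topologicalClosure := by
        rw [hnd]; trivial
      refine closure_minimal (t := {ξ | q.1.1 ξ = 0}) (fun η hη => ?_)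
        (isClosed_eq q.1.1.continuous continuous_const) hξ
      refine Submodule.span_le (p := (q.1.1).ker).2 ?_ hη
      rintro _ ⟨a, ζ, rfl⟩
      exact congrArg (fun T : H →L[ℂ] H => T ζ) (hq a)
    · have h1 : q ⊓ (HilbertRep.ofRep π).onIdem x = q :=
        finset_inf_inf_eq_self _ hx _
      have h2 : q.1.1 * π (tightGen x.1) = q.1.1 := congrArg (fun b => b.1.1) h1
      rw [← h2, h x]

/-- By the left unit of a section over $s$, every $\rho(\delta_s k)\xi$ is of the form
$\sigma_{ss^*}\eta$. So both families of vectors have the same closed span. -/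
theorem nondegenerateRep_iff {ρ : (tightAction S).CStarGpd →⋆ₙₐ[ℂ] (H →L[ℂ] H)}
    {σ : HilbertRep S H} (h : ∀ s, ρ ((tightAction S).toCStar (tightGen s)) = σ.toFun s) :
    NondegenerateRep ρ ↔ σ.Nondegenerate := by
  constructor
  · intro hρ
    refine top_le_iff.1 (hρ.symm.le.trans (Submodule.topologicalClosure_minimal _
      (Submodule.span_le.2 ?_) (Submodule.isClosed_topologicalClosure _)))
    rintro _ ⟨a, ξ, rfl⟩
    refine CStarCompletion.induction
      (p := fun a => ρ a ξ ∈ (Submodule.span ℂ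
        {η : H | ∃ (s : S) (ξ : H), η = σ.toFun s ξ}).topologicalClosure)
      ((Submodule.isClosed_topologicalClosure _).preimage
        ((continuous_rep ρ).clm_apply continuous_const)) (fun f => ?_) a
    refine Submodule.le_topologicalClosure _ ?_
    change ρ ((tightAction S).toCStar f) ξ ∈ _
    induction f using tightSection_induction with
    | basic s k =>
      rw [← tightGen_mul_tightSection, map_mul, map_mul, h]
      exact Submodule.subset_span ⟨_, _, rfl⟩
    | add f g hf hg => rw [map_add, map_add]; exact add_mem hf hg
    | smul c f hf => rw [map_smul, map_smul]; exact Submodule.smul_mem _ c hf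
  · intro hσ
    refine top_le_iff.1 (hσ.symm.le.trans (Submodule.topologicalClosure_mono
      (Submodule.span_mono ?_)))
    rintro _ ⟨s, ξ, rfl⟩
    exact ⟨_, ξ, by rw [h]⟩

/-- Since $E^{\emptyset,\emptyset}=E$, tightness applied to a finite cover gives
$\bigvee_Z\sigma_z=1$. Expanding $a\vee b=a+b-ab$ writes each vector as a finite sum of vectors
$\sigma_z\eta$. -/
theorem HilbertRep.IsTight.nondegenerate {σ : HilbertRep S H} (hσ : σ.IsTight)
    (hE : HasFiniteCover (Idem S)) : σ.Nondegenerate := by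
  classical
  obtain ⟨Z, hZ, hZ'⟩ := hE
  have h1 : Z.sup σ.onIdem = ⊤ := by
    have h := hσ.tight ∅ ∅ Z ⟨fun z _ => ⟨by simp, by simp⟩, fun x _ => hZ' x trivial⟩
    simpa using h
  have h2 : ∀ (Z : Finset (Idem S)) (ξ : H), (Z.sup σ.onIdem).1.1 ξ ∈
      Submodule.span ℂ {η : H | ∃ (s : S) (ξ : H), η = σ.toFun s ξ} := by
    intro Z
    induction Z using Finset.induction_on with
    | empty => intro ξ; exact zero_mem _
    | insert z Z _ ih =>
      intro ξ
      rw [Finset.sup_insert]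
      change σ.toFun z.1 ξ + (Z.sup σ.onIdem).1.1 ξ - σ.toFun z.1 ((Z.sup σ.onIdem).1.1 ξ) ∈ _
      exact sub_mem (add_mem (Submodule.subset_span ⟨_, _, rfl⟩) (ih ξ))
        (Submodule.subset_span ⟨_, _, rfl⟩)
  refine Submodule.eq_top_iff'.2 fun ξ => Submodule.le_topologicalClosure _ ?_
  have h3 := h2 Z ξ
  rwa [h1] at h3

theorem HilbertRep.IsTight.exists_rep {σ : HilbertRep S H} (hσ : σ.IsTight) :
    ∃ ρ : (tightAction S).CStarGpd →⋆ₙₐ[ℂ] (H →L[ℂ] H),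
      ∀ s, ρ ((tightAction S).toCStar (tightGen s)) = σ.toFun s := by
  obtain ⟨π, hπ⟩ := HilbertRep.exists_integrated hσ
  exact ⟨CStarCompletion.lift π (norm_rep_le π), fun s =>
    (CStarCompletion.lift_toCStarCompletion π (norm_rep_le π) _).trans (hπ s)⟩

end Correspondence

/-- For a countable inverse semigroup `S` with zero and a Hilbert space `H`, tight representations
of `S` on `H` correspond bijectively to *-representations of `C*(G_tight)` on `H` (nondegenerate
ones, in case `E(S)` admits a finite cover), via `ρ(i(1_{s s*} δ_s)) = σ_s`; nondegenerate
representations correspond to each other. -/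
theorem theorem13p3 {S : Type u} [InverseSemigroupWithZero S] [Countable S]
    {H : Type v} [NormedAddCommGroup H] [InnerProductSpace ℂ H] [CompleteSpace H] :
    ∃ Ψ : {σ : HilbertRep S H // σ.IsTight} ≃
        {ρ : (tightAction S).CStarGpd →⋆ₙₐ[ℂ] (H →L[ℂ] H) //
          HasFiniteCover (Idem S) → NondegenerateRep ρ},
      (∀ σ s, (Ψ σ).1 ((tightAction S).toCStar (tightGen s)) = σ.1.toFun s) ∧
      ∀ σ, NondegenerateRep (Ψ σ).1 ↔ σ.1.Nondegenerate := by
  choose F hF using fun σ : {σ : HilbertRep S H // σ.IsTight} => σ.2.exists_rep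
  let Ψ : {σ : HilbertRep S H // σ.IsTight} →
      {ρ : (tightAction S).CStarGpd →⋆ₙₐ[ℂ] (H →L[ℂ] H) //
        HasFiniteCover (Idem S) → NondegenerateRep ρ} := fun σ =>
    ⟨F σ, fun hE => (nondegenerateRep_iff (hF σ)).2 (σ.2.nondegenerate hE)⟩
  have hΨ : Function.Bijective Ψ := by
    constructor
    -- The representation of $S$ is read off from the values on the generators.
    · intro σ τ h
      refine Subtype.ext (HilbertRep.ext fun s => ?_)
      rw [← hF σ, ← hF τ, show F σ = F τ from congrArg Subtype.val h]
    · intro ρ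
      -- The preimage is the restriction of $\rho$ to the generators. Integrating it gives a
      -- representation that agrees with $\rho$ on the generators, hence on $C_c(\mathcal G_{\rm
      -- tight})$ and on its completion.
      refine ⟨⟨_, isTight_ofRep ρ.1 ρ.2⟩, Subtype.ext (CStarCompletion.hom_ext fun f => ?_)⟩
      refine congrArg (fun π : (tightAction S).Cc →⋆ₙₐ[ℂ] (H →L[ℂ] H) => π f)
        (rep_ext (π := (F _).comp (tightAction S).toCStar)
          (π' := ρ.1.comp (tightAction S).toCStar) fun s => ?_)
      exact hF _ s
  exact ⟨Equiv.ofBijective Ψ hΨ, fun σ s => hF σ s, fun σ => nondegenerateRep_iff (hF σ)⟩
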